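/- **Theorem 3 (convergence of SCAFFOLD with option II).** Let $f=\frac1N\sum_{i=1}^N f_i$ on $\mathbb R^d$, where every $f_i$ is differentiable with $\beta$-Lipschitz gradient ($\beta>0$), and let $g_i(x)=g_i(x;\zeta)$, $\zeta\sim\nu_i$, be unbiased stochastic gradients of $f_i$ with $\mathbb E\|g_i(x)-\nabla f_i(x)\|^2\le\sigma^2$ for all $x$ and $i$. Nothing is assumed about how similar the clients are. Let $1\le S\le N$ and $K\ge1$. SCAFFOLD with local step-size $\eta_l>0$ and global step-size $\eta_g$ starts from $x^0\in\mathbb R^d$, control variates $c_1^0,\dots,c_N^0$ and $c^0=\frac1N\sum_i c_i^0$. In round $r\ge1$ a uniformly random set $\mathcal S^r$ of $S$ clients is drawn. Each $i\in\mathcal S^r$ sets $y_{i}\leftarrow x^{r-1}$, performs $K$ steps $y_i\leftarrow y_i-\eta_l\,(g_i(y_i)-c_i^{r-1}+c^{r-1})$ with fresh independent samples, and sets $c_i^{r}=c_i^{r-1}-c^{r-1}+\frac1{K\eta_l}(x^{r-1}-y_i)$. The other clients keep $c_i^r=c_i^{r-1}$. Then $x^r=x^{r-1}+\frac{\eta_g}{S}\sum_{i\in\mathcal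 S^r}(y_i-x^{r-1})$ and $c^r=c^{r-1}+\frac1N\sum_{i\in\mathcal S^r}(c_i^r-c_i^{r-1})$. For weights $w_0,\dots,w_R\ge0$, not all zero, the output $\bar x^R$ after $R$ rounds is $x^r$ with probability $w_r/\sum_q w_q$, $0\le r\le R$. *Warm start* means that, before the $R$ rounds, every client sets $c_i^0=\frac1K\sum_{k=1}^K g_i(x^0)$, the average over $K$ independent samples. In the convex cases let $x^\star$ be a minimizer of $f$, and for fixed $c_i^0$ put $$\tilde D^2=\|x^0-x^\star\|^2+\frac1{2N\beta^2}\sum_{i=1}^N\|c_i^0-\nabla f_i(x^\star)\|^2 ,\qquad D=\|x^0-x^\star\|,\qquad F=f(x^0)-f(x^\star).$$ There is a universal constant $C$ such that the following holds. In each item, "attained" means: there are weights and a local step-size $\eta_l>0$ satisfying the bound on $\eta_l$ given in that case for which the error of the output is integrable and the stated inequality holds. In the items on the number of rounds, $\eta_g=\sqrt S$, the start is warm, and $\epsilon>0$ is arbitrary. 1. **Strongly convex.** Let $\mu>0$ and $\langle\nabla f_i(x),y-x\rangle\le-\big(f_i(x)-f_i(y)+\frac\mu2\|x-y\|^2\big)$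 for all $i,x,y$. Bound on the step-size: $\eta_l\le\min\big(\frac1{81\beta K\eta_g},\frac{S}{15\mu NK\eta_g}\big)$. * For all fixed $c_i^0$, all $\eta_g\ge1$ and all $R\ge\max\big(\frac{162\beta}\mu,\frac{30N}S\big)$ it is attained that $$\mathbb E f(\bar x^R)-f(x^\star)\le C\Big(\frac{\sigma^2}{\mu RKS}\Big(1+\frac S{\eta_g^2}\Big)\log\Big(e+\frac{\mu^2RNK\tilde D^2}{\sigma^2}\Big)+\frac{N\mu}S\tilde D^2\exp\Big(-\min\Big\{\frac S{30N},\frac\mu{162\beta}\Big\}R\Big)\Big),$$ where the first summand is $0$ if $\sigma=0$. * For every $R\ge C\big(\frac{\sigma^2}{\mu KS\epsilon}+\frac\beta\mu+\frac NS\big)\log\big(e+\frac{N\mu D^2}{S\epsilon}\big)$ it is attained that $\mathbb E f(\bar x^R)-f(x^\star)<\epsilon$. 2. **General convex.** Let the inequality in 1 hold with $\mu=0$. Bound on the step-size: $\eta_l\le\frac1{81\beta K\eta_g}$. * For all fixed $c_i^0$, all $\eta_g\ge1$ and all $R\ge1$ it is attained that $$\mathbb E f(\bar x^R)-f(x^\star)\le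 C\Big(\frac{\sigma\tilde D}{\sqrt{RKS}}\sqrt{1+\frac S{\eta_g^2}}+\sqrt{\frac NS}\,\frac{\beta\tilde D^2}R\Big).$$ * For every $R\ge C\big(\frac{\sigma^2D^2}{KS\epsilon^2}+\frac{\beta D^2}\epsilon+\frac{NF}{S\epsilon}\big)$ it is attained that $\mathbb E f(\bar x^R)-f(x^\star)<\epsilon$. 3. **Non-convex.** Let $f\ge f^\star$ for some $f^\star\in\mathbb R$, and put $F=f(x^0)-f^\star$. Bound on the step-size: $\eta_l\le\frac1{24K\eta_g\beta}\big(\frac SN\big)^{2/3}$. * With warm start, for all $\eta_g\ge1$ and all $R\ge1$ it is attained that $$\mathbb E\|\nabla f(\bar x^R)\|^2\le C\Big(\frac{\sigma\sqrt{\beta F}}{\sqrt{RKS}}\sqrt{1+\frac S{\eta_g^2}}+\frac{\beta F}R\Big(\frac NS\Big)^{2/3}\Big).$$ * For every $R\ge C\big(\frac{\beta\sigma^2F}{KS\epsilon^2}+\big(\frac NS\big)^{2/3}\frac{\beta F}\epsilon\big)$ it is attained that $\mathbb E\|\nabla f(\bar x^R)\|^2<\epsilon$. -/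

import Mathlib

open MeasureTheory ProbabilityTheory
open scoped NNReal ENNReal Gradient InnerProductSpace

namespace Scaffold

/-- The parameter space `ℝ^d` with its Euclidean norm. -/
abbrev Vec (d : ℕ) : Type := EuclideanSpace ℝ (Fin d)

/-- The global objective `f = (1/N) ∑ᵢ fᵢ`. -/
noncomputable def objective {d N : ℕ} (f : Fin N → Vec d → ℝ) (x : Vec d) : ℝ :=
  (1 / (N : ℝ)) * ∑ i, f i x

/-- `h` is differentiable with `β`-Lipschitz gradient. -/
def IsSmooth {d : ℕ} (β : ℝ) (h : Vec d → ℝ) : Prop :=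
  Differentiable ℝ h ∧ ∀ x y, ‖∇ h x - ∇ h y‖ ≤ β * ‖x - y‖

/-- `μ`-convexity through gradients; `μ = 0` is plain convexity. -/
def IsMuConvex {d : ℕ} (μ : ℝ) (h : Vec d → ℝ) : Prop :=
  ∀ x y, ⟪∇ h x, y - x⟫_ℝ ≤ -(h x - h y + μ / 2 * ‖x - y‖ ^ 2)

/-- `g i x z` is an unbiased stochastic gradient of `f i` at `x` (where the data point `z` has law
`ν i`), with variance at most `σ²`. -/
structure IsStochasticGradient {d N : ℕ} {Ξ : Type*} [MeasurableSpace Ξ] (σ : ℝ)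
    (f : Fin N → Vec d → ℝ) (ν : Fin N → Measure Ξ) (g : Fin N → Vec d → Ξ → Vec d) : Prop where
  measurable : ∀ i, Measurable (Function.uncurry (g i))
  integrable : ∀ i x, Integrable (g i x) (ν i)
  unbiased : ∀ i x, ∫ z, g i x z ∂(ν i) = ∇ (f i) x
  integrable_sq : ∀ i x, Integrable (fun z => ‖g i x z - ∇ (f i) x‖ ^ 2) (ν i)
  variance_le : ∀ i x, ∫ z, ‖g i x z - ∇ (f i) x‖ ^ 2 ∂(ν i) ≤ σ ^ 2

/-- The randomness of the method: `A r` is the set of clients of round `r`, uniform among the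
`S`-element sets of clients, and `Z r i k` is the data point that client `i` uses in its `k`-th local
step of round `r`, with law `ν i`. All these random variables are mutually independent. -/
structure IsSampling {N : ℕ} {Ω Ξ : Type*} [MeasurableSpace Ω] [MeasurableSpace Ξ]
    (P : Measure Ω) (S : ℕ) (ν : Fin N → Measure Ξ)
    (A : ℕ → Ω → Finset (Fin N)) (Z : ℕ → Fin N → ℕ → Ω → Ξ) : Prop where
  measurable_clients : ∀ r, Measurable (A r)
  measurable_data : ∀ r i k, Measurable (Z r i k)
  uniform_clients : ∀ r, ∀ T : Finset (Fin N), T.card = S →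
    P (A r ⁻¹' {T}) = ((N.choose S : ℕ) : ℝ≥0∞)⁻¹
  law_data : ∀ r i k, P.map (Z r i k) = ν i
  indep_clients : iIndepFun A P
  indep_data : iIndepFun (fun p : ℕ × Fin N × ℕ => Z p.1 p.2.1 p.2.2) P
  indep_clients_data : IndepFun (fun ω (r : ℕ) => A r ω)
    (fun ω (p : ℕ × Fin N × ℕ) => Z p.1 p.2.1 p.2.2 ω) P

/-- The local model of a client after `k` local steps, started at the server model `x`, with server
control variate `c`, client control variate `ci` and data points `z 0, z 1, …`. -/
def localModel {d : ℕ} {Ξ : Type*} (gi : Vec d → Ξ → Vec d) (ηl : ℝ) (x c ci : Vec d)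
    (z : ℕ → Ξ) : ℕ → Vec d
  | 0 => x
  | k + 1 =>
    localModel gi ηl x c ci z k - ηl • (gi (localModel gi ηl x c ci z k) (z k) - ci + c)

/-- Server model, server control variate and client control variates. -/
structure State (d N : ℕ) where
  model : Vec d
  control : Vec d
  clientControl : Fin N → Vec d

/-- The new control variate of a client whose local model is `y` after the `K` local steps
(option II). -/
noncomputable def newControl {d : ℕ} (K : ℕ) (ηl : ℝ) (x c ci y : Vec d) : Vec d :=
  ci - c + (1 / ((K : ℝ) * ηl)) • (x - y)

/-- One communication round with client set `T` and data points `z`. -/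
noncomputable def round {d N : ℕ} {Ξ : Type*} (g : Fin N → Vec d → Ξ → Vec d) (S K : ℕ)
    (ηl ηg : ℝ) (T : Finset (Fin N)) (z : Fin N → ℕ → Ξ) (s : State d N) : State d N :=
  let y : Fin N → Vec d := fun i =>
    localModel (g i) ηl s.model s.control (s.clientControl i) (z i) K
  let cplus : Fin N → Vec d := fun i =>
    newControl K ηl s.model s.control (s.clientControl i) (y i)
  { model := s.model + (ηg / (S : ℝ)) • ∑ i ∈ T, (y i - s.model)
    control := s.control + (1 / (N : ℝ)) • ∑ i ∈ T, (cplus i - s.clientControl i)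
    clientControl := fun i => if i ∈ T then cplus i else s.clientControl i }

/-- The state after `r` rounds (round `r` uses `T r` and `z r`), started from the server model `x₀`,
the client control variates `c₀` and their average as server control variate. -/
noncomputable def run {d N : ℕ} {Ξ : Type*} (g : Fin N → Vec d → Ξ → Vec d) (S K : ℕ)
    (ηl ηg : ℝ) (x₀ : Vec d) (c₀ : Fin N → Vec d) (T : ℕ → Finset (Fin N))
    (z : ℕ → Fin N → ℕ → Ξ) : ℕ → State d N
  | 0 => ⟨x₀, (1 / (N : ℝ)) • ∑ i, c₀ i, c₀⟩
  | r + 1 => round g S K ηl ηg (T (r + 1)) (z (r + 1)) (run g S K ηl ηg x₀ c₀ T z r)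

/-- The random server models `x^0, x^1, …` for (possibly random) initial client control
variates `c₀`. -/
noncomputable def iterates {d N : ℕ} {Ω Ξ : Type*} (g : Fin N → Vec d → Ξ → Vec d) (S K : ℕ)
    (A : ℕ → Ω → Finset (Fin N)) (Z : ℕ → Fin N → ℕ → Ω → Ξ) (x₀ : Vec d)
    (c₀ : Fin N → Ω → Vec d) (ηl ηg : ℝ) (r : ℕ) (ω : Ω) : Vec d :=
  (run g S K ηl ηg x₀ (fun i => c₀ i ω) (fun q => A q ω) (fun q i k => Z q i k ω) r).model

/-- Warm start: each client starts with the control variate `g_i(x₀)`, computed on a batch of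
`K` data points. -/
noncomputable def warmStart {d N : ℕ} {Ω Ξ : Type*} (g : Fin N → Vec d → Ξ → Vec d) (K : ℕ)
    (Z : ℕ → Fin N → ℕ → Ω → Ξ) (x₀ : Vec d) (i : Fin N) (ω : Ω) : Vec d :=
  (1 / (K : ℝ)) • ∑ k ∈ Finset.range K, g i x₀ (Z 0 i k ω)

/-- The law of the output after `R` rounds: `x^r` with probability proportional to `w r`,
for `r = 0, …, R`. -/
noncomputable def outputLaw {d : ℕ} {Ω : Type*} [MeasurableSpace Ω] (P : Measure Ω)
    (x : ℕ → Ω → Vec d) (R : ℕ) (w : ℕ → ℝ≥0) : Measure (Vec d) :=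
  ∑ r ∈ Finset.range (R + 1),
    ((w r / ∑ q ∈ Finset.range (R + 1), w q : ℝ≥0) : ℝ≥0∞) • P.map (x r)

/-- For some positive local step-size at most `ηmax` and some weights, the output after `R` rounds
has integrable error `err`; its expectation satisfies `Q`. The function `x` maps a local step-size
to the random server models. -/
def OutputSatisfies {d : ℕ} {Ω : Type*} [MeasurableSpace Ω] (P : Measure Ω)
    (x : ℝ → ℕ → Ω → Vec d) (ηmax : ℝ) (R : ℕ) (err : Vec d → ℝ) (Q : ℝ → Prop) : Prop :=
  ∃ ηl : ℝ, 0 < ηl ∧ ηl ≤ ηmax ∧ ∃ w : ℕ → ℝ≥0, 0 < ∑ r ∈ Finset.range (R + 1), w r ∧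
    Integrable err (outputLaw P (x ηl) R w) ∧ Q (∫ v, err v ∂(outputLaw P (x ηl) R w))

/-- `D̃² = ‖x₀ - x⋆‖² + (1 / (2Nβ²)) ∑ᵢ ‖cᵢ - ∇fᵢ(x⋆)‖²`. -/
noncomputable def initDistSq {d N : ℕ} (f : Fin N → Vec d → ℝ) (β : ℝ) (x₀ xs : Vec d)
    (c : Fin N → Vec d) : ℝ :=
  ‖x₀ - xs‖ ^ 2 + 1 / (2 * N * β ^ 2) * ∑ i, ‖c i - ∇ (f i) xs‖ ^ 2

end Scaffold

/-! Heterogeneity of the clients enters only through the mismatch between the gradients of the f_i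
and the control variates, and the iteration itself reduces this mismatch. With option II the new
control variate of a sampled client is the mean of its K local stochastic gradients
(`newControl_y_last`). Every control variate c_i is therefore split into an exact part h_i and a
noise part of second moment at most σ²/K. After a refresh h_i is a mean of true gradients at local
points. The split survives every round (`next_noise_le`), and only h_i enters the potentials.

Local models are defined for all clients, sampled or not. The client set of a round is then
independent of all of them, and its expectation is a plain mean over the S-element subsets. With
effective step a = K η_l η_g, a round is x ← x - a · direction, and three facts drive everything.
Against any vector determined by the past, the direction has the same expected inner product as the
mean local gradient averaged over all N clients (`integral_inner_direction`). Its second moment is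
at most a constant times β²·drift + exactSq + σ²/(KS) (`integral_direction_sq_le`). The drift of the
local models is at most (K η_l)² times a combination of exactSq and σ²/K (`drift_le`). The factor
1/S in the noise has two sources: fresh noises are orthogonal, and the old control noise is centered
over the clients, so that sampling without replacement averages it out. Altogether a round costs
noise of order a² σ²/(KS) · (1 + S/η_g²).

It remains to control exactSq, the mean square of ∇f_i(x) - h_i + h̄, where h̄ is the mean of the
h_j. In the convex cases it is at most 4β times the gap f(x) - f(x⋆) plus 2C, where C is the mean
square of h_i - ∇f_i(x⋆). A client is refreshed with probability S/N, so C contracts by 1 - S/N up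
to gap and drift, and ‖x - x⋆‖² + 13 (N/S) a² C is a potential (`convex_round_le`). In the
non-convex case exactSq is at most 2‖∇f(x)‖² + 2β²·lag, where the lag is the mean square distance
from x to the points at which the gradients in h_i were taken, and f + 40 (N/S) β³ a² · lag is a
potential (`nonconvex_round_le`). One round can raise the lag by a multiple of (N/S) a² ‖∇f‖²;
weighted, this is (aβ)³ (N/S)² · a‖∇f‖², which must stay below a‖∇f‖². Hence the restriction aβ ≲
(S/N)^(2/3).

Summing these recursions with uniform weights, or with geometric weights under strong convexity, and
choosing a to balance initial error against noise gives all the rates. -/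

namespace Scaffold

set_option linter.unusedSectionVars false

/-! ### Smooth convex functions and means of vectors. -/

section Deterministic

variable {d N : ℕ} {β μ : ℝ} {h : Vec d → ℝ} {f : Fin N → Vec d → ℝ}

theorem IsSmooth.continuous_gradient (hh : IsSmooth β h) : Continuous (∇ h) := by
  have : LipschitzWith (Real.toNNReal β) (∇ h) := by
    refine LipschitzWith.of_dist_le_mul fun x y => ?_
    rw [dist_eq_norm, dist_eq_norm]
    refine (hh.2 x y).trans ?_
    gcongr
    exact Real.le_coe_toNNReal β
  exact this.continuous

theorem IsSmooth.measurable_gradient (hh : IsSmooth β h) : Measurable (∇ h) :=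
  hh.continuous_gradient.measurable

/-- Along the segment from x to y the difference φ of the two sides has nonpositive derivative,
because the gradient is Lipschitz. -/
theorem IsSmooth.le_quadratic (hh : IsSmooth β h) (x y : Vec d) :
    h y ≤ h x + ⟪∇ h x, y - x⟫_ℝ + β / 2 * ‖y - x‖ ^ 2 := by
  set v := y - x with hv
  let φ : ℝ → ℝ := fun t => h (x + t • v) - t * ⟪∇ h x, v⟫_ℝ - β / 2 * t ^ 2 * ‖v‖ ^ 2
  have hd : ∀ t : ℝ, HasDerivAt φ (⟪∇ h (x + t • v), v⟫_ℝ - ⟪∇ h x, v⟫_ℝ - β * t * ‖v‖ ^ 2) t := by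
    intro t
    have h1 : HasDerivAt (fun t : ℝ => x + t • v) v t := by
      simpa using ((hasDerivAt_id t).smul_const v).const_add x
    have h2 := (hh.1 (x + t • v)).hasGradientAt.hasFDerivAt.comp_hasDerivAt t h1
    have h3 : HasDerivAt (fun t : ℝ => t * ⟪∇ h x, v⟫_ℝ) ⟪∇ h x, v⟫_ℝ t := by
      simpa using (hasDerivAt_id t).mul_const ⟪∇ h x, v⟫_ℝ
    have h4 : HasDerivAt (fun t : ℝ => β / 2 * t ^ 2 * ‖v‖ ^ 2) (β * t * ‖v‖ ^ 2) t := by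
      have := (((hasDerivAt_id t).pow 2).const_mul (β / 2)).mul_const (‖v‖ ^ 2)
      refine this.congr_deriv ?_
      change β / 2 * ((2 : ℕ) * t ^ 1 * 1) * ‖v‖ ^ 2 = _
      push_cast
      ring
    refine ((h2.sub h3).sub h4).congr_deriv ?_
    simp
  have hanti : AntitoneOn φ (Set.Icc 0 1) := by
    refine antitoneOn_of_deriv_nonpos (convex_Icc 0 1)
      (fun t _ => (hd t).continuousAt.continuousWithinAt)
      (fun t _ => (hd t).differentiableAt.differentiableWithinAt) fun t ht => ?_
    rw [interior_Icc] at ht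
    rw [(hd t).deriv, ← inner_sub_left]
    have h1 : ⟪∇ h (x + t • v) - ∇ h x, v⟫_ℝ ≤ (β * (t * ‖v‖)) * ‖v‖ := by
      refine (real_inner_le_norm _ _).trans ?_
      gcongr
      refine (hh.2 _ _).trans (le_of_eq ?_)
      rw [add_sub_cancel_left, norm_smul, Real.norm_of_nonneg ht.1.le]
    nlinarith
  have h01 := hanti (Set.left_mem_Icc.2 zero_le_one) (Set.right_mem_Icc.2 zero_le_one) zero_le_one
  simp only [φ, hv] at h01
  simp only [one_smul, zero_smul, add_zero, zero_mul, one_mul, add_sub_cancel] at h01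
  rw [hv]
  nlinarith

theorem IsMuConvex.zero (hμ : 0 ≤ μ) (hh : IsMuConvex μ h) : IsMuConvex 0 h := by
  intro x y
  have := hh x y
  have : 0 ≤ μ / 2 * ‖x - y‖ ^ 2 := by positivity
  linarith

/-- Co-coercivity. At the point x - w/β, with w the difference of the gradients, the quadratic upper
bound from x is compared with the tangent lower bound from y. -/
theorem norm_gradient_sub_sq_le (hβ : 0 < β) (hh : IsSmooth β h) (hc : IsMuConvex 0 h)
    (x y : Vec d) :
    ‖∇ h x - ∇ h y‖ ^ 2 ≤ 2 * β * (h x - h y - ⟪∇ h y, x - y⟫_ℝ) := by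
  set w := ∇ h x - ∇ h y with hw
  have h1 := hh.le_quadratic x (x - (1 / β) • w)
  have h2 := hc y (x - (1 / β) • w)
  have e1 : x - (1 / β) • w - x = -((1 / β) • w) := by abel
  have e2 : x - (1 / β) • w - y = (x - y) - (1 / β) • w := by abel
  rw [e1, inner_neg_right, inner_smul_right, norm_neg, norm_smul] at h1
  rw [e2, inner_sub_right, inner_smul_right] at h2
  have e3 : ⟪∇ h x, w⟫_ℝ - ⟪∇ h y, w⟫_ℝ = ‖w‖ ^ 2 := by
    rw [← inner_sub_left, ← hw, real_inner_self_eq_norm_sq]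
  have e4 : β / 2 * (‖1 / β‖ * ‖w‖) ^ 2 = 1 / (2 * β) * ‖w‖ ^ 2 := by
    rw [Real.norm_of_nonneg (by positivity)]
    field_simp
  rw [e4] at h1
  have h3 : 1 / (2 * β) * ‖w‖ ^ 2 ≤ h x - h y - ⟪∇ h y, x - y⟫_ℝ := by
    have : 1 / β * ‖w‖ ^ 2 = 1 / β * ⟪∇ h x, w⟫_ℝ - 1 / β * ⟪∇ h y, w⟫_ℝ := by rw [← e3]; ring
    have e5 : 1 / β = 2 * (1 / (2 * β)) := by field_simp
    nlinarith
  calc ‖w‖ ^ 2 = 2 * β * (1 / (2 * β) * ‖w‖ ^ 2) := by field_simp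
    _ ≤ _ := by gcongr

/-- Convexity at a perturbed point. -/
theorem inner_gradient_le (hh : IsSmooth β h) (hμ : 0 ≤ μ) (hc : IsMuConvex μ h)
    (x y z : Vec d) :
    ⟪∇ h y, z - x⟫_ℝ ≤ -(h x - h z) - μ / 4 * ‖x - z‖ ^ 2 + β * ‖y - x‖ ^ 2 := by
  have h1 := hc y z
  have h2 := hh.le_quadratic y x
  -- In effect μ ≤ β: adding the convexity inequalities for (x, y) and (y, x) bounds the gradient
  -- difference from below. It is kept multiplied by the norm, as no second point need exist.
  -- Together with `h5` it lets β/2 absorb the loss of moving the quadratic term from y to x.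
  have h3 : μ * ‖y - x‖ ^ 2 ≤ β * ‖y - x‖ ^ 2 := by
    have a1 := hc y x
    have a2 := hc x y
    have a3 : ⟪∇ h x, y - x⟫_ℝ + ⟪∇ h y, x - y⟫_ℝ = -⟪∇ h x - ∇ h y, x - y⟫_ℝ := by
      rw [inner_sub_left, ← neg_sub x y, inner_neg_right]; ring
    have a4 : ⟪∇ h x - ∇ h y, x - y⟫_ℝ ≤ β * ‖x - y‖ * ‖x - y‖ :=
      (real_inner_le_norm _ _).trans (by gcongr; exact hh.2 x y)
    rw [norm_sub_rev x y] at a2 a4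
    nlinarith
  have h4 : ⟪∇ h y, z - x⟫_ℝ = ⟪∇ h y, z - y⟫_ℝ - ⟪∇ h y, x - y⟫_ℝ := by
    rw [← inner_sub_right]; congr 1; abel
  have h5 : ‖x - z‖ ^ 2 ≤ 2 * ‖y - z‖ ^ 2 + 2 * ‖y - x‖ ^ 2 := by
    have : x - z = (y - z) - (y - x) := by abel
    rw [this]
    have a1 := norm_sub_le (y - z) (y - x)
    have a2 := norm_nonneg ((y - z) - (y - x))
    nlinarith [sq_nonneg (‖y - z‖ - ‖y - x‖)]
  rw [norm_sub_rev x y] at h2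
  nlinarith

theorem hasGradientAt_objective (hf : ∀ i, Differentiable ℝ (f i)) (x : Vec d) :
    HasGradientAt (objective f) ((1 / (N : ℝ)) • ∑ i, ∇ (f i) x) x := by
  have h1 : HasFDerivAt (objective f)
      ((1 / (N : ℝ)) • ∑ i, InnerProductSpace.toDual ℝ (Vec d) (∇ (f i) x)) x :=
    (HasFDerivAt.fun_sum fun i _ => (hf i x).hasGradientAt.hasFDerivAt).const_mul _
  rw [hasGradientAt_iff_hasFDerivAt]
  refine h1.congr_fderiv ?_
  ext v
  simp

theorem gradient_objective (hf : ∀ i, Differentiable ℝ (f i)) (x : Vec d) :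
    ∇ (objective f) x = (1 / (N : ℝ)) • ∑ i, ∇ (f i) x :=
  (hasGradientAt_objective hf x).gradient

theorem norm_average_sq_le {E : Type*} [NormedAddCommGroup E] [InnerProductSpace ℝ E] {ι : Type*}
    (s : Finset ι) (a : ι → E) :
    ‖(1 / (s.card : ℝ)) • ∑ i ∈ s, a i‖ ^ 2 ≤ 1 / (s.card : ℝ) * ∑ i ∈ s, ‖a i‖ ^ 2 := by
  rcases s.eq_empty_or_nonempty with rfl | hs
  · simp
  have hc : (0 : ℝ) < s.card := by exact_mod_cast hs.card_pos
  rw [norm_smul, Real.norm_of_nonneg (by positivity), mul_pow]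
  have h1 : ‖∑ i ∈ s, a i‖ ^ 2 ≤ s.card * ∑ i ∈ s, ‖a i‖ ^ 2 :=
    (pow_le_pow_left₀ (norm_nonneg _) (norm_sum_le _ _) 2).trans sq_sum_le_card_mul_sum_sq
  calc (1 / (s.card : ℝ)) ^ 2 * ‖∑ i ∈ s, a i‖ ^ 2
      ≤ (1 / (s.card : ℝ)) ^ 2 * (s.card * ∑ i ∈ s, ‖a i‖ ^ 2) := by gcongr
    _ = _ := by field_simp

theorem norm_average_fin_sq_le {E : Type*} [NormedAddCommGroup E] [InnerProductSpace ℝ E]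
    (a : Fin N → E) :
    ‖(1 / (N : ℝ)) • ∑ i, a i‖ ^ 2 ≤ 1 / (N : ℝ) * ∑ i, ‖a i‖ ^ 2 := by
  simpa using norm_average_sq_le Finset.univ a

theorem norm_average_range_sq_le {E : Type*} [NormedAddCommGroup E] [InnerProductSpace ℝ E]
    (K : ℕ) (a : ℕ → E) :
    ‖(1 / (K : ℝ)) • ∑ k ∈ Finset.range K, a k‖ ^ 2
      ≤ 1 / (K : ℝ) * ∑ k ∈ Finset.range K, ‖a k‖ ^ 2 := by
  simpa using norm_average_sq_le (Finset.range K) a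

theorem average_sub {E : Type*} [AddCommGroup E] [Module ℝ E] (a b : Fin N → E) :
    (1 / (N : ℝ)) • ∑ i, (a i - b i) = (1 / (N : ℝ)) • ∑ i, a i - (1 / (N : ℝ)) • ∑ i, b i := by
  rw [Finset.sum_sub_distrib, smul_sub]

/-- Centering does not increase the mean square. -/
theorem average_norm_sub_average_sq_le {E : Type*} [NormedAddCommGroup E] [InnerProductSpace ℝ E]
    (hN : 1 ≤ N) (a : Fin N → E) :
    1 / (N : ℝ) * ∑ i, ‖a i - (1 / (N : ℝ)) • ∑ j, a j‖ ^ 2 ≤ 1 / (N : ℝ) * ∑ i, ‖a i‖ ^ 2 := by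
  have hN' : (0 : ℝ) < N := by positivity
  set m := (1 / (N : ℝ)) • ∑ j, a j with hm
  have h1 : ∑ i, ‖a i - m‖ ^ 2 = ∑ i, ‖a i‖ ^ 2 - 2 * ⟪∑ i, a i, m⟫_ℝ + N * ‖m‖ ^ 2 := by
    simp_rw [norm_sub_sq_real, Finset.sum_add_distrib, Finset.sum_sub_distrib, sum_inner,
      Finset.mul_sum]
    simp
  have h2 : ∑ i, a i = (N : ℝ) • m := by
    rw [hm, smul_smul]; simp [hN'.ne']
  rw [h1, h2, real_inner_smul_left, real_inner_self_eq_norm_sq]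
  gcongr
  nlinarith [mul_nonneg hN'.le (sq_nonneg ‖m‖)]

theorem isSmooth_objective (hN : 1 ≤ N) (hf : ∀ i, IsSmooth β (f i)) :
    IsSmooth β (objective f) := by
  have hd : ∀ i, Differentiable ℝ (f i) := fun i => (hf i).1
  refine ⟨fun x => (hasGradientAt_objective hd x).differentiableAt, fun x y => ?_⟩
  have hN' : (0 : ℝ) < N := by positivity
  rw [gradient_objective hd, gradient_objective hd, ← average_sub, norm_smul,
    Real.norm_of_nonneg (by positivity)]
  calc 1 / (N : ℝ) * ‖∑ i, (∇ (f i) x - ∇ (f i) y)‖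
      ≤ 1 / (N : ℝ) * ∑ i : Fin N, β * ‖x - y‖ := by
        gcongr
        exact (norm_sum_le _ _).trans (Finset.sum_le_sum fun i _ => (hf i).2 x y)
    _ = β * ‖x - y‖ := by
        simp; field_simp

theorem gradient_eq_zero_of_forall_le {x : Vec d} (hx : ∀ y, h x ≤ h y) : ∇ h x = 0 := by
  have : IsLocalMin h x := Filter.Eventually.of_forall hx
  simp [gradient, this.fderiv_eq_zero]

/-- Co-coercivity averaged over the clients: the linear terms cancel because the gradients ∇f_i(xs)
sum to zero at a minimizer of the mean. No single f_i needs to be minimal there. -/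
theorem average_norm_gradient_sub_sq_le (hβ : 0 < β) (hf : ∀ i, IsSmooth β (f i))
    (hc : ∀ i, IsMuConvex 0 (f i)) {xs : Vec d}
    (hxs : ∀ x, objective f xs ≤ objective f x) (x : Vec d) :
    1 / (N : ℝ) * ∑ i, ‖∇ (f i) x - ∇ (f i) xs‖ ^ 2
      ≤ 2 * β * (objective f x - objective f xs) := by
  have h0 := gradient_eq_zero_of_forall_le hxs
  rw [gradient_objective fun i => (hf i).1] at h0
  have h1 : 1 / (N : ℝ) * ∑ i, ⟪∇ (f i) xs, x - xs⟫_ℝ = 0 := by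
    rw [← sum_inner, ← real_inner_smul_left, h0, inner_zero_left]
  calc 1 / (N : ℝ) * ∑ i, ‖∇ (f i) x - ∇ (f i) xs‖ ^ 2
      ≤ 1 / (N : ℝ) * ∑ i, 2 * β * (f i x - f i xs - ⟪∇ (f i) xs, x - xs⟫_ℝ) := by
        gcongr with i
        exact norm_gradient_sub_sq_le hβ (hf i) (hc i) x xs
    _ = 2 * β * (objective f x - objective f xs)
          - 2 * β * (1 / (N : ℝ) * ∑ i, ⟪∇ (f i) xs, x - xs⟫_ℝ) := by
        rw [← Finset.mul_sum, Finset.sum_sub_distrib, Finset.sum_sub_distrib, objective, objective]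
        ring
    _ = _ := by rw [h1]; ring

end Deterministic

/-! ### Means over S-element subsets. -/

section Subsets

variable {N S : ℕ} {E : Type*} [NormedAddCommGroup E] [InnerProductSpace ℝ E]

/-- The mean of `φ` over the `S`-element subsets of `Fin N`. -/
noncomputable def subsetMean (N S : ℕ) (φ : Finset (Fin N) → ℝ) : ℝ :=
  1 / (N.choose S : ℝ) * ∑ T ∈ Finset.powersetCard S Finset.univ, φ T

theorem subsetMean_mono {φ ψ : Finset (Fin N) → ℝ} (h : ∀ T, T.card = S → φ T ≤ ψ T) :
    subsetMean N S φ ≤ subsetMean N S ψ := by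
  unfold subsetMean
  gcongr with T hT
  exact h T (Finset.mem_powersetCard.1 hT).2

theorem subsetMean_congr {φ ψ : Finset (Fin N) → ℝ} (h : ∀ T, T.card = S → φ T = ψ T) :
    subsetMean N S φ = subsetMean N S ψ := by
  unfold subsetMean
  rw [Finset.sum_congr rfl fun T hT => h T (Finset.mem_powersetCard.1 hT).2]

theorem subsetMean_add (φ ψ : Finset (Fin N) → ℝ) :
    subsetMean N S (fun T => φ T + ψ T) = subsetMean N S φ + subsetMean N S ψ := by
  simp only [subsetMean, Finset.sum_add_distrib, mul_add]

theorem subsetMean_const_mul (a : ℝ) (φ : Finset (Fin N) → ℝ) :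
    subsetMean N S (fun T => a * φ T) = a * subsetMean N S φ := by
  simp only [subsetMean, ← Finset.mul_sum]
  ring

theorem subsetMean_const (hSN : S ≤ N) (a : ℝ) : subsetMean N S (fun _ => a) = a := by
  have : (N.choose S : ℝ) ≠ 0 := by exact_mod_cast (Nat.choose_pos hSN).ne'
  simp [subsetMean, this]

theorem sum_powersetCard_sum_mem (a : Fin N → ℝ) (hS : 1 ≤ S) :
    ∑ T ∈ Finset.powersetCard S (Finset.univ : Finset (Fin N)), ∑ i ∈ T, a i
      = ((N - 1).choose (S - 1) : ℝ) * ∑ i, a i := by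
  have h1 : ∀ T : Finset (Fin N), ∑ i ∈ T, a i = ∑ i, if i ∈ T then a i else 0 := by
    intro T; simp
  rw [Finset.sum_congr rfl fun T _ => h1 T, Finset.sum_comm, Finset.mul_sum]
  refine Finset.sum_congr rfl fun i _ => ?_
  rw [← Finset.sum_filter, Finset.sum_const, nsmul_eq_mul]
  congr 2
  have := Finset.card_filter_powersetCard_subset {i} (Finset.univ : Finset (Fin N)) S
    (Finset.subset_univ _) (by simpa using hS)
  simpa using this

theorem choose_pred_div (hS : 1 ≤ S) (hSN : S ≤ N) :
    1 / (N.choose S : ℝ) * ((N - 1).choose (S - 1) : ℝ) = S / N := by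
  obtain ⟨s, rfl⟩ := Nat.exists_eq_add_of_le' hS
  obtain ⟨n, rfl⟩ := Nat.exists_eq_add_of_le' (hS.trans hSN)
  have h1 : ((n + 1).choose (s + 1) : ℝ) ≠ 0 := by exact_mod_cast (Nat.choose_pos hSN).ne'
  have h2 : ((n + 1 : ℕ) : ℝ) * (n.choose s : ℝ) = (n + 1).choose (s + 1) * ((s + 1 : ℕ) : ℝ) := by
    exact_mod_cast Nat.add_one_mul_choose_eq n s
  simp only [Nat.add_sub_cancel]
  rw [div_mul_eq_mul_div, one_mul, div_eq_div_iff h1 (by positivity)]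
  linarith

theorem subsetMean_sum_mem (hS : 1 ≤ S) (hSN : S ≤ N) (a : Fin N → ℝ) :
    subsetMean N S (fun T => ∑ i ∈ T, a i) = (S : ℝ) / N * ∑ i, a i := by
  rw [subsetMean, sum_powersetCard_sum_mem a hS, ← mul_assoc, choose_pred_div hS hSN]

theorem subsetMean_ite_mem (hS : 1 ≤ S) (hSN : S ≤ N) (i : Fin N) (a b : ℝ) :
    subsetMean N S (fun T => if i ∈ T then a else b) = (S : ℝ) / N * a + (1 - (S : ℝ) / N) * b := by
  have h := subsetMean_sum_mem hS hSN (fun j => if j = i then a - b else 0)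
  simp only [Finset.sum_ite_eq', Finset.mem_univ, if_true] at h
  have h2 : subsetMean N S (fun T => if i ∈ T then a else b)
      = subsetMean N S (fun T => (if i ∈ T then a - b else 0) + b) := by
    congr 1; ext T; split_ifs <;> ring
  rw [h2, subsetMean_add, subsetMean_const hSN, h]
  ring

theorem subsetMean_norm_average_sq_le (hS : 1 ≤ S) (hSN : S ≤ N) (a : Fin N → E) :
    subsetMean N S (fun T => ‖(1 / (S : ℝ)) • ∑ i ∈ T, a i‖ ^ 2)
      ≤ 1 / (N : ℝ) * ∑ i, ‖a i‖ ^ 2 := by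
  have hS' : (0 : ℝ) < S := by positivity
  calc subsetMean N S (fun T => ‖(1 / (S : ℝ)) • ∑ i ∈ T, a i‖ ^ 2)
      ≤ subsetMean N S (fun T => 1 / (S : ℝ) * ∑ i ∈ T, ‖a i‖ ^ 2) := by
        refine subsetMean_mono fun T hT => ?_
        have := norm_average_sq_le T a
        rwa [hT] at this
    _ = _ := by
        rw [subsetMean_const_mul, subsetMean_sum_mem hS hSN]
        field_simp

/-- Any two distinct clients lie in the same number c of S-element subsets. The off-diagonal terms
therefore add up to c(‖∑ b_i‖² - ∑ ‖b_i‖²), which is nonpositive for centered vectors: sampling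
without replacement is at least as good as independent sampling. -/
theorem sum_powersetCard_norm_sum_sq_le (hS : 1 ≤ S) (b : Fin N → E) (hb : ∑ i, b i = 0) :
    ∑ T ∈ Finset.powersetCard S (Finset.univ : Finset (Fin N)), ‖∑ i ∈ T, b i‖ ^ 2
      ≤ ((N - 1).choose (S - 1) : ℝ) * ∑ i, ‖b i‖ ^ 2 := by
  have h1 : ∀ T : Finset (Fin N), ‖∑ i ∈ T, b i‖ ^ 2
      = ∑ i ∈ T, ‖b i‖ ^ 2
        + ∑ i, ∑ j, if i ≠ j ∧ {i, j} ⊆ T then ⟪b i, b j⟫_ℝ else 0 := by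
    intro T
    have e1 : ‖∑ i ∈ T, b i‖ ^ 2 = ∑ i, ∑ j, if i ∈ T ∧ j ∈ T then ⟪b i, b j⟫_ℝ else 0 := by
      rw [← real_inner_self_eq_norm_sq, sum_inner]
      simp_rw [inner_sum, ite_and]
      simp
    have e2 : ∑ i ∈ T, ‖b i‖ ^ 2
        = ∑ i, ∑ j, if i = j ∧ i ∈ T then ⟪b i, b j⟫_ℝ else 0 := by
      simp_rw [ite_and]
      simp
    rw [e1, e2, ← Finset.sum_add_distrib]
    refine Finset.sum_congr rfl fun i _ => ?_
    rw [← Finset.sum_add_distrib]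
    refine Finset.sum_congr rfl fun j _ => ?_
    by_cases hij : i = j
    · subst hij; simp
    · simp [hij, Finset.insert_subset_iff]
  simp_rw [h1]
  rw [Finset.sum_add_distrib, sum_powersetCard_sum_mem _ hS]
  suffices h : ∑ T ∈ Finset.powersetCard S (Finset.univ : Finset (Fin N)),
      ∑ i, ∑ j, (if i ≠ j ∧ {i, j} ⊆ T then ⟪b i, b j⟫_ℝ else 0) ≤ 0 by linarith
  obtain ⟨c, hc0, hc⟩ : ∃ c : ℝ, 0 ≤ c ∧ ∀ i j : Fin N, i ≠ j →
      (((Finset.powersetCard S (Finset.univ : Finset (Fin N))).filter ({i, j} ⊆ ·)).card : ℝ)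
        = c := by
    -- For S = 1 no pair fits into a subset, but truncated subtraction would make the binomial
    -- coefficient equal to 1.
    by_cases h2 : 2 ≤ S
    · refine ⟨((N - 2).choose (S - 2) : ℝ), by positivity, fun i j hij => ?_⟩
      have := Finset.card_filter_powersetCard_subset {i, j} (Finset.univ : Finset (Fin N)) S
        (Finset.subset_univ _) (by rw [Finset.card_pair hij]; exact h2)
      rw [this, Finset.card_pair hij]
      simp
    · refine ⟨0, le_rfl, fun i j hij => ?_⟩
      rw [Nat.cast_eq_zero, Finset.card_eq_zero, Finset.filter_eq_empty_iff]
      intro T hT hsub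
      have := Finset.card_le_card hsub
      rw [Finset.card_pair hij, (Finset.mem_powersetCard.1 hT).2] at this
      exact h2 this
  have h3 : ∑ T ∈ Finset.powersetCard S (Finset.univ : Finset (Fin N)),
      ∑ i, ∑ j, (if i ≠ j ∧ {i, j} ⊆ T then ⟪b i, b j⟫_ℝ else 0)
      = ∑ i, ∑ j, if i ≠ j then c * ⟪b i, b j⟫_ℝ else 0 := by
    rw [Finset.sum_comm]
    refine Finset.sum_congr rfl fun i _ => ?_
    rw [Finset.sum_comm]
    refine Finset.sum_congr rfl fun j _ => ?_
    by_cases hij : i = j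
    · simp [hij]
    · simp only [ne_eq, hij, not_false_eq_true, true_and, if_true]
      rw [← Finset.sum_filter, Finset.sum_const, nsmul_eq_mul, hc i j hij]
  have h4 : ∑ i, ∑ j, (if i ≠ j then c * ⟪b i, b j⟫_ℝ else 0)
      = c * ⟪∑ i, b i, ∑ j, b j⟫_ℝ - c * ∑ i, ‖b i‖ ^ 2 := by
    rw [sum_inner, Finset.mul_sum, Finset.mul_sum, ← Finset.sum_sub_distrib]
    refine Finset.sum_congr rfl fun i _ => ?_
    rw [inner_sum, Finset.mul_sum, eq_sub_iff_add_eq]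
    have : c * ‖b i‖ ^ 2 = ∑ j, if i = j then c * ⟪b i, b j⟫_ℝ else 0 := by simp
    rw [this, ← Finset.sum_add_distrib]
    refine Finset.sum_congr rfl fun j _ => ?_
    by_cases hij : i = j <;> simp [hij]
  rw [h3, h4, hb]
  simp only [inner_zero_left, mul_zero, zero_sub, Left.neg_nonpos_iff]
  positivity

theorem subsetMean_norm_average_sq_le_of_centered (hS : 1 ≤ S) (hSN : S ≤ N) (b : Fin N → E)
    (hb : ∑ i, b i = 0) :
    subsetMean N S (fun T => ‖(1 / (S : ℝ)) • ∑ i ∈ T, b i‖ ^ 2)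
      ≤ 1 / (S : ℝ) * (1 / (N : ℝ) * ∑ i, ‖b i‖ ^ 2) := by
  have hS' : (0 : ℝ) < S := by positivity
  have h1 : subsetMean N S (fun T => ‖∑ i ∈ T, b i‖ ^ 2) ≤ (S : ℝ) / N * ∑ i, ‖b i‖ ^ 2 := by
    rw [subsetMean, ← choose_pred_div hS hSN, mul_assoc]
    gcongr
    exact sum_powersetCard_norm_sum_sq_le hS b hb
  simp_rw [norm_smul, mul_pow, Real.norm_of_nonneg (one_div_nonneg.2 hS'.le)]
  rw [subsetMean_const_mul]
  calc (1 / (S : ℝ)) ^ 2 * subsetMean N S (fun T => ‖∑ i ∈ T, b i‖ ^ 2)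
      ≤ (1 / (S : ℝ)) ^ 2 * ((S : ℝ) / N * ∑ i, ‖b i‖ ^ 2) := by gcongr
    _ = _ := by field_simp

end Subsets

/-! ### Independence and integration with frozen variables. -/

section Probability

/-- The intersections of a set of m₂ with a set of m₃ form a π-system generating m₂ ⊔ m₃, and on it
the product formula follows from the two given independences. -/
theorem indep_sup_right {Ω : Type*} {m₁ m₂ m₃ mΩ : MeasurableSpace Ω} {P : Measure Ω}
    [IsProbabilityMeasure P] (h₁ : m₁ ≤ mΩ) (h₂ : m₂ ≤ mΩ) (h₃ : m₃ ≤ mΩ)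
    (h₁₂ : Indep m₁ m₂ P) (h₁₂₃ : Indep (m₁ ⊔ m₂) m₃ P) : Indep m₁ (m₂ ⊔ m₃) P := by
  let π : Set (Set Ω) := {s | ∃ a b, MeasurableSet[m₂] a ∧ MeasurableSet[m₃] b ∧ s = a ∩ b}
  have hgen : m₂ ⊔ m₃ = MeasurableSpace.generateFrom π := by
    apply le_antisymm
    · refine sup_le (fun a ha => ?_) (fun b hb => ?_)
      · exact MeasurableSpace.measurableSet_generateFrom
          ⟨a, Set.univ, ha, MeasurableSet.univ, (Set.inter_univ a).symm⟩
      · exact MeasurableSpace.measurableSet_generateFrom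
          ⟨Set.univ, b, MeasurableSet.univ, hb, (Set.univ_inter b).symm⟩
    · refine MeasurableSpace.generateFrom_le ?_
      rintro _ ⟨a, b, ha, hb, rfl⟩
      exact MeasurableSet.inter ((le_sup_left : m₂ ≤ m₂ ⊔ m₃) a ha)
        ((le_sup_right : m₃ ≤ m₂ ⊔ m₃) b hb)
  have hpi : IsPiSystem π := by
    rintro _ ⟨a, b, ha, hb, rfl⟩ _ ⟨a', b', ha', hb', rfl⟩ _
    exact ⟨a ∩ a', b ∩ b', ha.inter ha', hb.inter hb', Set.inter_inter_inter_comm a b a' b'⟩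
  refine IndepSets.indep h₁ (sup_le h₂ h₃) (@MeasurableSpace.isPiSystem_measurableSet Ω m₁) hpi
    (@MeasurableSpace.generateFrom_measurableSet Ω m₁).symm hgen ?_
  rw [IndepSets_iff]
  rintro s _ hs ⟨a, b, ha, hb, rfl⟩
  rw [Indep_iff] at h₁₂ h₁₂₃
  have hs' : MeasurableSet[m₁ ⊔ m₂] s := (le_sup_left : m₁ ≤ m₁ ⊔ m₂) s hs
  have ha' : MeasurableSet[m₁ ⊔ m₂] a := (le_sup_right : m₂ ≤ m₁ ⊔ m₂) a ha
  rw [← Set.inter_assoc, h₁₂₃ _ _ (hs'.inter ha') hb, h₁₂ _ _ hs ha, h₁₂₃ _ _ ha' hb, mul_assoc]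

theorem eq_sum_indicator {Ω E : Type*} {N : ℕ} [AddCommMonoid E] (T : Ω → Finset (Fin N))
    (F : Finset (Fin N) → Ω → E) :
    (fun ω => F (T ω) ω) = ∑ s : Finset (Fin N), (T ⁻¹' {s}).indicator (F s) := by
  ext ω
  rw [Finset.sum_apply, Finset.sum_eq_single (T ω)]
  · simp [Set.indicator]
  · intro s _ hs
    simp [Set.indicator, hs.symm]
  · simp

variable {Ω Ξ : Type*} {m : MeasurableSpace Ω} [mΩ : MeasurableSpace Ω] [MeasurableSpace Ξ]
  {P : Measure Ω}
  {d N S : ℕ}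

theorem integrable_inner_of_memLp {E : Type*} [NormedAddCommGroup E] [InnerProductSpace ℝ E]
    {X Y : Ω → E} (hX : MemLp X 2 P) (hY : MemLp Y 2 P) :
    Integrable (fun ω => ⟪X ω, Y ω⟫_ℝ) P := by
  refine (hX.norm.integrable_mul hY.norm).mono (hX.1.inner hY.1) (Filter.Eventually.of_forall ?_)
  intro ω
  simpa using abs_real_inner_le_norm (X ω) (Y ω)

theorem integrable_norm_sq_of_memLp {E : Type*} [NormedAddCommGroup E]
    {X : Ω → E} (hX : MemLp X 2 P) : Integrable (fun ω => ‖X ω‖ ^ 2) P :=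
  (memLp_two_iff_integrable_sq_norm hX.1).1 hX

/-- Expectation of a centered function of an independent variable, conditionally frozen. -/
theorem integral_norm_sq_noise_le [IsProbabilityMeasure P] {σ : ℝ} {ν : Measure Ξ}
    [IsProbabilityMeasure ν] {γ : Vec d → Ξ → Vec d} {G : Vec d → Vec d}
    (hγ : Measurable (Function.uncurry γ)) (hG : Measurable G)
    (hsq : ∀ x, Integrable (fun z => ‖γ x z - G x‖ ^ 2) ν)
    (hvar : ∀ x, ∫ z, ‖γ x z - G x‖ ^ 2 ∂ν ≤ σ ^ 2)
    (hm : m ≤ mΩ) {Z : Ω → Ξ} (hZ : Measurable Z) (hlaw : P.map Z = ν)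
    (hind : Indep m (MeasurableSpace.comap Z inferInstance) P)
    {Y : Ω → Vec d} (hY : Measurable[m] Y) :
    MemLp (fun ω => γ (Y ω) (Z ω) - G (Y ω)) 2 P ∧
      ∫ ω, ‖γ (Y ω) (Z ω) - G (Y ω)‖ ^ 2 ∂P ≤ σ ^ 2 := by
  have hY' : Measurable Y := hY.mono hm le_rfl
  have hYZ : IndepFun Y Z P := by
    rw [IndepFun_iff_Indep]
    exact indep_of_indep_of_le_left hind hY.comap_le
  have hmap := (indepFun_iff_map_prod_eq_prod_map_map hY'.aemeasurable hZ.aemeasurable).1 hYZ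
  rw [hlaw] at hmap
  have hmeas : Measurable (fun p : Vec d × Ξ => γ p.1 p.2 - G p.1) :=
    hγ.sub (hG.comp measurable_fst)
  have hmeasΩ : Measurable (fun ω => γ (Y ω) (Z ω) - G (Y ω)) := hmeas.comp (hY'.prodMk hZ)
  -- The bound is proved for the lower integral first, since integrability of the squared noise at a
  -- random point is part of the claim.
  have hlint : ∫⁻ ω, ENNReal.ofReal (‖γ (Y ω) (Z ω) - G (Y ω)‖ ^ 2) ∂P
      ≤ ENNReal.ofReal (σ ^ 2) := by
    have hF : Measurable (fun p : Vec d × Ξ => ENNReal.ofReal (‖γ p.1 p.2 - G p.1‖ ^ 2)) :=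
      (hmeas.norm.pow_const 2).ennreal_ofReal
    have e1 : ∫⁻ ω, ENNReal.ofReal (‖γ (Y ω) (Z ω) - G (Y ω)‖ ^ 2) ∂P
        = ∫⁻ p, ENNReal.ofReal (‖γ p.1 p.2 - G p.1‖ ^ 2) ∂(P.map (fun ω => (Y ω, Z ω))) := by
      rw [lintegral_map hF (hY'.prodMk hZ)]
    rw [e1, hmap, lintegral_prod _ hF.aemeasurable]
    have : IsProbabilityMeasure (P.map Y) := Measure.isProbabilityMeasure_map hY'.aemeasurable
    calc ∫⁻ x, ∫⁻ z, ENNReal.ofReal (‖γ x z - G x‖ ^ 2) ∂ν ∂(P.map Y)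
        ≤ ∫⁻ _x, ENNReal.ofReal (σ ^ 2) ∂(P.map Y) := by
          refine lintegral_mono fun x => ?_
          rw [← ofReal_integral_eq_lintegral_ofReal (hsq x)
            (Filter.Eventually.of_forall fun z => by positivity)]
          exact ENNReal.ofReal_le_ofReal (hvar x)
      _ = _ := by simp
  have hint : Integrable (fun ω => ‖γ (Y ω) (Z ω) - G (Y ω)‖ ^ 2) P := by
    refine ⟨(hmeasΩ.norm.pow_const 2).aestronglyMeasurable, ?_⟩
    rw [hasFiniteIntegral_iff_ofReal (Filter.Eventually.of_forall fun ω => by positivity)]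
    exact hlint.trans_lt ENNReal.ofReal_lt_top
  refine ⟨(memLp_two_iff_integrable_sq_norm hmeasΩ.aestronglyMeasurable).2 hint, ?_⟩
  rw [← ENNReal.ofReal_le_ofReal_iff (sq_nonneg σ), ofReal_integral_eq_lintegral_ofReal hint
    (Filter.Eventually.of_forall fun ω => by positivity)]
  exact hlint

/-- The pair (W, Y) is independent of Z, so by Fubini it can be frozen, and the inner integral over
the data vanishes by unbiasedness. -/
theorem integral_inner_noise_eq_zero [IsProbabilityMeasure P] {ν : Measure Ξ}
    [IsProbabilityMeasure ν] {γ : Vec d → Ξ → Vec d} {G : Vec d → Vec d}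
    (hγ : Measurable (Function.uncurry γ)) (hG : Measurable G)
    (hint : ∀ x, Integrable (γ x) ν) (hmean : ∀ x, ∫ z, γ x z ∂ν = G x)
    (hm : m ≤ mΩ) {Z : Ω → Ξ} (hZ : Measurable Z) (hlaw : P.map Z = ν)
    (hind : Indep m (MeasurableSpace.comap Z inferInstance) P)
    {Y W : Ω → Vec d} (hY : Measurable[m] Y) (hW : Measurable[m] W) (hW2 : MemLp W 2 P)
    (hn : MemLp (fun ω => γ (Y ω) (Z ω) - G (Y ω)) 2 P) :
    ∫ ω, ⟪W ω, γ (Y ω) (Z ω) - G (Y ω)⟫_ℝ ∂P = 0 := by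
  have hWY : Measurable[m] (fun ω => (W ω, Y ω)) := hW.prodMk hY
  have hWY' : Measurable (fun ω => (W ω, Y ω)) := hWY.mono hm le_rfl
  have hWYZ : IndepFun (fun ω => (W ω, Y ω)) Z P := by
    rw [IndepFun_iff_Indep]
    exact indep_of_indep_of_le_left hind hWY.comap_le
  have hmap := (indepFun_iff_map_prod_eq_prod_map_map hWY'.aemeasurable hZ.aemeasurable).1 hWYZ
  rw [hlaw] at hmap
  have hF : Measurable (fun p : (Vec d × Vec d) × Ξ => ⟪p.1.1, γ p.1.2 p.2 - G p.1.2⟫_ℝ) := by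
    have h1 : Measurable (fun p : (Vec d × Vec d) × Ξ => γ p.1.2 p.2 - G p.1.2) :=
      (hγ.comp ((measurable_snd.comp measurable_fst).prodMk measurable_snd)).sub
        (hG.comp (measurable_snd.comp measurable_fst))
    exact (measurable_fst.comp measurable_fst).inner h1
  have hI := integrable_inner_of_memLp hW2 hn
  have hmeas := hWY'.prodMk hZ
  have e1 : ∫ ω, ⟪W ω, γ (Y ω) (Z ω) - G (Y ω)⟫_ℝ ∂P
      = ∫ p : (Vec d × Vec d) × Ξ, ⟪p.1.1, γ p.1.2 p.2 - G p.1.2⟫_ℝ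
          ∂(P.map (fun ω => ((W ω, Y ω), Z ω))) := by
    rw [integral_map hmeas.aemeasurable hF.aestronglyMeasurable]
  have hI' : Integrable (fun p : (Vec d × Vec d) × Ξ => ⟪p.1.1, γ p.1.2 p.2 - G p.1.2⟫_ℝ)
      (P.map (fun ω => ((W ω, Y ω), Z ω))) := by
    rw [integrable_map_measure hF.aestronglyMeasurable hmeas.aemeasurable]
    exact hI
  rw [e1]
  rw [hmap] at hI' ⊢
  have : IsProbabilityMeasure (P.map fun ω => (W ω, Y ω)) :=
    Measure.isProbabilityMeasure_map hWY'.aemeasurable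
  rw [integral_prod _ hI']
  have : ∀ p : Vec d × Vec d, ∫ z, ⟪p.1, γ p.2 z - G p.2⟫_ℝ ∂ν = 0 := by
    intro p
    have h := integral_inner (𝕜 := ℝ) (f := fun z => γ p.2 z - G p.2)
      ((hint p.2).sub (integrable_const _)) p.1
    rw [h, integral_sub (hint p.2) (integrable_const _), hmean]
    simp
  simp [this]

/-- `T` is uniform among the `S`-element subsets of `Fin N`. -/
structure IsUniformSubset (P : Measure Ω) (S : ℕ) (T : Ω → Finset (Fin N)) : Prop where
  measurable : Measurable T
  uniform : ∀ s : Finset (Fin N), s.card = S → P (T ⁻¹' {s}) = ((N.choose S : ℕ) : ℝ≥0∞)⁻¹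

/-- Only the probabilities of the S-element sets are prescribed, but they already add up to 1. -/
theorem IsUniformSubset.ae_card [IsProbabilityMeasure P] {T : Ω → Finset (Fin N)}
    (hT : IsUniformSubset P S T) (hSN : S ≤ N) : ∀ᵐ ω ∂P, (T ω).card = S := by
  have h1 : P (T ⁻¹' (Finset.powersetCard S (Finset.univ : Finset (Fin N)) :
      Set (Finset (Fin N)))) = 1 := by
    have : T ⁻¹' (Finset.powersetCard S (Finset.univ : Finset (Fin N)) : Set (Finset (Fin N)))
        = ⋃ s ∈ Finset.powersetCard S (Finset.univ : Finset (Fin N)), T ⁻¹' {s} := by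
      ext ω; simp
    rw [this, measure_biUnion_finset]
    · rw [Finset.sum_congr rfl fun s hs => hT.uniform s (Finset.mem_powersetCard.1 hs).2]
      rw [Finset.sum_const, Finset.card_powersetCard, Finset.card_univ, Fintype.card_fin,
        nsmul_eq_mul]
      exact ENNReal.mul_inv_cancel (by exact_mod_cast (Nat.choose_pos hSN).ne')
        (ENNReal.natCast_ne_top _)
    · intro s _ t _ hst
      exact Disjoint.preimage _ (Set.disjoint_singleton.2 hst)
    · intro s _
      exact hT.measurable (measurableSet_singleton s)
  have h2 : ∀ᵐ ω ∂P, ω ∈ T ⁻¹' (Finset.powersetCard S (Finset.univ : Finset (Fin N)) :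
      Set (Finset (Fin N))) := by
    exact (mem_ae_iff_prob_eq_one (hT.measurable (Set.toFinite _).measurableSet)).2 h1
  filter_upwards [h2] with ω hω
  simpa using hω

theorem memLp_subset {E : Type*} [NormedAddCommGroup E] {T : Ω → Finset (Fin N)}
    (hT : Measurable T) {F : Finset (Fin N) → Ω → E} {p : ℝ≥0∞} (hF : ∀ s, MemLp (F s) p P) :
    MemLp (fun ω => F (T ω) ω) p P := by
  rw [eq_sum_indicator]
  exact memLp_finsetSum' _ fun s _ => (hF s).indicator (hT (measurableSet_singleton s))

theorem integrable_subset {E : Type*} [NormedAddCommGroup E] {T : Ω → Finset (Fin N)}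
    (hT : Measurable T) {F : Finset (Fin N) → Ω → E} (hF : ∀ s, Integrable (F s) P) :
    Integrable (fun ω => F (T ω) ω) P := by
  simp_rw [← memLp_one_iff_integrable] at hF ⊢
  exact memLp_subset hT hF

/-- Expectation over an independent uniform subset. -/
theorem IsUniformSubset.integral_eq [IsProbabilityMeasure P] {T : Ω → Finset (Fin N)}
    (hT : IsUniformSubset P S T) (hSN : S ≤ N) (hm : m ≤ mΩ)
    (hind : Indep (MeasurableSpace.comap T inferInstance) m P)
    {φ : Finset (Fin N) → Ω → ℝ} (hφ : ∀ s, Measurable[m] (φ s)) (hφi : ∀ s, Integrable (φ s) P) :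
    ∫ ω, φ (T ω) ω ∂P = subsetMean N S fun s => ∫ ω, φ s ω ∂P := by
  have h1 : ∫ ω, φ (T ω) ω ∂P
      = ∫ ω, ∑ s ∈ Finset.powersetCard S Finset.univ, (if T ω = s then (1 : ℝ) else 0) * φ s ω ∂P := by
    refine integral_congr_ae ?_
    filter_upwards [hT.ae_card hSN] with ω hω
    have : T ω ∈ Finset.powersetCard S Finset.univ := by simp [hω]
    simp [this]
  have hi : ∀ s, Integrable (fun ω => (if T ω = s then (1 : ℝ) else 0) * φ s ω) P := by
    intro s
    have : (fun ω => (if T ω = s then (1 : ℝ) else 0) * φ s ω) = (T ⁻¹' {s}).indicator (φ s) := by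
      ext ω; by_cases h : T ω = s <;> simp [Set.indicator, h]
    rw [this]
    exact (hφi s).indicator (hT.measurable (measurableSet_singleton s))
  rw [h1, integral_finsetSum _ fun s _ => hi s, subsetMean, Finset.mul_sum]
  refine Finset.sum_congr rfl fun s hs => ?_
  have hTφ : IndepFun T (φ s) P := by
    rw [IndepFun_iff_Indep]
    exact indep_of_indep_of_le_right hind (hφ s).comap_le
  have hφm : Measurable (φ s) := (hφ s).mono hm le_rfl
  have h2 := hTφ.integral_fun_comp_mul_comp (f := fun t => if t = s then (1 : ℝ) else 0)
    (g := fun x : ℝ => x) hT.measurable.aemeasurable hφm.aemeasurable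
    (Measurable.ite (measurableSet_singleton s) measurable_const
      measurable_const).aestronglyMeasurable measurable_id.aestronglyMeasurable
  rw [h2]
  congr 1
  have h3 : (fun ω => if T ω = s then (1 : ℝ) else 0) = (T ⁻¹' {s}).indicator 1 := by
    ext ω; by_cases h : T ω = s <;> simp [Set.indicator, h]
  rw [h3, integral_indicator_one (hT.measurable (measurableSet_singleton s)), measureReal_def,
    hT.uniform s (Finset.mem_powersetCard.1 hs).2]
  simp

end Probability

/-! ### Square integrable random vectors and quadratic inequalities. -/

theorem memLp_gradient {Ω : Type*} {d : ℕ} [MeasurableSpace Ω] {P : Measure Ω} [IsFiniteMeasure P]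
    {β : ℝ} {h : Vec d → ℝ} (hh : IsSmooth β h) {X : Ω → Vec d} (hX : MemLp X 2 P) :
    MemLp (fun ω => ∇ h (X ω)) 2 P := by
  have ha : MemLp (fun _ : Ω => ‖∇ h 0‖) 2 P := memLp_const _
  have hb : MemLp (fun ω => |β| * ‖X ω‖) 2 P := hX.norm.const_mul |β|
  have h1 : MemLp (fun ω => ‖∇ h 0‖ + |β| * ‖X ω‖) 2 P := ha.add hb
  refine h1.of_le (hh.continuous_gradient.comp_aestronglyMeasurable hX.1) ?_
  refine Filter.Eventually.of_forall fun ω => ?_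
  rw [Real.norm_of_nonneg (by positivity)]
  have h2 := hh.2 (X ω) 0
  rw [sub_zero] at h2
  have h3 := norm_sub_norm_le (∇ h (X ω)) (∇ h 0)
  have h4 : β * ‖X ω‖ ≤ |β| * ‖X ω‖ := by gcongr; exact le_abs_self β
  linarith

/-- `X` is square integrable and measurable with respect to the sub-σ-algebra `m`. -/
structure IsL2 {Ω : Type*} {d : ℕ} (m : MeasurableSpace Ω) [MeasurableSpace Ω] (P : Measure Ω)
    (X : Ω → Vec d) : Prop where
  measurable : Measurable[m] X
  memLp : MemLp X 2 P

namespace IsL2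

variable {Ω : Type*} {d : ℕ} {m m' : MeasurableSpace Ω} [MeasurableSpace Ω] {P : Measure Ω}
  {X Y : Ω → Vec d}

theorem mono (hX : IsL2 m P X) (h : m ≤ m') : IsL2 m' P X := ⟨hX.1.mono h le_rfl, hX.2⟩

theorem add (hX : IsL2 m P X) (hY : IsL2 m P Y) : IsL2 m P (fun ω => X ω + Y ω) :=
  ⟨hX.1.add hY.1, hX.2.add hY.2⟩

theorem sub (hX : IsL2 m P X) (hY : IsL2 m P Y) : IsL2 m P (fun ω => X ω - Y ω) :=
  ⟨hX.1.sub hY.1, hX.2.sub hY.2⟩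

theorem const_smul (a : ℝ) (hX : IsL2 m P X) : IsL2 m P (fun ω => a • X ω) :=
  ⟨hX.1.const_smul a, hX.2.const_smul a⟩

theorem const [IsFiniteMeasure P] (v : Vec d) : IsL2 m P (fun _ => v) :=
  ⟨measurable_const, memLp_const v⟩

theorem sum {ι : Type*} (s : Finset ι) {X : ι → Ω → Vec d} (hX : ∀ i ∈ s, IsL2 m P (X i)) :
    IsL2 m P (fun ω => ∑ i ∈ s, X i ω) :=
  ⟨Finset.measurable_sum s fun i hi => (hX i hi).1, memLp_finsetSum s fun i hi => (hX i hi).2⟩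

theorem gradient [IsFiniteMeasure P] {β : ℝ} {h : Vec d → ℝ} (hh : IsSmooth β h)
    (hX : IsL2 m P X) : IsL2 m P (fun ω => ∇ h (X ω)) :=
  ⟨hh.measurable_gradient.comp hX.1, memLp_gradient hh hX.2⟩

theorem integrable_sq (hX : IsL2 m P X) : Integrable (fun ω => ‖X ω‖ ^ 2) P :=
  integrable_norm_sq_of_memLp hX.2

theorem integrable_inner (hX : IsL2 m P X) (hY : IsL2 m P Y) :
    Integrable (fun ω => ⟪X ω, Y ω⟫_ℝ) P :=
  integrable_inner_of_memLp hX.2 hY.2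

theorem measurable_norm_sq (hX : IsL2 m P X) : Measurable[m] (fun ω => ‖X ω‖ ^ 2) :=
  (continuous_norm.pow 2).measurable.comp hX.1

theorem measurable_inner (hX : IsL2 m P X) (hY : IsL2 m P Y) :
    Measurable[m] (fun ω => ⟪X ω, Y ω⟫_ℝ) :=
  continuous_inner.measurable.comp (hX.1.prodMk hY.1)

end IsL2

theorem norm_add_sq_le_two {E : Type*} [NormedAddCommGroup E] [InnerProductSpace ℝ E] (a b : E) :
    ‖a + b‖ ^ 2 ≤ 2 * ‖a‖ ^ 2 + 2 * ‖b‖ ^ 2 := by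
  nlinarith [parallelogram_law_with_norm ℝ a b, norm_nonneg (a - b)]

theorem norm_sub_sq_le_two {E : Type*} [NormedAddCommGroup E] [InnerProductSpace ℝ E] (a b : E) :
    ‖a - b‖ ^ 2 ≤ 2 * ‖a‖ ^ 2 + 2 * ‖b‖ ^ 2 := by
  nlinarith [parallelogram_law_with_norm ℝ a b, norm_nonneg (a + b)]

theorem norm_add_four_sq_le {E : Type*} [NormedAddCommGroup E] [InnerProductSpace ℝ E]
    (a b c e : E) :
    ‖a + b + c + e‖ ^ 2 ≤ 4 * (‖a‖ ^ 2 + ‖b‖ ^ 2 + ‖c‖ ^ 2 + ‖e‖ ^ 2) := by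
  have h1 := norm_add_sq_le_two (a + b) (c + e)
  have h2 := norm_add_sq_le_two a b
  have h3 := norm_add_sq_le_two c e
  rw [← add_assoc] at h1
  linarith

/-- Young's inequality with weight 1/K: a factor 1 + 1/K per local step stays bounded over K steps.
-/
theorem norm_sub_smul_sq_le {E : Type*} [NormedAddCommGroup E] [InnerProductSpace ℝ E]
    {K : ℝ} (hK : 0 < K) (η : ℝ) (a v : E) :
    ‖a - η • v‖ ^ 2 ≤ (1 + 1 / K) * ‖a‖ ^ 2 + (1 + K) * (η ^ 2 * ‖v‖ ^ 2) := by
  rw [norm_sub_sq_real, norm_smul, mul_pow, Real.norm_eq_abs, sq_abs, real_inner_smul_right]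
  have h0 : 0 ≤ ‖(1 / K) • a + η • v‖ ^ 2 := by positivity
  rw [norm_add_sq_real, norm_smul, norm_smul, mul_pow, mul_pow, Real.norm_eq_abs, sq_abs,
    Real.norm_eq_abs, sq_abs, real_inner_smul_left, real_inner_smul_right] at h0
  have h1 : 0 ≤ K * ((1 / K) ^ 2 * ‖a‖ ^ 2 + 2 * (1 / K * (η * ⟪a, v⟫_ℝ)) + η ^ 2 * ‖v‖ ^ 2) := by
    positivity
  have h2 : K * ((1 / K) ^ 2 * ‖a‖ ^ 2 + 2 * (1 / K * (η * ⟪a, v⟫_ℝ)) + η ^ 2 * ‖v‖ ^ 2)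
      = 1 / K * ‖a‖ ^ 2 + 2 * (η * ⟪a, v⟫_ℝ) + K * (η ^ 2 * ‖v‖ ^ 2) := by field_simp
  linarith

/-! ### One communication round: local models and stochastic noise. -/

/-- The random quantities of one communication round: `x`, `c`, `ci` are the server model and the
control variates at its start, `h i` is the part of `ci i` that comes from exact gradients, `T` is
the set of clients and `z` are the data points. -/
structure RoundData (d N : ℕ) (Ω Ξ : Type*) where
  f : Fin N → Vec d → ℝ
  g : Fin N → Vec d → Ξ → Vec d
  S : ℕ
  K : ℕ
  ηl : ℝ
  x : Ω → Vec d
  c : Ω → Vec d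
  ci : Fin N → Ω → Vec d
  h : Fin N → Ω → Vec d
  T : Ω → Finset (Fin N)
  z : Fin N → ℕ → Ω → Ξ

namespace RoundData

variable {d N : ℕ} {Ω Ξ : Type*} (D : RoundData d N Ω Ξ)

/-- The local models, computed for all clients. -/
noncomputable def y (i : Fin N) (k : ℕ) (ω : Ω) : Vec d :=
  localModel (D.g i) D.ηl (D.x ω) (D.c ω) (D.ci i ω) (fun l => D.z i l ω) k

noncomputable def noise (i : Fin N) (k : ℕ) (ω : Ω) : Vec d :=
  D.g i (D.y i k ω) (D.z i k ω) - ∇ (D.f i) (D.y i k ω)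

noncomputable def meanGrad (i : Fin N) (ω : Ω) : Vec d :=
  (1 / (D.K : ℝ)) • ∑ k ∈ Finset.range D.K, ∇ (D.f i) (D.y i k ω)

noncomputable def meanNoise (i : Fin N) (ω : Ω) : Vec d :=
  (1 / (D.K : ℝ)) • ∑ k ∈ Finset.range D.K, D.noise i k ω

/-- The average over the clients in `s` of the mean local update direction. -/
noncomputable def direction (s : Finset (Fin N)) (ω : Ω) : Vec d :=
  (1 / (D.S : ℝ)) • ∑ i ∈ s, (D.meanGrad i ω + D.meanNoise i ω - D.ci i ω + D.c ω)

/-- The exact part of the first local update direction. -/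
noncomputable def exactDirection (i : Fin N) (ω : Ω) : Vec d :=
  ∇ (D.f i) (D.x ω) - D.h i ω + (1 / (N : ℝ)) • ∑ j, D.h j ω

theorem y_succ (i : Fin N) (k : ℕ) (ω : Ω) : D.y i (k + 1) ω
    = D.y i k ω - D.ηl • (∇ (D.f i) (D.y i k ω) - D.ci i ω + D.c ω) - D.ηl • D.noise i k ω := by
  have : D.y i (k + 1) ω
      = D.y i k ω - D.ηl • (D.g i (D.y i k ω) (D.z i k ω) - D.ci i ω + D.c ω) := rfl
  rw [this, noise]
  module

/-- The σ-algebra generated by the past `m` and the data points with index in `s`. -/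
abbrev sigma (m : MeasurableSpace Ω) [MeasurableSpace Ξ] (s : Set (Fin N × ℕ)) : MeasurableSpace Ω :=
  m ⊔ ⨆ p ∈ s, MeasurableSpace.comap (D.z p.1 p.2) inferInstance

theorem le_sigma (m : MeasurableSpace Ω) [MeasurableSpace Ξ] (s : Set (Fin N × ℕ)) :
    m ≤ D.sigma m s := le_sup_left

theorem measurable_z_sigma (m : MeasurableSpace Ω) [MeasurableSpace Ξ] {s : Set (Fin N × ℕ)}
    {i : Fin N} {k : ℕ} (h : (i, k) ∈ s) : Measurable[D.sigma m s] (D.z i k) := by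
  rw [measurable_iff_comap_le]
  exact (le_iSup₂_of_le (f := fun (p : Fin N × ℕ) (_ : p ∈ s) =>
    MeasurableSpace.comap (D.z p.1 p.2) inferInstance) (i, k) h le_rfl).trans le_sup_right

/-- The hypotheses on a round whose past is described by the σ-algebra `m`. -/
structure IsValid (m : MeasurableSpace Ω) [mΩ : MeasurableSpace Ω] [MeasurableSpace Ξ]
    (P : Measure Ω) (ν : Fin N → Measure Ξ) (β σ : ℝ) : Prop where
  one_le_S : 1 ≤ D.S
  S_le : D.S ≤ N
  one_le_K : 1 ≤ D.K
  ηl_nonneg : 0 ≤ D.ηl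
  β_pos : 0 < β
  smooth : ∀ i, IsSmooth β (D.f i)
  stoch : IsStochasticGradient σ D.f ν D.g
  le : m ≤ mΩ
  clients : IsUniformSubset P D.S D.T
  measurable_z : ∀ i k, Measurable (D.z i k)
  law_z : ∀ i k, P.map (D.z i k) = ν i
  indep_clients : Indep (MeasurableSpace.comap D.T inferInstance) (D.sigma m Set.univ) P
  indep_z : ∀ i k, Indep (D.sigma m {(i, k)}ᶜ)
    (MeasurableSpace.comap (D.z i k) inferInstance) P
  isL2_x : IsL2 m P D.x
  isL2_ci : ∀ i, IsL2 m P (D.ci i)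
  isL2_h : ∀ i, IsL2 m P (D.h i)
  c_eq : ∀ ω, D.c ω = (1 / (N : ℝ)) • ∑ i, D.ci i ω
  noise_le : ∀ i, ∫ ω, ‖D.ci i ω - D.h i ω‖ ^ 2 ∂P ≤ σ ^ 2 / D.K
  step_le : 2 * (D.K * D.ηl * β) ≤ 1

namespace IsValid

variable {D} {m m' : MeasurableSpace Ω} [mΩ : MeasurableSpace Ω] [MeasurableSpace Ξ]
  {P : Measure Ω} {ν : Fin N → Measure Ξ} {β σ : ℝ} (H : D.IsValid m P ν β σ)
include H

theorem one_le_N : 1 ≤ N := H.one_le_S.trans H.S_le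

theorem K_pos : (0 : ℝ) < D.K := by exact_mod_cast H.one_le_K

theorem S_pos : (0 : ℝ) < D.S := by exact_mod_cast H.one_le_S

theorem N_pos : (0 : ℝ) < N := by exact_mod_cast H.one_le_N

theorem sigma_le (s : Set (Fin N × ℕ)) : D.sigma m s ≤ mΩ :=
  sup_le H.le (iSup₂_le fun p _ => (H.measurable_z p.1 p.2).comap_le)

theorem isL2_c : IsL2 m P D.c := by
  have h1 : D.c = fun ω => (1 / (N : ℝ)) • ∑ i, D.ci i ω := funext H.c_eq
  rw [h1]
  exact (IsL2.sum _ fun i _ => H.isL2_ci i).const_smul _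

theorem measurable_y (hm : m ≤ m') (i : Fin N) (k : ℕ)
    (hz : ∀ l < k, Measurable[m'] (D.z i l)) : Measurable[m'] (D.y i k) := by
  induction k with
  | zero => exact H.isL2_x.1.mono hm le_rfl
  | succ k ih =>
    have h1 := ih fun l hl => hz l (hl.trans k.lt_succ_self)
    have h2 : Measurable[m'] (fun ω => D.g i (D.y i k ω) (D.z i k ω)) :=
      (H.stoch.measurable i).comp (h1.prodMk (hz k k.lt_succ_self))
    exact h1.sub (((h2.sub ((H.isL2_ci i).1.mono hm le_rfl)).add
      (H.isL2_c.1.mono hm le_rfl)).const_smul D.ηl)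

theorem measurable_y_compl (i : Fin N) {k l : ℕ} (hkl : k ≤ l) :
    Measurable[D.sigma m {(i, l)}ᶜ] (D.y i k) := by
  refine H.measurable_y (D.le_sigma m _) i k fun q hq => D.measurable_z_sigma m ?_
  simp only [Set.mem_compl_iff, Set.mem_singleton_iff, Prod.mk.injEq, true_and]
  omega

variable [IsProbabilityMeasure P] [∀ i, IsProbabilityMeasure (ν i)]

theorem noise_spec (i : Fin N) (k : ℕ) :
    MemLp (D.noise i k) 2 P ∧ ∫ ω, ‖D.noise i k ω‖ ^ 2 ∂P ≤ σ ^ 2 :=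
  integral_norm_sq_noise_le (H.stoch.measurable i) (H.smooth i).measurable_gradient
    (H.stoch.integrable_sq i) (H.stoch.variance_le i) (H.sigma_le _) (H.measurable_z i k)
    (H.law_z i k) (H.indep_z i k) (H.measurable_y_compl i le_rfl)

theorem integral_inner_noise {W : Ω → Vec d} (i : Fin N) (k : ℕ)
    (hW : IsL2 (D.sigma m {(i, k)}ᶜ) P W) : ∫ ω, ⟪W ω, D.noise i k ω⟫_ℝ ∂P = 0 :=
  integral_inner_noise_eq_zero (H.stoch.measurable i) (H.smooth i).measurable_gradient
    (H.stoch.integrable i) (H.stoch.unbiased i) (H.sigma_le _) (H.measurable_z i k)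
    (H.law_z i k) (H.indep_z i k) (H.measurable_y_compl i le_rfl) hW.1 hW.2 (H.noise_spec i k).1

theorem memLp_y (i : Fin N) (k : ℕ) : MemLp (D.y i k) 2 P := by
  induction k with
  | zero => exact H.isL2_x.2
  | succ k ih =>
    have h1 : IsL2 mΩ P (D.y i k) :=
      ⟨(H.measurable_y_compl i le_rfl).mono (H.sigma_le _) le_rfl, ih⟩
    have h2 : D.y i (k + 1) = fun ω => D.y i k ω
        - D.ηl • (∇ (D.f i) (D.y i k ω) - D.ci i ω + D.c ω) - D.ηl • D.noise i k ω :=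
      funext (D.y_succ i k)
    rw [h2]
    exact (ih.sub ((((h1.gradient (H.smooth i)).2.sub (H.isL2_ci i).2).add
      H.isL2_c.2).const_smul D.ηl)).sub ((H.noise_spec i k).1.const_smul D.ηl)

theorem isL2_y (hm : m ≤ m') (i : Fin N) (k : ℕ)
    (hz : ∀ l < k, Measurable[m'] (D.z i l)) : IsL2 m' P (D.y i k) :=
  ⟨H.measurable_y hm i k hz, H.memLp_y i k⟩

theorem isL2_noise (hm : m ≤ m') (i : Fin N) (k : ℕ)
    (hz : ∀ l ≤ k, Measurable[m'] (D.z i l)) : IsL2 m' P (D.noise i k) := by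
  have h1 := H.measurable_y hm i k fun l hl => hz l hl.le
  exact ⟨((H.stoch.measurable i).comp (h1.prodMk (hz k le_rfl))).sub
    ((H.smooth i).measurable_gradient.comp h1), (H.noise_spec i k).1⟩

theorem isL2_y_univ (i : Fin N) (k : ℕ) : IsL2 (D.sigma m Set.univ) P (D.y i k) :=
  H.isL2_y (D.le_sigma m _) i k fun _ _ => D.measurable_z_sigma m (Set.mem_univ _)

theorem isL2_noise_univ (i : Fin N) (k : ℕ) : IsL2 (D.sigma m Set.univ) P (D.noise i k) :=
  H.isL2_noise (D.le_sigma m _) i k fun _ _ => D.measurable_z_sigma m (Set.mem_univ _)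

theorem isL2_meanGrad (i : Fin N) : IsL2 (D.sigma m Set.univ) P (D.meanGrad i) :=
  (IsL2.sum _ fun k _ => (H.isL2_y_univ i k).gradient (H.smooth i)).const_smul _

theorem isL2_meanNoise (i : Fin N) : IsL2 (D.sigma m Set.univ) P (D.meanNoise i) :=
  (IsL2.sum _ fun k _ => H.isL2_noise_univ i k).const_smul _

/-- One of the two noises is always a function of the past and of data other than the point used by
the other one: the earlier noise if the clients agree, and either noise if they differ, since local
runs do not see each other's data. -/
theorem integral_inner_noise_noise {i j : Fin N} {k l : ℕ} (hne : (i, k) ≠ (j, l)) :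
    ∫ ω, ⟪D.noise i k ω, D.noise j l ω⟫_ℝ ∂P = 0 := by
  have key : ∀ {i j : Fin N} {k l : ℕ}, (i ≠ j ∨ k < l) →
      ∫ ω, ⟪D.noise i k ω, D.noise j l ω⟫_ℝ ∂P = 0 := by
    intro i j k l h
    refine H.integral_inner_noise j l (H.isL2_noise (D.le_sigma m _) i k fun q hq =>
      D.measurable_z_sigma m ?_)
    simp only [Set.mem_compl_iff, Set.mem_singleton_iff, Prod.mk.injEq, not_and]
    rintro rfl
    rcases h with h | h
    · exact absurd rfl h
    · omega
  by_cases hij : i = j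
  · subst hij
    have hkl : k ≠ l := fun h => hne (by rw [h])
    rcases lt_or_gt_of_ne hkl with h | h
    · exact key (Or.inr h)
    · rw [← key (i := i) (j := i) (Or.inr h)]
      exact integral_congr_ae (Filter.Eventually.of_forall fun ω => real_inner_comm _ _)
  · exact key (Or.inl hij)

theorem integral_inner_meanNoise {W : Ω → Vec d} (hW : IsL2 m P W) (i : Fin N) :
    ∫ ω, ⟪W ω, D.meanNoise i ω⟫_ℝ ∂P = 0 := by
  simp_rw [meanNoise, real_inner_smul_right, inner_sum]
  rw [integral_const_mul, integral_finsetSum]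
  · rw [Finset.sum_eq_zero, mul_zero]
    intro k _
    exact H.integral_inner_noise i k (hW.mono (D.le_sigma m _))
  · intro k _
    exact (hW.mono (D.le_sigma m _)).integrable_inner (H.isL2_noise_univ i k)

/-- Orthogonality of the noises of the K local steps leaves only the diagonal terms, hence the gain
1/K. Orthogonality between clients gives the further 1/S in `integral_average_meanNoise_sq_le`. -/
theorem integral_meanNoise_sq_le (i : Fin N) :
    ∫ ω, ‖D.meanNoise i ω‖ ^ 2 ∂P ≤ σ ^ 2 / D.K := by
  have hint : ∀ k l, Integrable (fun ω => ⟪D.noise i k ω, D.noise i l ω⟫_ℝ) P := fun k l =>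
    (H.isL2_noise_univ i k).integrable_inner (H.isL2_noise_univ i l)
  have h1 : ∀ ω, ‖D.meanNoise i ω‖ ^ 2 = (1 / (D.K : ℝ)) ^ 2 *
      ∑ k ∈ Finset.range D.K, ∑ l ∈ Finset.range D.K, ⟪D.noise i k ω, D.noise i l ω⟫_ℝ := by
    intro ω
    rw [meanNoise, norm_smul, mul_pow, Real.norm_eq_abs, sq_abs, ← real_inner_self_eq_norm_sq,
      sum_inner]
    simp_rw [inner_sum]
  simp_rw [h1]
  rw [integral_const_mul, integral_finsetSum _ fun k _ => integrable_finsetSum _ fun l _ => hint k l]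
  have h2 : ∀ k ∈ Finset.range D.K, ∫ ω, ∑ l ∈ Finset.range D.K,
      ⟪D.noise i k ω, D.noise i l ω⟫_ℝ ∂P ≤ σ ^ 2 := by
    intro k hk
    rw [integral_finsetSum _ fun l _ => hint k l, Finset.sum_eq_single k]
    · simp_rw [real_inner_self_eq_norm_sq]
      exact (H.noise_spec i k).2
    · intro l _ hl
      exact H.integral_inner_noise_noise fun h => hl (Prod.ext_iff.1 h).2.symm
    · intro h; exact absurd hk h
  calc (1 / (D.K : ℝ)) ^ 2 * _ ≤ (1 / (D.K : ℝ)) ^ 2 * ∑ k ∈ Finset.range D.K, σ ^ 2 := by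
        gcongr with k hk; exact h2 k hk
    _ = σ ^ 2 / D.K := by
        have := H.K_pos
        simp; field_simp

theorem integral_inner_meanNoise_meanNoise {i j : Fin N} (hij : i ≠ j) :
    ∫ ω, ⟪D.meanNoise i ω, D.meanNoise j ω⟫_ℝ ∂P = 0 := by
  simp_rw [meanNoise, real_inner_smul_left, real_inner_smul_right, sum_inner, inner_sum]
  have hint : ∀ k l, Integrable (fun ω => ⟪D.noise i k ω, D.noise j l ω⟫_ℝ) P := fun k l =>
    (H.isL2_noise_univ i k).integrable_inner (H.isL2_noise_univ j l)
  rw [integral_const_mul, integral_const_mul,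
    integral_finsetSum _ fun k _ => integrable_finsetSum _ fun l _ => hint k l,
    Finset.sum_eq_zero, mul_zero, mul_zero]
  intro k _
  rw [integral_finsetSum _ fun l _ => hint k l, Finset.sum_eq_zero]
  intro l _
  exact H.integral_inner_noise_noise fun h => hij (Prod.ext_iff.1 h).1

theorem integral_average_meanNoise_sq_le {s : Finset (Fin N)} (hs : s.card = D.S) :
    ∫ ω, ‖(1 / (D.S : ℝ)) • ∑ i ∈ s, D.meanNoise i ω‖ ^ 2 ∂P ≤ σ ^ 2 / (D.K * D.S) := by
  have hint : ∀ i j, Integrable (fun ω => ⟪D.meanNoise i ω, D.meanNoise j ω⟫_ℝ) P := fun i j =>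
    (H.isL2_meanNoise i).integrable_inner (H.isL2_meanNoise j)
  have h1 : ∀ ω, ‖(1 / (D.S : ℝ)) • ∑ i ∈ s, D.meanNoise i ω‖ ^ 2 = (1 / (D.S : ℝ)) ^ 2 *
      ∑ i ∈ s, ∑ j ∈ s, ⟪D.meanNoise i ω, D.meanNoise j ω⟫_ℝ := by
    intro ω
    rw [norm_smul, mul_pow, Real.norm_eq_abs, sq_abs, ← real_inner_self_eq_norm_sq, sum_inner]
    simp_rw [inner_sum]
  simp_rw [h1]
  rw [integral_const_mul, integral_finsetSum _ fun k _ => integrable_finsetSum _ fun l _ => hint k l]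
  have h2 : ∀ i ∈ s, ∫ ω, ∑ j ∈ s, ⟪D.meanNoise i ω, D.meanNoise j ω⟫_ℝ ∂P ≤ σ ^ 2 / D.K := by
    intro i hi
    rw [integral_finsetSum _ fun j _ => hint i j, Finset.sum_eq_single i]
    · simp_rw [real_inner_self_eq_norm_sq]
      exact H.integral_meanNoise_sq_le i
    · intro j _ hj
      exact H.integral_inner_meanNoise_meanNoise hj.symm
    · intro h; exact absurd hi h
  have hS := H.S_pos
  have hK := H.K_pos
  calc (1 / (D.S : ℝ)) ^ 2 * _ ≤ (1 / (D.S : ℝ)) ^ 2 * ∑ i ∈ s, σ ^ 2 / D.K := by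
        gcongr with i hi; exact h2 i hi
    _ = σ ^ 2 / (D.K * D.S) := by
        simp [hs]; field_simp

end IsValid

end RoundData

/-! ### Client drift and the second moment of the server update. -/

theorem le_of_linear_recursion {a : ℕ → ℝ} {b : ℝ} {K : ℕ} (hK : 1 ≤ K) (hb : 0 ≤ b)
    (h0 : a 0 = 0) (h : ∀ k, a (k + 1) ≤ (1 + 2 / (K : ℝ)) * a k + b) {k : ℕ} (hk : k ≤ K) :
    a k ≤ 8 * K * b := by
  have hK' : (0 : ℝ) < K := by exact_mod_cast hK
  -- Each of the k increments b is amplified by at most the full factor, and that factor is at most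
  -- e² < 8 for k ≤ K.
  have h1 : ∀ k, a k ≤ (1 + 2 / (K : ℝ)) ^ k * (k * b) := by
    intro k
    induction k with
    | zero => simp [h0]
    | succ k ih =>
      have h2 : (1 : ℝ) ≤ (1 + 2 / (K : ℝ)) ^ (k + 1) :=
        one_le_pow₀ (by have : (0 : ℝ) ≤ 2 / K := by positivity
                        linarith)
      calc a (k + 1) ≤ (1 + 2 / (K : ℝ)) * a k + b := h k
        _ ≤ (1 + 2 / (K : ℝ)) * ((1 + 2 / (K : ℝ)) ^ k * (k * b))
              + (1 + 2 / (K : ℝ)) ^ (k + 1) * b := by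
            gcongr
            exact le_mul_of_one_le_left hb h2
        _ = _ := by push_cast; ring
  have h3 : (1 + 2 / (K : ℝ)) ^ k ≤ 8 := by
    have e1 : 1 + 2 / (K : ℝ) ≤ Real.exp (2 / K) := by
      linarith [Real.add_one_le_exp (2 / (K : ℝ))]
    calc (1 + 2 / (K : ℝ)) ^ k ≤ Real.exp (2 / K) ^ k := by gcongr
      _ = Real.exp (k * (2 / K)) := by rw [← Real.exp_nat_mul]
      _ ≤ Real.exp 2 := by
        apply Real.exp_le_exp.2
        have : (k : ℝ) ≤ K := by exact_mod_cast hk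
        calc (k : ℝ) * (2 / K) ≤ K * (2 / K) := by gcongr
          _ = 2 := by field_simp
      _ = Real.exp 1 ^ 2 := by rw [← Real.exp_nat_mul]; norm_num
      _ ≤ 2.7182818286 ^ 2 := by gcongr; exact Real.exp_one_lt_d9.le
      _ ≤ 8 := by norm_num
  calc a k ≤ (1 + 2 / (K : ℝ)) ^ k * (k * b) := h1 k
    _ ≤ 8 * (K * b) := by gcongr
    _ = _ := by ring

namespace RoundData

variable {d N : ℕ} {Ω Ξ : Type*} (D : RoundData d N Ω Ξ)

/-- The mean square distance between the local models and the server model. -/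
noncomputable def drift [MeasurableSpace Ω] (P : Measure Ω) : ℝ :=
  1 / (N : ℝ) * ∑ i, 1 / (D.K : ℝ) * ∑ k ∈ Finset.range D.K, ∫ ω, ‖D.y i k ω - D.x ω‖ ^ 2 ∂P

/-- The mean square of the exact directions. -/
noncomputable def exactSq [MeasurableSpace Ω] (P : Measure Ω) : ℝ :=
  1 / (N : ℝ) * ∑ i, ∫ ω, ‖D.exactDirection i ω‖ ^ 2 ∂P

namespace IsValid

variable {D} {m m' : MeasurableSpace Ω} [mΩ : MeasurableSpace Ω] [MeasurableSpace Ξ]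
  {P : Measure Ω} {ν : Fin N → Measure Ξ} {β σ : ℝ} (H : D.IsValid m P ν β σ)
  [IsProbabilityMeasure P] [∀ i, IsProbabilityMeasure (ν i)]
include H

theorem isL2_exactDirection (i : Fin N) : IsL2 m P (D.exactDirection i) :=
  ((H.isL2_x.gradient (H.smooth i)).sub (H.isL2_h i)).add
    ((IsL2.sum _ fun j _ => H.isL2_h j).const_smul _)

/-- The deterministic part u of the new displacement depends only on the past and on data other than
z i k, so the noise is orthogonal to it and enters as ηl²σ² without a factor K. Young's inequality
is spent on u alone. -/
theorem integral_y_succ_sub_sq_le (i : Fin N) (k : ℕ) :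
    ∫ ω, ‖D.y i (k + 1) ω - D.x ω‖ ^ 2 ∂P
      ≤ (1 + 2 / (D.K : ℝ)) * ∫ ω, ‖D.y i k ω - D.x ω‖ ^ 2 ∂P
        + (4 * D.K * D.ηl ^ 2 * ∫ ω, ‖∇ (D.f i) (D.x ω) - D.ci i ω + D.c ω‖ ^ 2 ∂P
          + D.ηl ^ 2 * σ ^ 2) := by
  have hK := H.K_pos
  have hK1 : (1 : ℝ) ≤ D.K := by exact_mod_cast H.one_le_K
  have hm₁ : m ≤ D.sigma m {(i, k)}ᶜ := D.le_sigma m _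
  have hy : IsL2 (D.sigma m {(i, k)}ᶜ) P (D.y i k) := ⟨H.measurable_y_compl i le_rfl, H.memLp_y i k⟩
  have hx := H.isL2_x.mono hm₁
  have hci := (H.isL2_ci i).mono hm₁
  have hc := H.isL2_c.mono hm₁
  let u : Ω → Vec d := fun ω => (D.y i k ω - D.x ω)
    - D.ηl • (∇ (D.f i) (D.y i k ω) - D.ci i ω + D.c ω)
  have hu : IsL2 (D.sigma m {(i, k)}ᶜ) P u :=
    (hy.sub hx).sub (((((hy.gradient (H.smooth i)).sub hci).add hc).const_smul D.ηl))
  let b : Ω → Vec d := fun ω => ∇ (D.f i) (D.x ω) - D.ci i ω + D.c ω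
  have hb : IsL2 (D.sigma m {(i, k)}ᶜ) P b := ((hx.gradient (H.smooth i)).sub hci).add hc
  have hn := H.isL2_noise_univ i k
  have h1 : ∀ ω, ‖D.y i (k + 1) ω - D.x ω‖ ^ 2
      = ‖u ω‖ ^ 2 - 2 * D.ηl * ⟪u ω, D.noise i k ω⟫_ℝ + D.ηl ^ 2 * ‖D.noise i k ω‖ ^ 2 := by
    intro ω
    have : D.y i (k + 1) ω - D.x ω = u ω - D.ηl • D.noise i k ω := by
      rw [D.y_succ]; simp only [u]; module
    rw [this, norm_sub_sq_real, norm_smul, mul_pow, Real.norm_eq_abs, sq_abs,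
      real_inner_smul_right]
    ring
  have hun : Integrable (fun ω => ⟪u ω, D.noise i k ω⟫_ℝ) P :=
    integrable_inner_of_memLp hu.2 hn.2
  simp_rw [h1]
  have hun' : Integrable (fun ω => ‖u ω‖ ^ 2 - 2 * D.ηl * ⟪u ω, D.noise i k ω⟫_ℝ) P :=
    hu.integrable_sq.sub (hun.const_mul _)
  rw [integral_add hun' (hn.integrable_sq.const_mul _),
    integral_sub hu.integrable_sq (hun.const_mul _), integral_const_mul, integral_const_mul,
    H.integral_inner_noise i k hu, mul_zero, sub_zero]
  have h2 : ∀ ω, ‖u ω‖ ^ 2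
      ≤ (1 + 2 / (D.K : ℝ)) * ‖D.y i k ω - D.x ω‖ ^ 2 + 4 * D.K * D.ηl ^ 2 * ‖b ω‖ ^ 2 := by
    intro ω
    have e1 := norm_sub_smul_sq_le hK D.ηl (D.y i k ω - D.x ω)
      (∇ (D.f i) (D.y i k ω) - D.ci i ω + D.c ω)
    have e2 : ‖∇ (D.f i) (D.y i k ω) - D.ci i ω + D.c ω‖ ^ 2
        ≤ 2 * (β * ‖D.y i k ω - D.x ω‖) ^ 2 + 2 * ‖b ω‖ ^ 2 := by
      have : ∇ (D.f i) (D.y i k ω) - D.ci i ω + D.c ω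
          = (∇ (D.f i) (D.y i k ω) - ∇ (D.f i) (D.x ω)) + b ω := by simp only [b]; abel
      rw [this]
      refine (norm_add_sq_le_two _ _).trans ?_
      gcongr
      exact (H.smooth i).2 _ _
    have e3 : (1 + (D.K : ℝ)) * (D.ηl ^ 2 * ‖∇ (D.f i) (D.y i k ω) - D.ci i ω + D.c ω‖ ^ 2)
        ≤ (2 * D.K) * (D.ηl ^ 2 * (2 * (β * ‖D.y i k ω - D.x ω‖) ^ 2 + 2 * ‖b ω‖ ^ 2)) := by
      gcongr; linarith
    -- The bound 2Kηlβ ≤ 1 turns the Lipschitz error into a second 1/K, whence the factor 1 + 2/K.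
    have e4 : 4 * D.K * D.ηl ^ 2 * β ^ 2 ≤ 1 / (D.K : ℝ) := by
      rw [le_div_iff₀ hK]
      have h0 : 0 ≤ 2 * (D.K * D.ηl * β) := by
        have := H.ηl_nonneg; have := H.β_pos; positivity
      calc 4 * (D.K : ℝ) * D.ηl ^ 2 * β ^ 2 * D.K = (2 * (D.K * D.ηl * β)) ^ 2 := by ring
        _ ≤ 1 := pow_le_one₀ h0 H.step_le
    have e5 : 4 * D.K * D.ηl ^ 2 * β ^ 2 * ‖D.y i k ω - D.x ω‖ ^ 2
        ≤ 1 / (D.K : ℝ) * ‖D.y i k ω - D.x ω‖ ^ 2 := by gcongr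
    have e6 : (2 : ℝ) / D.K = 1 / D.K + 1 / D.K := by ring
    rw [e6]
    simp only [u]
    linarith
  have hyx := (hy.sub hx).integrable_sq
  have h3 : ∫ ω, ‖u ω‖ ^ 2 ∂P ≤ (1 + 2 / (D.K : ℝ)) * ∫ ω, ‖D.y i k ω - D.x ω‖ ^ 2 ∂P
      + 4 * D.K * D.ηl ^ 2 * ∫ ω, ‖b ω‖ ^ 2 ∂P := by
    rw [← integral_const_mul, ← integral_const_mul,
      ← integral_add (hyx.const_mul _) (hb.integrable_sq.const_mul _)]
    exact integral_mono hu.integrable_sq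
      ((hyx.const_mul _).add (hb.integrable_sq.const_mul _)) h2
  have h4 : D.ηl ^ 2 * ∫ ω, ‖D.noise i k ω‖ ^ 2 ∂P ≤ D.ηl ^ 2 * σ ^ 2 := by
    gcongr; exact (H.noise_spec i k).2
  linarith

theorem integral_y_sub_sq_le (i : Fin N) {k : ℕ} (hk : k ≤ D.K) :
    ∫ ω, ‖D.y i k ω - D.x ω‖ ^ 2 ∂P
      ≤ 8 * D.K * (4 * D.K * D.ηl ^ 2 * ∫ ω, ‖∇ (D.f i) (D.x ω) - D.ci i ω + D.c ω‖ ^ 2 ∂P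
          + D.ηl ^ 2 * σ ^ 2) := by
  refine le_of_linear_recursion (a := fun k => ∫ ω, ‖D.y i k ω - D.x ω‖ ^ 2 ∂P) H.one_le_K ?_ ?_ (H.integral_y_succ_sub_sq_le i) hk
  · have : 0 ≤ ∫ ω, ‖∇ (D.f i) (D.x ω) - D.ci i ω + D.c ω‖ ^ 2 ∂P :=
      integral_nonneg fun ω => by positivity
    positivity
  · simp [y, localModel]

theorem isL2_controlNoise (i : Fin N) : IsL2 m P (fun ω => D.ci i ω - D.h i ω) :=
  (H.isL2_ci i).sub (H.isL2_h i)

theorem average_controlNoise_le :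
    1 / (N : ℝ) * ∑ i, ∫ ω, ‖D.ci i ω - D.h i ω‖ ^ 2 ∂P ≤ σ ^ 2 / D.K := by
  have hN := H.N_pos
  calc _ ≤ 1 / (N : ℝ) * ∑ _i : Fin N, σ ^ 2 / D.K := by
        gcongr with i; exact H.noise_le i
    _ = _ := by simp; field_simp

theorem isL2_centeredNoise (i : Fin N) : IsL2 m P (fun ω =>
    (D.ci i ω - D.h i ω) - (1 / (N : ℝ)) • ∑ j, (D.ci j ω - D.h j ω)) :=
  (H.isL2_controlNoise i).sub ((IsL2.sum _ fun j _ => H.isL2_controlNoise j).const_smul _)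

theorem average_centeredNoise_le :
    1 / (N : ℝ) * ∑ i, ∫ ω, ‖(D.ci i ω - D.h i ω)
      - (1 / (N : ℝ)) • ∑ j, (D.ci j ω - D.h j ω)‖ ^ 2 ∂P ≤ σ ^ 2 / D.K := by
  refine le_trans ?_ H.average_controlNoise_le
  rw [← integral_finsetSum _ fun i _ => (H.isL2_centeredNoise i).integrable_sq,
    ← integral_finsetSum _ fun i _ => (H.isL2_controlNoise i).integrable_sq,
    ← integral_const_mul, ← integral_const_mul]
  refine integral_mono
    ((integrable_finsetSum _ fun i _ => (H.isL2_centeredNoise i).integrable_sq).const_mul _)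
    ((integrable_finsetSum _ fun i _ => (H.isL2_controlNoise i).integrable_sq).const_mul _)
    fun ω => ?_
  exact average_norm_sub_average_sq_le H.one_le_N fun i => D.ci i ω - D.h i ω

/-- The first local direction is the exact direction minus the centered control noise, which costs a
factor 2 in squares. So 64 = 8·4·2, and 72 adds the 8 from the noise of the local steps. -/
theorem drift_le :
    D.drift P ≤ (D.K * D.ηl) ^ 2 * (64 * D.exactSq P + 72 * (σ ^ 2 / D.K)) := by
  have hN := H.N_pos
  have hK := H.K_pos
  let B : Fin N → ℝ := fun i => ∫ ω, ‖∇ (D.f i) (D.x ω) - D.ci i ω + D.c ω‖ ^ 2 ∂P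
  have h1 : D.drift P ≤ 1 / (N : ℝ) * ∑ i,
      8 * D.K * (4 * D.K * D.ηl ^ 2 * B i + D.ηl ^ 2 * σ ^ 2) := by
    unfold drift
    refine mul_le_mul_of_nonneg_left (Finset.sum_le_sum fun i _ => ?_) (by positivity)
    calc 1 / (D.K : ℝ) * ∑ k ∈ Finset.range D.K, ∫ ω, ‖D.y i k ω - D.x ω‖ ^ 2 ∂P
        ≤ 1 / (D.K : ℝ) * ∑ _k ∈ Finset.range D.K,
            8 * D.K * (4 * D.K * D.ηl ^ 2 * B i + D.ηl ^ 2 * σ ^ 2) := by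
          gcongr with k hk
          exact H.integral_y_sub_sq_le i (Finset.mem_range.1 hk).le
      _ = _ := by simp only [Finset.sum_const, Finset.card_range, nsmul_eq_mul]; field_simp
  have h2 : ∀ i, B i ≤ 2 * ∫ ω, ‖D.exactDirection i ω‖ ^ 2 ∂P
      + 2 * ∫ ω, ‖(D.ci i ω - D.h i ω) - (1 / (N : ℝ)) • ∑ j, (D.ci j ω - D.h j ω)‖ ^ 2 ∂P := by
    intro i
    have i1 := (H.isL2_exactDirection i).integrable_sq
    have i2 := (H.isL2_centeredNoise i).integrable_sq
    rw [← integral_const_mul, ← integral_const_mul, ← integral_add (i1.const_mul _) (i2.const_mul _)]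
    refine integral_mono
      (((H.isL2_x.gradient (H.smooth i)).sub (H.isL2_ci i)).add H.isL2_c).integrable_sq
      ((i1.const_mul _).add (i2.const_mul _)) fun ω => ?_
    have : ∇ (D.f i) (D.x ω) - D.ci i ω + D.c ω = D.exactDirection i ω
        - ((D.ci i ω - D.h i ω) - (1 / (N : ℝ)) • ∑ j, (D.ci j ω - D.h j ω)) := by
      rw [average_sub, ← H.c_eq, exactDirection]; abel
    simp only [this]
    exact norm_sub_sq_le_two _ _
  have h3 : 1 / (N : ℝ) * ∑ i, B i ≤ 2 * D.exactSq P + 2 * (σ ^ 2 / D.K) := by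
    calc 1 / (N : ℝ) * ∑ i, B i ≤ 1 / (N : ℝ) * ∑ i, (2 * ∫ ω, ‖D.exactDirection i ω‖ ^ 2 ∂P
          + 2 * ∫ ω, ‖(D.ci i ω - D.h i ω)
            - (1 / (N : ℝ)) • ∑ j, (D.ci j ω - D.h j ω)‖ ^ 2 ∂P) := by
          gcongr with i; exact h2 i
      _ = 2 * D.exactSq P + 2 * (1 / (N : ℝ) * ∑ i, ∫ ω, ‖(D.ci i ω - D.h i ω)
            - (1 / (N : ℝ)) • ∑ j, (D.ci j ω - D.h j ω)‖ ^ 2 ∂P) := by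
          rw [Finset.sum_add_distrib, ← Finset.mul_sum, ← Finset.mul_sum, exactSq]; ring
      _ ≤ _ := by
          have := H.average_centeredNoise_le
          linarith
  calc D.drift P ≤ _ := h1
    _ = 32 * (D.K * D.ηl) ^ 2 * (1 / (N : ℝ) * ∑ i, B i) + 8 * D.K * D.ηl ^ 2 * σ ^ 2 := by
        rw [← Finset.mul_sum, Finset.sum_add_distrib, ← Finset.mul_sum]
        simp only [Finset.sum_const, Finset.card_univ, Fintype.card_fin, nsmul_eq_mul]
        field_simp
        ring
    _ ≤ 32 * (D.K * D.ηl) ^ 2 * (2 * D.exactSq P + 2 * (σ ^ 2 / D.K))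
          + 8 * D.K * D.ηl ^ 2 * σ ^ 2 := by gcongr
    _ = _ := by field_simp; ring

theorem isL2_direction (s : Finset (Fin N)) : IsL2 (D.sigma m Set.univ) P (D.direction s) := by
  have hm := D.le_sigma m Set.univ
  exact (IsL2.sum s fun i _ => (((H.isL2_meanGrad i).add (H.isL2_meanNoise i)).sub
    ((H.isL2_ci i).mono hm)).add (H.isL2_c.mono hm)).const_smul _

theorem memLp_direction : MemLp (fun ω => D.direction (D.T ω) ω) 2 P :=
  memLp_subset H.clients.measurable fun s => (H.isL2_direction s).2

/-- Here the local models of unsampled clients pay off: φ s is defined for every fixed s, measurably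
with respect to a σ-algebra independent of the drawn set. -/
theorem integral_subset {φ : Finset (Fin N) → Ω → ℝ}
    (hφ : ∀ s, Measurable[D.sigma m Set.univ] (φ s)) (hφi : ∀ s, Integrable (φ s) P) :
    ∫ ω, φ (D.T ω) ω ∂P = subsetMean N D.S fun s => ∫ ω, φ s ω ∂P :=
  H.clients.integral_eq H.S_le (H.sigma_le _) H.indep_clients hφ hφi

theorem integral_ite_mem (i : Fin N) {a b : Ω → ℝ} (ha : Measurable[D.sigma m Set.univ] a)
    (hb : Measurable[D.sigma m Set.univ] b) (hai : Integrable a P) (hbi : Integrable b P) :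
    ∫ ω, (if i ∈ D.T ω then a ω else b ω) ∂P
      = (D.S : ℝ) / N * ∫ ω, a ω ∂P + (1 - (D.S : ℝ) / N) * ∫ ω, b ω ∂P := by
  have h := H.integral_subset (φ := fun s ω => if i ∈ s then a ω else b ω)
    (fun s => by split_ifs <;> assumption) (fun s => by split_ifs <;> assumption)
  rw [h, ← subsetMean_ite_mem H.one_le_S H.S_le i]
  refine subsetMean_congr fun s _ => ?_
  split_ifs <;> rfl

/-- The update is unbiased for the full average. The fresh noise is orthogonal to the past, each
client is drawn with weight S/N, and the corrections c - c_i sum to zero over all clients because c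
is the mean of the c_i. -/
theorem integral_inner_direction {W : Ω → Vec d} (hW : IsL2 m P W) :
    ∫ ω, ⟪W ω, D.direction (D.T ω) ω⟫_ℝ ∂P
      = ∫ ω, ⟪W ω, (1 / (N : ℝ)) • ∑ i, D.meanGrad i ω⟫_ℝ ∂P := by
  have hm := D.le_sigma m Set.univ
  have hN := H.N_pos
  have hS := H.S_pos
  have hW' := hW.mono hm
  have hG := fun i => hW'.integrable_inner (H.isL2_meanGrad i)
  have hn := fun i => hW'.integrable_inner (H.isL2_meanNoise i)
  have hd := fun i => hW.integrable_inner ((H.isL2_ci i).sub H.isL2_c)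
  rw [H.integral_subset (φ := fun s ω => ⟪W ω, D.direction s ω⟫_ℝ)
    (fun s => hW'.measurable_inner (H.isL2_direction s))
    (fun s => hW'.integrable_inner (H.isL2_direction s))]
  have h1 : ∀ s, ∫ ω, ⟪W ω, D.direction s ω⟫_ℝ ∂P = 1 / (D.S : ℝ) * ∑ i ∈ s,
      (∫ ω, ⟪W ω, D.meanGrad i ω⟫_ℝ ∂P - ∫ ω, ⟪W ω, D.ci i ω - D.c ω⟫_ℝ ∂P) := by
    intro s
    have e1 : ∀ ω, ⟪W ω, D.direction s ω⟫_ℝ = 1 / (D.S : ℝ) * ∑ i ∈ s,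
        (⟪W ω, D.meanGrad i ω⟫_ℝ + ⟪W ω, D.meanNoise i ω⟫_ℝ - ⟪W ω, D.ci i ω - D.c ω⟫_ℝ) := by
      intro ω
      rw [direction, real_inner_smul_right, inner_sum]
      congr 1
      refine Finset.sum_congr rfl fun i _ => ?_
      rw [← inner_add_right, ← inner_sub_right]
      congr 1
      abel
    simp_rw [e1]
    have hi : ∀ i, Integrable (fun ω => ⟪W ω, D.meanGrad i ω⟫_ℝ + ⟪W ω, D.meanNoise i ω⟫_ℝ
        - ⟪W ω, D.ci i ω - D.c ω⟫_ℝ) P := fun i => ((hG i).add (hn i)).sub (hd i)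
    rw [integral_const_mul, integral_finsetSum _ fun i _ => hi i]
    congr 1
    refine Finset.sum_congr rfl fun i _ => ?_
    rw [integral_sub (by exact (hG i).add (hn i)) (hd i), integral_add (hG i) (hn i),
      H.integral_inner_meanNoise hW i, add_zero]
  simp_rw [h1]
  rw [subsetMean_const_mul, subsetMean_sum_mem H.one_le_S H.S_le]
  have h2 : ∑ i, ∫ ω, ⟪W ω, D.ci i ω - D.c ω⟫_ℝ ∂P = 0 := by
    rw [← integral_finsetSum _ fun i _ => hd i]
    simp_rw [← inner_sum]
    have : ∀ ω, ∑ i, (D.ci i ω - D.c ω) = 0 := by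
      intro ω
      rw [Finset.sum_sub_distrib, H.c_eq]
      simp only [Finset.sum_const, Finset.card_univ, Fintype.card_fin]
      rw [← Nat.cast_smul_eq_nsmul ℝ, smul_smul]
      simp [hN.ne']
    simp [this]
  rw [Finset.sum_sub_distrib, h2, sub_zero]
  simp_rw [real_inner_smul_right, inner_sum]
  rw [integral_const_mul, integral_finsetSum _ fun i _ => hG i]
  field_simp

theorem average_meanGrad_sub_sq_le :
    1 / (N : ℝ) * ∑ i, ∫ ω, ‖D.meanGrad i ω - ∇ (D.f i) (D.x ω)‖ ^ 2 ∂P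
      ≤ β ^ 2 * D.drift P := by
  have hm := D.le_sigma m Set.univ
  have hx := H.isL2_x.mono hm
  have h0 : β ^ 2 * D.drift P = 1 / (N : ℝ) * ∑ i, β ^ 2 * (1 / (D.K : ℝ) *
      ∑ k ∈ Finset.range D.K, ∫ ω, ‖D.y i k ω - D.x ω‖ ^ 2 ∂P) := by
    rw [drift, mul_left_comm]
    congr 1
    rw [Finset.mul_sum]
  rw [h0]
  refine mul_le_mul_of_nonneg_left (Finset.sum_le_sum fun i _ => ?_) (by positivity)
  have hi : ∀ k, Integrable (fun ω => ‖D.y i k ω - D.x ω‖ ^ 2) P := fun k =>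
    ((H.isL2_y_univ i k).sub hx).integrable_sq
  rw [← integral_finsetSum _ fun k _ => hi k, ← integral_const_mul, ← integral_const_mul]
  refine integral_mono ((H.isL2_meanGrad i).sub (hx.gradient (H.smooth i))).integrable_sq
    (((integrable_finsetSum _ fun k _ => hi k).const_mul _).const_mul _) fun ω => ?_
  have h1 : D.meanGrad i ω - ∇ (D.f i) (D.x ω) = (1 / (D.K : ℝ)) • ∑ k ∈ Finset.range D.K,
      (∇ (D.f i) (D.y i k ω) - ∇ (D.f i) (D.x ω)) := by
    rw [Finset.sum_sub_distrib, smul_sub, meanGrad]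
    congr 1
    simp only [Finset.sum_const, Finset.card_range]
    rw [← Nat.cast_smul_eq_nsmul ℝ, smul_smul]
    simp [H.K_pos.ne']
  simp only [h1]
  refine (norm_average_range_sq_le _ _).trans ?_
  rw [mul_left_comm (β ^ 2)]
  refine mul_le_mul_of_nonneg_left ?_ (by positivity)
  rw [Finset.mul_sum]
  refine Finset.sum_le_sum fun k _ => ?_
  rw [← mul_pow]
  gcongr
  exact (H.smooth i).2 _ _

/-- An average of square integrable variables over the clients of the round. -/
theorem subsetMean_integral_average_sq_le {a : Fin N → Ω → Vec d}
    (ha : ∀ i, IsL2 m' P (a i)) :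
    subsetMean N D.S (fun s => ∫ ω, ‖(1 / (D.S : ℝ)) • ∑ i ∈ s, a i ω‖ ^ 2 ∂P)
      ≤ 1 / (N : ℝ) * ∑ i, ∫ ω, ‖a i ω‖ ^ 2 ∂P := by
  have hi : ∀ s : Finset (Fin N), Integrable
      (fun ω => ‖(1 / (D.S : ℝ)) • ∑ i ∈ s, a i ω‖ ^ 2) P := fun s =>
    ((IsL2.sum s fun i _ => ha i).const_smul _).integrable_sq
  have hi' := fun i => (ha i).integrable_sq
  rw [subsetMean, ← integral_finsetSum _ fun s _ => hi s, ← integral_const_mul,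
    ← integral_finsetSum _ fun i _ => hi' i, ← integral_const_mul]
  exact integral_mono ((integrable_finsetSum _ fun s _ => hi s).const_mul _)
    ((integrable_finsetSum _ fun i _ => hi' i).const_mul _)
    fun ω => subsetMean_norm_average_sq_le H.one_le_S H.S_le fun i => a i ω

theorem subsetMean_integral_average_sq_le_of_centered {a : Fin N → Ω → Vec d}
    (ha : ∀ i, IsL2 m' P (a i)) (h0 : ∀ ω, ∑ i, a i ω = 0) :
    subsetMean N D.S (fun s => ∫ ω, ‖(1 / (D.S : ℝ)) • ∑ i ∈ s, a i ω‖ ^ 2 ∂P)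
      ≤ 1 / (D.S : ℝ) * (1 / (N : ℝ) * ∑ i, ∫ ω, ‖a i ω‖ ^ 2 ∂P) := by
  have hi : ∀ s : Finset (Fin N), Integrable
      (fun ω => ‖(1 / (D.S : ℝ)) • ∑ i ∈ s, a i ω‖ ^ 2) P := fun s =>
    ((IsL2.sum s fun i _ => ha i).const_smul _).integrable_sq
  have hi' := fun i => (ha i).integrable_sq
  rw [subsetMean, ← integral_finsetSum _ fun s _ => hi s, ← integral_const_mul,
    ← integral_finsetSum _ fun i _ => hi' i, ← integral_const_mul, ← integral_const_mul]
  exact integral_mono ((integrable_finsetSum _ fun s _ => hi s).const_mul _)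
    (((integrable_finsetSum _ fun i _ => hi' i).const_mul _).const_mul _)
    fun ω => subsetMean_norm_average_sq_le_of_centered H.one_le_S H.S_le (fun i => a i ω) (h0 ω)

/-- The direction has four parts: the change of the gradients along the local run, the exact
direction, the centered control noise and the fresh noise. The first two are averaged by convexity
only; each of the two noise parts contributes σ²/(KS). -/
theorem integral_direction_sq_le :
    ∫ ω, ‖D.direction (D.T ω) ω‖ ^ 2 ∂P
      ≤ 4 * (β ^ 2 * D.drift P + D.exactSq P + 2 * (σ ^ 2 / (D.K * D.S))) := by
  have hm := D.le_sigma m Set.univ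
  have hN := H.N_pos
  have hS := H.S_pos
  have hK := H.K_pos
  have hx := H.isL2_x.mono hm
  rw [H.integral_subset (φ := fun s ω => ‖D.direction s ω‖ ^ 2)
    (fun s => (H.isL2_direction s).measurable_norm_sq) fun s => (H.isL2_direction s).integrable_sq]
  let a₁ : Fin N → Ω → Vec d := fun i ω => D.meanGrad i ω - ∇ (D.f i) (D.x ω)
  let a₃ : Fin N → Ω → Vec d := fun i ω =>
    (D.ci i ω - D.h i ω) - (1 / (N : ℝ)) • ∑ j, (D.ci j ω - D.h j ω)
  have h₁ : ∀ i, IsL2 (D.sigma m Set.univ) P (a₁ i) := fun i =>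
    (H.isL2_meanGrad i).sub (hx.gradient (H.smooth i))
  have h₂ := fun i => (H.isL2_exactDirection i).mono hm
  have h₃ : ∀ i, IsL2 (D.sigma m Set.univ) P (a₃ i) := fun i => (H.isL2_centeredNoise i).mono hm
  have h₄ := H.isL2_meanNoise
  have hav : ∀ {a : Fin N → Ω → Vec d}, (∀ i, IsL2 (D.sigma m Set.univ) P (a i)) →
      ∀ s : Finset (Fin N), Integrable (fun ω => ‖(1 / (D.S : ℝ)) • ∑ i ∈ s, a i ω‖ ^ 2) P :=
    fun ha s => ((IsL2.sum s fun i _ => ha i).const_smul _).integrable_sq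
  have hsplit : ∀ s, s.card = D.S → ∫ ω, ‖D.direction s ω‖ ^ 2 ∂P
      ≤ 4 * (∫ ω, ‖(1 / (D.S : ℝ)) • ∑ i ∈ s, a₁ i ω‖ ^ 2 ∂P
        + ∫ ω, ‖(1 / (D.S : ℝ)) • ∑ i ∈ s, D.exactDirection i ω‖ ^ 2 ∂P
        + ∫ ω, ‖(1 / (D.S : ℝ)) • ∑ i ∈ s, a₃ i ω‖ ^ 2 ∂P + σ ^ 2 / (D.K * D.S)) := by
    intro s hs
    have h5 := H.integral_average_meanNoise_sq_le hs
    refine le_trans ?_ (mul_le_mul_of_nonneg_left (add_le_add_right h5 _) (by norm_num))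
    have i₁ := (hav h₁ s).add (hav h₂ s)
    have i₂ := i₁.add (hav h₃ s)
    simp only [Pi.add_def] at i₁ i₂
    rw [← integral_add (hav h₁ s) (hav h₂ s), ← integral_add i₁ (hav h₃ s),
      ← integral_add i₂ (hav h₄ s), ← integral_const_mul]
    refine integral_mono (H.isL2_direction s).integrable_sq
      (((((hav h₁ s).add (hav h₂ s)).add (hav h₃ s)).add (hav h₄ s)).const_mul _) fun ω => ?_
    have : D.direction s ω = (1 / (D.S : ℝ)) • ∑ i ∈ s, a₁ i ω
        + (1 / (D.S : ℝ)) • ∑ i ∈ s, D.exactDirection i ω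
        + (-((1 / (D.S : ℝ)) • ∑ i ∈ s, a₃ i ω))
        + (1 / (D.S : ℝ)) • ∑ i ∈ s, D.meanNoise i ω := by
      rw [direction, ← smul_neg, ← smul_add, ← smul_add, ← smul_add, ← Finset.sum_neg_distrib,
        ← Finset.sum_add_distrib, ← Finset.sum_add_distrib, ← Finset.sum_add_distrib]
      congr 1
      refine Finset.sum_congr rfl fun i _ => ?_
      simp only [a₁, a₃]
      rw [average_sub, ← H.c_eq, exactDirection]
      abel
    have h6 := norm_add_four_sq_le ((1 / (D.S : ℝ)) • ∑ i ∈ s, a₁ i ω)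
      ((1 / (D.S : ℝ)) • ∑ i ∈ s, D.exactDirection i ω)
      (-((1 / (D.S : ℝ)) • ∑ i ∈ s, a₃ i ω)) ((1 / (D.S : ℝ)) • ∑ i ∈ s, D.meanNoise i ω)
    rw [← this, norm_neg] at h6
    exact h6
  refine (subsetMean_mono hsplit).trans ?_
  rw [subsetMean_const_mul, subsetMean_add, subsetMean_add, subsetMean_add,
    subsetMean_const H.S_le]
  have g₁ := (H.subsetMean_integral_average_sq_le h₁).trans
    H.average_meanGrad_sub_sq_le
  have g₂ : subsetMean N D.S (fun s => ∫ ω, ‖(1 / (D.S : ℝ)) • ∑ i ∈ s, D.exactDirection i ω‖ ^ 2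
      ∂P) ≤ D.exactSq P := H.subsetMean_integral_average_sq_le h₂
  -- The centered control noises sum to zero, so subset sampling alone gives the factor 1/S. No
  -- independence between the control noises of different clients, possibly of different ages, is
  -- needed.
  have g₃ := H.subsetMean_integral_average_sq_le_of_centered h₃ (fun ω => by
    simp only [a₃]
    rw [Finset.sum_sub_distrib]
    simp only [Finset.sum_const, Finset.card_univ, Fintype.card_fin]
    rw [← Nat.cast_smul_eq_nsmul ℝ, smul_smul]
    simp [hN.ne'])
  have g₃' : 1 / (D.S : ℝ) * (1 / (N : ℝ) * ∑ i, ∫ ω, ‖a₃ i ω‖ ^ 2 ∂P)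
      ≤ σ ^ 2 / (D.K * D.S) := by
    calc _ ≤ 1 / (D.S : ℝ) * (σ ^ 2 / D.K) := by
          gcongr; exact H.average_centeredNoise_le
      _ = _ := by field_simp
  linarith

end IsValid

end RoundData

theorem integrable_comp_of_memLp {Ω : Type*} {d : ℕ} [MeasurableSpace Ω]
    {P : Measure Ω} [IsFiniteMeasure P] {β : ℝ} {h : Vec d → ℝ} {X : Ω → Vec d}
    (hX : MemLp X 2 P) (hβ : 0 ≤ β) (hh : IsSmooth β h) : Integrable (fun ω => h (X ω)) P := by
  have h1 : Integrable (fun ω => |h 0| + ‖∇ h 0‖ ^ 2 + ‖X ω‖ ^ 2 + ‖∇ h (X ω)‖ ^ 2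
      + β * ‖X ω‖ ^ 2) P :=
    ((((integrable_const _).add (integrable_const _)).add (integrable_norm_sq_of_memLp hX)).add
      (integrable_norm_sq_of_memLp (memLp_gradient hh hX))).add ((integrable_norm_sq_of_memLp hX).const_mul _)
  refine h1.mono (hh.1.continuous.comp_aestronglyMeasurable hX.1)
    (Filter.Eventually.of_forall fun ω => ?_)
  -- The quadratic upper bound is used from 0 to X and from X to 0; the second use bounds h (X ω)
  -- from below without convexity.
  have e1 := hh.le_quadratic 0 (X ω)
  have e2 := hh.le_quadratic (X ω) 0
  rw [sub_zero] at e1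
  rw [zero_sub, inner_neg_right, norm_neg] at e2
  have e3 := real_inner_le_norm (∇ h 0) (X ω)
  have e4 := abs_le.1 (abs_real_inner_le_norm (∇ h (X ω)) (X ω))
  have e5 := abs_le.1 (le_refl |h 0|)
  have e6 : 0 ≤ β * ‖X ω‖ ^ 2 := by positivity
  rw [Real.norm_of_nonneg (by positivity : 0 ≤ |h 0| + ‖∇ h 0‖ ^ 2 + ‖X ω‖ ^ 2
    + ‖∇ h (X ω)‖ ^ 2 + β * ‖X ω‖ ^ 2), Real.norm_eq_abs, abs_le]
  constructor
  · nlinarith [sq_nonneg (‖∇ h (X ω)‖ - ‖X ω‖), sq_nonneg ‖∇ h 0‖, sq_nonneg ‖X ω‖,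
      sq_nonneg ‖∇ h (X ω)‖]
  · nlinarith [sq_nonneg (‖∇ h 0‖ - ‖X ω‖), sq_nonneg ‖∇ h 0‖, sq_nonneg ‖X ω‖,
      sq_nonneg ‖∇ h (X ω)‖]

/-! ### The one-round recursion in the convex cases. -/

namespace RoundData

variable {d N : ℕ} {Ω Ξ : Type*} (D : RoundData d N Ω Ξ)

/-- The next server model, for the effective step-size `a`. -/
noncomputable def nextX (a : ℝ) (ω : Ω) : Vec d := D.x ω - a • D.direction (D.T ω) ω

/-- A refreshed client replaces its exact part by the mean of true gradients along its local run;
`nextCi` adds the mean noise of the same run. That `nextCi` is the control variate of option II is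
`newControl_y_last`. -/
noncomputable def nextH (i : Fin N) (ω : Ω) : Vec d :=
  if i ∈ D.T ω then D.meanGrad i ω else D.h i ω

noncomputable def nextCi (i : Fin N) (ω : Ω) : Vec d :=
  if i ∈ D.T ω then D.meanGrad i ω + D.meanNoise i ω else D.ci i ω

namespace IsValid

variable {D} {m : MeasurableSpace Ω} [mΩ : MeasurableSpace Ω] [MeasurableSpace Ξ]
  {P : Measure Ω} {ν : Fin N → Measure Ξ} {β σ : ℝ} (H : D.IsValid m P ν β σ)
  [IsProbabilityMeasure P] [∀ i, IsProbabilityMeasure (ν i)]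
include H

theorem drift_nonneg : 0 ≤ D.drift P := by
  unfold drift
  have : ∀ i k, 0 ≤ ∫ ω, ‖D.y i k ω - D.x ω‖ ^ 2 ∂P := fun i k =>
    integral_nonneg fun ω => by positivity
  positivity

theorem exactSq_nonneg : 0 ≤ D.exactSq P := by
  unfold exactSq
  have : ∀ i, 0 ≤ ∫ ω, ‖D.exactDirection i ω‖ ^ 2 ∂P := fun i =>
    integral_nonneg fun ω => by positivity
  positivity

theorem integral_ite_norm_sq (i : Fin N) {a b : Ω → Vec d} (ha : IsL2 (D.sigma m Set.univ) P a)
    (hb : IsL2 (D.sigma m Set.univ) P b) :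
    ∫ ω, ‖(if i ∈ D.T ω then a ω else b ω)‖ ^ 2 ∂P
      = (D.S : ℝ) / N * ∫ ω, ‖a ω‖ ^ 2 ∂P + (1 - (D.S : ℝ) / N) * ∫ ω, ‖b ω‖ ^ 2 ∂P := by
  rw [← H.integral_ite_mem i ha.measurable_norm_sq hb.measurable_norm_sq ha.integrable_sq
    hb.integrable_sq]
  refine integral_congr_ae (Filter.Eventually.of_forall fun ω => ?_)
  simp only
  split_ifs <;> rfl

theorem S_div_N_le_one : (D.S : ℝ) / N ≤ 1 := by
  rw [div_le_one H.N_pos]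
  exact_mod_cast H.S_le

theorem S_div_N_pos : 0 < (D.S : ℝ) / N := div_pos H.S_pos H.N_pos

/-- The control noise is fresh with probability S/N and inherited otherwise. Both have second moment
at most σ²/K, hence so does the mixture. -/
theorem next_noise_le (i : Fin N) : ∫ ω, ‖D.nextCi i ω - D.nextH i ω‖ ^ 2 ∂P ≤ σ ^ 2 / D.K := by
  have hm := D.le_sigma m Set.univ
  have h1 : ∀ ω, D.nextCi i ω - D.nextH i ω
      = if i ∈ D.T ω then D.meanNoise i ω else D.ci i ω - D.h i ω := by
    intro ω
    simp only [nextCi, nextH]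
    split_ifs
    · abel
    · rfl
  simp_rw [h1]
  rw [H.integral_ite_norm_sq i (H.isL2_meanNoise i) ((H.isL2_controlNoise i).mono hm)]
  have h2 := H.integral_meanNoise_sq_le i
  have h3 := H.noise_le i
  have h4 := H.S_div_N_pos
  have h5 := H.S_div_N_le_one
  nlinarith

theorem integral_nextX_sub_sq (a : ℝ) (v : Vec d) :
    ∫ ω, ‖D.nextX a ω - v‖ ^ 2 ∂P = ∫ ω, ‖D.x ω - v‖ ^ 2 ∂P
      - 2 * a * ∫ ω, ⟪D.x ω - v, (1 / (N : ℝ)) • ∑ i, D.meanGrad i ω⟫_ℝ ∂P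
      + a ^ 2 * ∫ ω, ‖D.direction (D.T ω) ω‖ ^ 2 ∂P := by
  have hx : IsL2 m P (fun ω => D.x ω - v) := H.isL2_x.sub (IsL2.const v)
  have hd := H.memLp_direction
  rw [← H.integral_inner_direction hx]
  have h1 : ∀ ω, ‖D.nextX a ω - v‖ ^ 2 = ‖D.x ω - v‖ ^ 2
      - 2 * a * ⟪D.x ω - v, D.direction (D.T ω) ω⟫_ℝ + a ^ 2 * ‖D.direction (D.T ω) ω‖ ^ 2 := by
    intro ω
    have : D.nextX a ω - v = (D.x ω - v) - a • D.direction (D.T ω) ω := by rw [nextX]; abel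
    rw [this, norm_sub_sq_real, norm_smul, mul_pow, Real.norm_eq_abs, sq_abs,
      real_inner_smul_right]
    ring
  simp_rw [h1]
  have i1 := integrable_inner_of_memLp hx.2 hd
  have i2 : Integrable (fun ω => ‖D.x ω - v‖ ^ 2
      - 2 * a * ⟪D.x ω - v, D.direction (D.T ω) ω⟫_ℝ) P := hx.integrable_sq.sub (i1.const_mul _)
  rw [integral_add i2 ((integrable_norm_sq_of_memLp hd).const_mul _),
    integral_sub hx.integrable_sq (i1.const_mul _), integral_const_mul, integral_const_mul]

theorem integrable_objective : Integrable (fun ω => objective D.f (D.x ω)) P :=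
  integrable_comp_of_memLp H.isL2_x.2 H.β_pos.le (isSmooth_objective H.one_le_N H.smooth)

theorem integrable_inner_meanGrad {W : Ω → Vec d} (hW : IsL2 m P W) :
    Integrable (fun ω => ⟪W ω, (1 / (N : ℝ)) • ∑ i, D.meanGrad i ω⟫_ℝ) P :=
  (hW.mono (D.le_sigma m Set.univ)).integrable_inner
    ((IsL2.sum _ fun i _ => H.isL2_meanGrad i).const_smul _)

section Convex

variable {μ : ℝ} (hμ : 0 ≤ μ) (hc : ∀ i, IsMuConvex μ (D.f i)) {xs : Vec d}
  (hxs : ∀ x, objective D.f xs ≤ objective D.f x)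

include hμ hc in
-- Perturbed convexity (`inner_gradient_le`) at every local point of every client. The price of
-- evaluating gradients away from x is exactly β times the drift.
theorem neg_integral_inner_meanGrad_le :
    -∫ ω, ⟪D.x ω - xs, (1 / (N : ℝ)) • ∑ i, D.meanGrad i ω⟫_ℝ ∂P
      ≤ -∫ ω, (objective D.f (D.x ω) - objective D.f xs) ∂P
        - μ / 4 * ∫ ω, ‖D.x ω - xs‖ ^ 2 ∂P + β * D.drift P := by
  have hx : IsL2 m P (fun ω => D.x ω - xs) := H.isL2_x.sub (IsL2.const xs)
  have hi : ∀ i k, Integrable (fun ω => ‖D.y i k ω - D.x ω‖ ^ 2) P := fun i k =>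
    ((H.isL2_y_univ i k).sub (H.isL2_x.mono (D.le_sigma m _))).integrable_sq
  have hN := H.N_pos
  have hK := H.K_pos
  have hdr : D.drift P = ∫ ω, 1 / (N : ℝ) * ∑ i, 1 / (D.K : ℝ) *
      ∑ k ∈ Finset.range D.K, ‖D.y i k ω - D.x ω‖ ^ 2 ∂P := by
    rw [integral_const_mul, integral_finsetSum _ fun i _ =>
      (integrable_finsetSum _ fun k _ => hi i k).const_mul _, drift]
    congr 1
    refine Finset.sum_congr rfl fun i _ => ?_
    rw [integral_const_mul, integral_finsetSum _ fun k _ => hi i k]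
  have hdi : Integrable (fun ω => 1 / (N : ℝ) * ∑ i, 1 / (D.K : ℝ) *
      ∑ k ∈ Finset.range D.K, ‖D.y i k ω - D.x ω‖ ^ 2) P :=
    (integrable_finsetSum _ fun i _ =>
      (integrable_finsetSum _ fun k _ => hi i k).const_mul _).const_mul _
  have hob : Integrable (fun ω => objective D.f (D.x ω) - objective D.f xs) P :=
    H.integrable_objective.sub (integrable_const _)
  have hob' : Integrable (fun ω => -(objective D.f (D.x ω) - objective D.f xs)) P := hob.neg
  have h2 : Integrable (fun ω => -(objective D.f (D.x ω) - objective D.f xs)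
      - μ / 4 * ‖D.x ω - xs‖ ^ 2) P := hob'.sub (hx.integrable_sq.const_mul _)
  rw [hdr, ← integral_neg, ← integral_neg, ← integral_const_mul, ← integral_const_mul,
    ← integral_sub hob' (hx.integrable_sq.const_mul _), ← integral_add h2 (hdi.const_mul _)]
  refine integral_mono (H.integrable_inner_meanGrad hx).neg (h2.add (hdi.const_mul _)) fun ω => ?_
  have e1 : -⟪D.x ω - xs, (1 / (N : ℝ)) • ∑ i, D.meanGrad i ω⟫_ℝ
      = 1 / (N : ℝ) * ∑ i, 1 / (D.K : ℝ) *
        ∑ k ∈ Finset.range D.K, ⟪∇ (D.f i) (D.y i k ω), xs - D.x ω⟫_ℝ := by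
    rw [← inner_neg_left, neg_sub, real_inner_smul_right, inner_sum]
    congr 1
    refine Finset.sum_congr rfl fun i _ => ?_
    rw [meanGrad, real_inner_smul_right, inner_sum]
    congr 1
    refine Finset.sum_congr rfl fun k _ => real_inner_comm _ _
  simp only
  rw [e1]
  calc 1 / (N : ℝ) * ∑ i, 1 / (D.K : ℝ) *
        ∑ k ∈ Finset.range D.K, ⟪∇ (D.f i) (D.y i k ω), xs - D.x ω⟫_ℝ
      ≤ 1 / (N : ℝ) * ∑ i, 1 / (D.K : ℝ) * ∑ k ∈ Finset.range D.K,
          (-(D.f i (D.x ω) - D.f i xs) - μ / 4 * ‖D.x ω - xs‖ ^ 2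
            + β * ‖D.y i k ω - D.x ω‖ ^ 2) := by
        gcongr with i _ k _
        exact inner_gradient_le (H.smooth i) hμ (hc i) _ _ _
    _ = _ := by
        have : ∀ i, 1 / (D.K : ℝ) * ∑ k ∈ Finset.range D.K,
            (-(D.f i (D.x ω) - D.f i xs) - μ / 4 * ‖D.x ω - xs‖ ^ 2
              + β * ‖D.y i k ω - D.x ω‖ ^ 2)
            = -(D.f i (D.x ω) - D.f i xs) - μ / 4 * ‖D.x ω - xs‖ ^ 2
              + β * (1 / (D.K : ℝ) * ∑ k ∈ Finset.range D.K, ‖D.y i k ω - D.x ω‖ ^ 2) := by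
          intro i
          rw [Finset.sum_add_distrib, ← Finset.mul_sum]
          simp only [Finset.sum_const, Finset.card_range, nsmul_eq_mul]
          field_simp
        obtain ⟨q, hq⟩ : ∃ q : Fin N → ℝ, ∀ i, q i = 1 / (D.K : ℝ) *
          ∑ k ∈ Finset.range D.K, ‖D.y i k ω - D.x ω‖ ^ 2 := ⟨_, fun _ => rfl⟩
        simp_rw [this, ← hq]
        rw [Finset.sum_add_distrib, Finset.sum_sub_distrib, Finset.sum_neg_distrib,
          Finset.sum_sub_distrib, ← Finset.mul_sum, ← Finset.mul_sum, objective, objective]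
        simp only [Finset.sum_const, Finset.card_univ, Fintype.card_fin, nsmul_eq_mul]
        field_simp

include hμ hc hxs in
theorem average_integral_gradient_sub_sq_le :
    1 / (N : ℝ) * ∑ i, ∫ ω, ‖∇ (D.f i) (D.x ω) - ∇ (D.f i) xs‖ ^ 2 ∂P
      ≤ 2 * β * ∫ ω, (objective D.f (D.x ω) - objective D.f xs) ∂P := by
  have hi : ∀ i, Integrable (fun ω => ‖∇ (D.f i) (D.x ω) - ∇ (D.f i) xs‖ ^ 2) P := fun i =>
    ((H.isL2_x.gradient (H.smooth i)).sub (IsL2.const (∇ (D.f i) xs))).integrable_sq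
  rw [← integral_finsetSum _ fun i _ => hi i, ← integral_const_mul, ← integral_const_mul]
  refine integral_mono ((integrable_finsetSum _ fun i _ => hi i).const_mul _)
    ((H.integrable_objective.sub (integrable_const _)).const_mul _) fun ω => ?_
  exact average_norm_gradient_sub_sq_le H.β_pos H.smooth (fun i => (hc i).zero hμ) hxs _

include hμ hc hxs in
-- Since the ∇f_i(xs) sum to zero, they may be subtracted both from ∇f_i(x) and from h_i. The first
-- difference is bounded by the gap through co-coercivity; centering the second over the clients
-- does not increase it.
theorem exactSq_le_of_convex :
    D.exactSq P ≤ 4 * β * ∫ ω, (objective D.f (D.x ω) - objective D.f xs) ∂P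
      + 2 * (1 / (N : ℝ) * ∑ i, ∫ ω, ‖D.h i ω - ∇ (D.f i) xs‖ ^ 2 ∂P) := by
  have h1 := H.average_integral_gradient_sub_sq_le hμ hc hxs
  have hi : ∀ i, Integrable (fun ω => ‖∇ (D.f i) (D.x ω) - ∇ (D.f i) xs‖ ^ 2) P := fun i =>
    ((H.isL2_x.gradient (H.smooth i)).sub (IsL2.const (∇ (D.f i) xs))).integrable_sq
  have hj : ∀ i, Integrable (fun ω => ‖D.h i ω - ∇ (D.f i) xs‖ ^ 2) P := fun i =>
    ((H.isL2_h i).sub (IsL2.const (∇ (D.f i) xs))).integrable_sq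
  have hsi := (integrable_finsetSum Finset.univ fun i _ => hi i)
  have hsj := (integrable_finsetSum Finset.univ fun i _ => hj i)
  have h2 : D.exactSq P
      ≤ 2 * (1 / (N : ℝ) * ∑ i, ∫ ω, ‖∇ (D.f i) (D.x ω) - ∇ (D.f i) xs‖ ^ 2 ∂P)
        + 2 * (1 / (N : ℝ) * ∑ i, ∫ ω, ‖D.h i ω - ∇ (D.f i) xs‖ ^ 2 ∂P) := by
    rw [exactSq, ← integral_finsetSum _ fun i _ => (H.isL2_exactDirection i).integrable_sq,
      ← integral_finsetSum _ fun i _ => hi i, ← integral_finsetSum _ fun i _ => hj i,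
      ← integral_const_mul, ← integral_const_mul, ← integral_const_mul, ← integral_const_mul,
      ← integral_const_mul,
      ← integral_add ((hsi.const_mul _).const_mul _) ((hsj.const_mul _).const_mul _)]
    refine integral_mono ((integrable_finsetSum _ fun i _ =>
      (H.isL2_exactDirection i).integrable_sq).const_mul _)
      (((hsi.const_mul _).const_mul _).add ((hsj.const_mul _).const_mul _)) fun ω => ?_
    have h0 := gradient_eq_zero_of_forall_le hxs
    rw [gradient_objective fun i => (H.smooth i).1] at h0
    have e1 : ∀ i, D.exactDirection i ω = (∇ (D.f i) (D.x ω) - ∇ (D.f i) xs)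
        - ((D.h i ω - ∇ (D.f i) xs)
          - (1 / (N : ℝ)) • ∑ j, (D.h j ω - ∇ (D.f j) xs)) := by
      intro i
      rw [average_sub, h0, exactDirection]
      abel
    have e2 := average_norm_sub_average_sq_le H.one_le_N fun i => D.h i ω - ∇ (D.f i) xs
    calc 1 / (N : ℝ) * ∑ i, ‖D.exactDirection i ω‖ ^ 2
        ≤ 1 / (N : ℝ) * ∑ i, (2 * ‖∇ (D.f i) (D.x ω) - ∇ (D.f i) xs‖ ^ 2
          + 2 * ‖(D.h i ω - ∇ (D.f i) xs)
            - (1 / (N : ℝ)) • ∑ j, (D.h j ω - ∇ (D.f j) xs)‖ ^ 2) := by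
          gcongr with i _
          rw [e1]
          exact norm_sub_sq_le_two _ _
      _ = 2 * (1 / (N : ℝ) * ∑ i, ‖∇ (D.f i) (D.x ω) - ∇ (D.f i) xs‖ ^ 2)
          + 2 * (1 / (N : ℝ) * ∑ i, ‖(D.h i ω - ∇ (D.f i) xs)
            - (1 / (N : ℝ)) • ∑ j, (D.h j ω - ∇ (D.f j) xs)‖ ^ 2) := by
          rw [Finset.sum_add_distrib, ← Finset.mul_sum, ← Finset.mul_sum]; ring
      _ ≤ 2 * (1 / (N : ℝ) * ∑ i, ‖∇ (D.f i) (D.x ω) - ∇ (D.f i) xs‖ ^ 2)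
          + 2 * (1 / (N : ℝ) * ∑ i, ‖D.h i ω - ∇ (D.f i) xs‖ ^ 2) := by gcongr
  linarith

include hμ hc hxs in
-- With probability S/N the old error of h_i is replaced by that of a gradient near x, which gap and
-- drift control. This is the contraction that makes the control variates learn the gradients at the
-- minimizer.
theorem average_nextH_sub_sq_le :
    1 / (N : ℝ) * ∑ i, ∫ ω, ‖D.nextH i ω - ∇ (D.f i) xs‖ ^ 2 ∂P
      ≤ (D.S : ℝ) / N * (4 * β * ∫ ω, (objective D.f (D.x ω) - objective D.f xs) ∂P
          + 2 * β ^ 2 * D.drift P)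
        + (1 - (D.S : ℝ) / N) *
          (1 / (N : ℝ) * ∑ i, ∫ ω, ‖D.h i ω - ∇ (D.f i) xs‖ ^ 2 ∂P) := by
  have hm := D.le_sigma m Set.univ
  have h1 := H.average_integral_gradient_sub_sq_le hμ hc hxs
  have h2 := H.average_meanGrad_sub_sq_le
  have hG : ∀ i, IsL2 (D.sigma m Set.univ) P (fun ω => D.meanGrad i ω - ∇ (D.f i) xs) := fun i =>
    (H.isL2_meanGrad i).sub (IsL2.const (∇ (D.f i) xs))
  have e1 : ∀ i, ∫ ω, ‖D.nextH i ω - ∇ (D.f i) xs‖ ^ 2 ∂P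
      = (D.S : ℝ) / N * ∫ ω, ‖D.meanGrad i ω - ∇ (D.f i) xs‖ ^ 2 ∂P
        + (1 - (D.S : ℝ) / N) * ∫ ω, ‖D.h i ω - ∇ (D.f i) xs‖ ^ 2 ∂P := by
    intro i
    rw [← H.integral_ite_norm_sq i (hG i)
      (((H.isL2_h i).sub (IsL2.const (∇ (D.f i) xs))).mono hm)]
    refine integral_congr_ae (Filter.Eventually.of_forall fun ω => ?_)
    simp only [nextH]
    split_ifs <;> rfl
  have e2 : ∀ i, ∫ ω, ‖D.meanGrad i ω - ∇ (D.f i) xs‖ ^ 2 ∂P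
      ≤ 2 * ∫ ω, ‖D.meanGrad i ω - ∇ (D.f i) (D.x ω)‖ ^ 2 ∂P
        + 2 * ∫ ω, ‖∇ (D.f i) (D.x ω) - ∇ (D.f i) xs‖ ^ 2 ∂P := by
    intro i
    have hx := H.isL2_x.gradient (H.smooth i)
    have i1 := ((H.isL2_meanGrad i).sub (hx.mono hm)).integrable_sq
    have i2 := (hx.sub (IsL2.const (∇ (D.f i) xs))).integrable_sq
    rw [← integral_const_mul, ← integral_const_mul,
      ← integral_add (i1.const_mul _) (i2.const_mul _)]
    refine integral_mono (hG i).integrable_sq ((i1.const_mul _).add (i2.const_mul _)) fun ω => ?_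
    have : D.meanGrad i ω - ∇ (D.f i) xs = (D.meanGrad i ω - ∇ (D.f i) (D.x ω))
      + (∇ (D.f i) (D.x ω) - ∇ (D.f i) xs) := by abel
    simp only [this]
    exact norm_add_sq_le_two _ _
  have e3 : 1 / (N : ℝ) * ∑ i, ∫ ω, ‖D.meanGrad i ω - ∇ (D.f i) xs‖ ^ 2 ∂P
      ≤ 2 * (1 / (N : ℝ) * ∑ i, ∫ ω, ‖D.meanGrad i ω - ∇ (D.f i) (D.x ω)‖ ^ 2 ∂P)
        + 2 * (1 / (N : ℝ) * ∑ i, ∫ ω, ‖∇ (D.f i) (D.x ω) - ∇ (D.f i) xs‖ ^ 2 ∂P) := by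
    calc _ ≤ 1 / (N : ℝ) * ∑ i, (2 * ∫ ω, ‖D.meanGrad i ω - ∇ (D.f i) (D.x ω)‖ ^ 2 ∂P
          + 2 * ∫ ω, ‖∇ (D.f i) (D.x ω) - ∇ (D.f i) xs‖ ^ 2 ∂P) := by
          gcongr with i; exact e2 i
      _ = _ := by rw [Finset.sum_add_distrib, ← Finset.mul_sum, ← Finset.mul_sum]; ring
  simp_rw [e1]
  rw [Finset.sum_add_distrib, ← Finset.mul_sum, ← Finset.mul_sum, mul_add, mul_left_comm,
    mul_left_comm (1 / (N : ℝ)) (1 - (D.S : ℝ) / N)]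
  have h4 := H.S_div_N_pos
  gcongr
  linarith

/-- One round in the convex case. -/
theorem convex_round_le {a : ℝ} (hμ : 0 ≤ μ) (hc : ∀ i, IsMuConvex μ (D.f i))
    (hxs : ∀ x, objective D.f xs ≤ objective D.f x) (hη : 0 < D.ηl)
    (ha : D.K * D.ηl ≤ a) (haβ : a * β ≤ 1 / 81) (haμ : μ * a ≤ (D.S : ℝ) / N / 15) :
    ∫ ω, ‖D.nextX a ω - xs‖ ^ 2 ∂P + 13 * ((N : ℝ) / D.S) * a ^ 2 *
        (1 / (N : ℝ) * ∑ i, ∫ ω, ‖D.nextH i ω - ∇ (D.f i) xs‖ ^ 2 ∂P)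
      ≤ (1 - μ * a / 2) * (∫ ω, ‖D.x ω - xs‖ ^ 2 ∂P + 13 * ((N : ℝ) / D.S) * a ^ 2 *
        (1 / (N : ℝ) * ∑ i, ∫ ω, ‖D.h i ω - ∇ (D.f i) xs‖ ^ 2 ∂P))
        - a * ∫ ω, (objective D.f (D.x ω) - objective D.f xs) ∂P
        + 8 * (a ^ 2 * (σ ^ 2 / (D.K * D.S))) + 3 * ((D.K * D.ηl) ^ 2 * (σ ^ 2 / D.K)) := by
  have h1 := H.neg_integral_inner_meanGrad_le hμ hc (xs := xs)
  have h2 := H.exactSq_le_of_convex hμ hc hxs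
  have h3 := H.average_nextH_sub_sq_le hμ hc hxs
  have h4 := H.integral_direction_sq_le
  have h5 := H.drift_le
  have h6 := H.drift_nonneg
  have h7 := H.exactSq_nonneg
  have hρ := H.S_div_N_pos
  have hβ := H.β_pos
  have hb : 0 < D.K * D.ηl := mul_pos H.K_pos hη
  have ha0 : 0 < a := hb.trans_le ha
  have hρinv : (N : ℝ) / D.S = ((D.S : ℝ) / N)⁻¹ := (inv_div _ _).symm
  have hn2 : 0 ≤ σ ^ 2 / (D.K : ℝ) := by positivity
  have hΔ : 0 ≤ ∫ ω, (objective D.f (D.x ω) - objective D.f xs) ∂P :=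
    integral_nonneg fun ω => sub_nonneg.2 (hxs _)
  have hC : 0 ≤ 1 / (N : ℝ) * ∑ i, ∫ ω, ‖D.h i ω - ∇ (D.f i) xs‖ ^ 2 ∂P :=
    mul_nonneg (by positivity) (Finset.sum_nonneg fun i _ => integral_nonneg fun ω => by positivity)
  rw [H.integral_nextX_sub_sq, hρinv]
  generalize ∫ ω, ⟪D.x ω - xs, (1 / (N : ℝ)) • ∑ i, D.meanGrad i ω⟫_ℝ ∂P = I at *
  generalize ∫ ω, (objective D.f (D.x ω) - objective D.f xs) ∂P = Δ at *
  generalize ∫ ω, ‖D.x ω - xs‖ ^ 2 ∂P = X at *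
  generalize 1 / (N : ℝ) * ∑ i, ∫ ω, ‖D.h i ω - ∇ (D.f i) xs‖ ^ 2 ∂P = C at *
  generalize 1 / (N : ℝ) * ∑ i, ∫ ω, ‖D.nextH i ω - ∇ (D.f i) xs‖ ^ 2 ∂P = C' at *
  generalize ∫ ω, ‖D.direction (D.T ω) ω‖ ^ 2 ∂P = M at *
  generalize D.drift P = E at *
  generalize D.exactSq P = Eb at *
  generalize σ ^ 2 / ((D.K : ℝ) * D.S) = n₁ at *
  generalize σ ^ 2 / (D.K : ℝ) = n₂ at *
  generalize (D.K : ℝ) * D.ηl = b at *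
  generalize (D.S : ℝ) / N = ρ at *
  have hb2 : b ^ 2 ≤ a ^ 2 := by gcongr
  have k1 : -(2 * a * I) ≤ 2 * a * (-Δ - μ / 4 * X + β * E) := by
    have := mul_le_mul_of_nonneg_left h1 (by positivity : 0 ≤ 2 * a)
    linarith
  have k2 : a ^ 2 * M ≤ a ^ 2 * (4 * (β ^ 2 * E + Eb + 2 * n₁)) := by gcongr
  -- The weight ρ⁻¹ = N/S turns the contraction by S/N into a gain of 13a²C, independent of N/S.
  have k3 : 13 * ρ⁻¹ * a ^ 2 * C' ≤ 13 * a ^ 2 * (4 * β * Δ + 2 * β ^ 2 * E)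
      + 13 * ρ⁻¹ * a ^ 2 * C - 13 * a ^ 2 * C := by
    calc _ ≤ 13 * ρ⁻¹ * a ^ 2 * (ρ * (4 * β * Δ + 2 * β ^ 2 * E) + (1 - ρ) * C) := by gcongr
      _ = _ := by field_simp; ring
  -- All drift terms: 2aβ from convexity, and 30 = 4 + 26 from the second moment and from the
  -- control error; 192/6561 = 2/81 + 30/81².
  have k4 : (2 * (a * β) + 30 * (a * β) ^ 2) * E ≤ 192 / 6561 * E := by
    have : (a * β) ^ 2 ≤ (1 / 81) ^ 2 := by gcongr
    gcongr
    linarith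
  have k5 : 192 / 6561 * E ≤ 192 / 6561 * (64 * (a ^ 2 * Eb) + 72 * (b ^ 2 * n₂)) := by
    have : b ^ 2 * Eb ≤ a ^ 2 * Eb := by gcongr
    linarith
  have k6 : a ^ 2 * Eb ≤ 4 * (a * β) * (a * Δ) + 2 * (a ^ 2 * C) := by
    calc a ^ 2 * Eb ≤ a ^ 2 * (4 * β * Δ + 2 * C) := by gcongr
      _ = _ := by ring
  have k7 : (a * β) * (a * Δ) ≤ 1 / 81 * (a * Δ) := by gcongr
  -- The contraction factor 1 - μa/2 is asked of the control error too. The bound on μa makes its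
  -- own rate S/N fast enough.
  have k8 : μ * a * ρ⁻¹ * (a ^ 2 * C) ≤ 1 / 15 * (a ^ 2 * C) := by
    gcongr
    rw [← div_eq_mul_inv, div_le_iff₀ hρ]
    linarith
  have k9 : 0 ≤ b ^ 2 * n₂ := by positivity
  have k10 : 0 ≤ a ^ 2 * C := by positivity
  have k11 : 0 ≤ a * Δ := by positivity
  -- The terms in a²Eb add up to less than 6, so C costs less than 12a²C out of the available 13 -
  -- 13/30. The gap keeps a coefficient below -1: -2 plus 52/81 from the control error plus less
  -- than 24/81 through Eb.
  nlinarith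

end Convex

end IsValid

end RoundData

/-! ### The one-round recursion in the non-convex case. -/

theorem average_range_affine {K : ℕ} (hK : 1 ≤ K) (a b c : ℝ) (u v : ℕ → ℝ) :
    1 / (K : ℝ) * ∑ k ∈ Finset.range K, (a * u k + b * v k + c)
      = a * (1 / (K : ℝ) * ∑ k ∈ Finset.range K, u k)
        + b * (1 / (K : ℝ) * ∑ k ∈ Finset.range K, v k) + c := by
  have : (K : ℝ) ≠ 0 := by positivity
  rw [Finset.sum_add_distrib, Finset.sum_add_distrib, ← Finset.mul_sum, ← Finset.mul_sum]
  simp only [Finset.sum_const, Finset.card_range, nsmul_eq_mul]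
  field_simp

theorem average_fin_affine {N : ℕ} (hN : 1 ≤ N) (a b c : ℝ) (u v : Fin N → ℝ) :
    1 / (N : ℝ) * ∑ i, (a * u i + b * v i + c)
      = a * (1 / (N : ℝ) * ∑ i, u i) + b * (1 / (N : ℝ) * ∑ i, v i) + c := by
  have : (N : ℝ) ≠ 0 := by positivity
  rw [Finset.sum_add_distrib, Finset.sum_add_distrib, ← Finset.mul_sum, ← Finset.mul_sum]
  simp only [Finset.sum_const, Finset.card_univ, Fintype.card_fin, nsmul_eq_mul]
  field_simp

/-- Pure arithmetic of the potential. The contraction ρ/4 of the lag gains 10β³a²L, which pays for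
8β³a²L from the second moment M and for the small drift share. The growth 8ρ⁻¹a²q of the lag, times
the weight 40ρ⁻¹β³a², is 320(aβ)³ρ⁻² · aq; this is where `h₃`, and so the power 2/3 of S/N, is
needed. The M in the lag similarly needs `h₂`. -/
theorem nonconvex_recursion_le {a b β ρ F F' L L' q M E Eb n₁ n₂ : ℝ} (hb : 0 < b) (hba : b ≤ a)
    (hβ : 0 < β) (hρ : 0 < ρ) (hL : 0 ≤ L) (hq : 0 ≤ q) (hE : 0 ≤ E) (hM : 0 ≤ M)
    (hn₂ : 0 ≤ n₂)
    (k1 : F' ≤ F - a / 2 * q + a / 2 * (β ^ 2 * E) + β / 2 * (a ^ 2 * M))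
    (k2 : Eb ≤ 2 * q + 2 * (β ^ 2 * L))
    (k3 : L' ≤ 2 * ρ * E + (1 - ρ / 4) * L + 8 * ρ⁻¹ * (a ^ 2 * (q + β ^ 2 * E))
      + 4 * (a ^ 2 * M))
    (k4 : M ≤ 4 * (β ^ 2 * E + Eb + 2 * n₁)) (k5 : E ≤ b ^ 2 * (64 * Eb + 72 * n₂))
    (h₁ : a * β ≤ 1 / 200) (h₂ : (a * β) ^ 2 ≤ ρ / 40000)
    (h₃ : (a * β) ^ 3 ≤ ρ ^ 2 / 8000000) :
    F' + 40 * ρ⁻¹ * (β ^ 3 * a ^ 2) * L' ≤ F + 40 * ρ⁻¹ * (β ^ 3 * a ^ 2) * L - a / 4 * q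
      + 8 * (β * a ^ 2 * n₁) + β * b ^ 2 * n₂ := by
  have ha0 : 0 < a := hb.trans_le hba
  have hb2 : b ^ 2 ≤ a ^ 2 := by gcongr
  have hu : 0 < a * β := by positivity
  have j2 : (a * β) ^ 2 * ρ⁻¹ ≤ 1 / 40000 := by
    rw [← div_eq_mul_inv, div_le_iff₀ hρ]; linarith
  have j3 : (a * β) ^ 3 * ρ⁻¹ ^ 2 ≤ 1 / 8000000 := by
    rw [inv_pow, ← div_eq_mul_inv, div_le_iff₀ (by positivity)]; linarith
  have l1 : 40 * ρ⁻¹ * (β ^ 3 * a ^ 2) * L' ≤ 40 * ρ⁻¹ * (β ^ 3 * a ^ 2) *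
      (2 * ρ * E + (1 - ρ / 4) * L + 8 * ρ⁻¹ * (a ^ 2 * (q + β ^ 2 * E)) + 4 * (a ^ 2 * M)) :=
    mul_le_mul_of_nonneg_left k3 (by positivity)
  have l2 : 40 * ρ⁻¹ * (β ^ 3 * a ^ 2) *
      (2 * ρ * E + (1 - ρ / 4) * L + 8 * ρ⁻¹ * (a ^ 2 * (q + β ^ 2 * E)) + 4 * (a ^ 2 * M))
      = 80 * (a * β) * (a * β ^ 2 * E) + 40 * ρ⁻¹ * (β ^ 3 * a ^ 2) * L
        - 10 * (β ^ 3 * a ^ 2 * L) + 320 * ((a * β) ^ 3 * ρ⁻¹ ^ 2) * (a * q)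
        + 320 * ((a * β) ^ 3 * ρ⁻¹ ^ 2) * (a * β ^ 2 * E)
        + 160 * ((a * β) ^ 2 * ρ⁻¹) * (β * (a ^ 2 * M)) := by
    field_simp
    ring
  have hM' : β * (a ^ 2 * M)
      ≤ β * (a ^ 2 * (4 * (β ^ 2 * E + (2 * q + 2 * (β ^ 2 * L)) + 2 * n₁))) := by
    have : M ≤ 4 * (β ^ 2 * E + (2 * q + 2 * (β ^ 2 * L)) + 2 * n₁) := by linarith
    gcongr
  -- Both occurrences of M, in the descent inequality and in the lag, are collected before the bound
  -- on M is inserted.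
  have l3 : (1 / 2 + 160 * ((a * β) ^ 2 * ρ⁻¹)) * (β * (a ^ 2 * M))
      ≤ 1 * (β * (a ^ 2 * (4 * (β ^ 2 * E + (2 * q + 2 * (β ^ 2 * L)) + 2 * n₁)))) :=
    mul_le_mul (by linarith) hM' (by positivity) zero_le_one
  have hE' : 0 ≤ a * β ^ 2 * E := by positivity
  have haq : 0 ≤ a * q := by positivity
  have hβL : 0 ≤ β ^ 3 * a ^ 2 * L := by positivity
  have l4 : (1 / 2 + 4 * (a * β) + 80 * (a * β) + 320 * ((a * β) ^ 3 * ρ⁻¹ ^ 2))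
      * (a * β ^ 2 * E) ≤ 1 * (a * β ^ 2 * E) :=
    mul_le_mul_of_nonneg_right (by linarith) hE'
  have hE2 : E ≤ b ^ 2 * (64 * (2 * q + 2 * (β ^ 2 * L)) + 72 * n₂) := by
    refine k5.trans ?_
    gcongr
  have l5 : a * β ^ 2 * E ≤ 128 * (a * β) ^ 2 * (a * q) + 128 * (a * β) * (β ^ 3 * a ^ 2 * L)
      + 72 * (a * β) * (β * b ^ 2 * n₂) := by
    calc a * β ^ 2 * E ≤ a * β ^ 2 * (b ^ 2 * (64 * (2 * q + 2 * (β ^ 2 * L)) + 72 * n₂)) :=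
          mul_le_mul_of_nonneg_left hE2 (by positivity)
      _ = a * β ^ 2 * (b ^ 2 * (64 * (2 * q + 2 * (β ^ 2 * L))))
          + a * β ^ 2 * (b ^ 2 * (72 * n₂)) := by ring
      _ ≤ a * β ^ 2 * (a ^ 2 * (64 * (2 * q + 2 * (β ^ 2 * L))))
          + a * β ^ 2 * (b ^ 2 * (72 * n₂)) := by gcongr
      _ = _ := by ring
  have hbn : 0 ≤ β * b ^ 2 * n₂ := by positivity
  have l6 : (8 * (a * β) + 128 * (a * β) ^ 2 + 320 * ((a * β) ^ 3 * ρ⁻¹ ^ 2)) * (a * q)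
      ≤ 1 / 4 * (a * q) := by
    have : (a * β) ^ 2 ≤ (1 / 200) ^ 2 := by gcongr
    exact mul_le_mul_of_nonneg_right (by linarith) haq
  have l7 : (8 + 128 * (a * β)) * (β ^ 3 * a ^ 2 * L) ≤ 10 * (β ^ 3 * a ^ 2 * L) :=
    mul_le_mul_of_nonneg_right (by linarith) hβL
  have l8 : 72 * (a * β) * (β * b ^ 2 * n₂) ≤ 1 * (β * b ^ 2 * n₂) :=
    mul_le_mul_of_nonneg_right (by linarith) hbn
  linarith

namespace RoundData

variable {d N : ℕ} {Ω Ξ : Type*} (D : RoundData d N Ω Ξ)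

/-- The mean square distance between the points `α i k` and `x`. -/
noncomputable def lag [MeasurableSpace Ω] (P : Measure Ω) (K : ℕ) (α : Fin N → ℕ → Ω → Vec d)
    (x : Ω → Vec d) : ℝ :=
  1 / (N : ℝ) * ∑ i, 1 / (K : ℝ) * ∑ k ∈ Finset.range K, ∫ ω, ‖α i k ω - x ω‖ ^ 2 ∂P

/-- The points at which the gradients in the next control variates are evaluated. -/
noncomputable def nextPoint (α : Fin N → ℕ → Ω → Vec d) (i : Fin N) (k : ℕ) (ω : Ω) : Vec d :=
  if i ∈ D.T ω then D.y i k ω else α i k ω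

theorem lag_eq_integral [MeasurableSpace Ω] {P : Measure Ω} (K : ℕ) {α : Fin N → ℕ → Ω → Vec d}
    {x : Ω → Vec d} (hi : ∀ i k, Integrable (fun ω => ‖α i k ω - x ω‖ ^ 2) P) :
    lag P K α x = ∫ ω, 1 / (N : ℝ) * ∑ i, 1 / (K : ℝ) *
      ∑ k ∈ Finset.range K, ‖α i k ω - x ω‖ ^ 2 ∂P := by
  rw [integral_const_mul, integral_finsetSum _ fun i _ =>
    (integrable_finsetSum _ fun k _ => hi i k).const_mul _, lag]
  congr 1
  refine Finset.sum_congr rfl fun i _ => ?_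
  rw [integral_const_mul, integral_finsetSum _ fun k _ => hi i k]

namespace IsValid

variable {D} {m : MeasurableSpace Ω} [mΩ : MeasurableSpace Ω] [MeasurableSpace Ξ]
  {P : Measure Ω} {ν : Fin N → Measure Ξ} {β σ : ℝ} (H : D.IsValid m P ν β σ)
  [IsProbabilityMeasure P] [∀ i, IsProbabilityMeasure (ν i)]
include H

theorem memLp_nextX (a : ℝ) : MemLp (D.nextX a) 2 P :=
  H.isL2_x.2.sub (H.memLp_direction.const_smul a)

theorem smooth_objective : IsSmooth β (objective D.f) :=
  isSmooth_objective H.one_le_N H.smooth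

theorem isL2_averageGrad :
    IsL2 (D.sigma m Set.univ) P (fun ω => (1 / (N : ℝ)) • ∑ i, D.meanGrad i ω) :=
  (IsL2.sum _ fun i _ => H.isL2_meanGrad i).const_smul _

theorem integral_averageGrad_sub_sq_le :
    ∫ ω, ‖(1 / (N : ℝ)) • ∑ i, D.meanGrad i ω - ∇ (objective D.f) (D.x ω)‖ ^ 2 ∂P
      ≤ β ^ 2 * D.drift P := by
  have hm := D.le_sigma m Set.univ
  have hi : ∀ i, IsL2 (D.sigma m Set.univ) P
      (fun ω => D.meanGrad i ω - ∇ (D.f i) (D.x ω)) := fun i =>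
    (H.isL2_meanGrad i).sub ((H.isL2_x.gradient (H.smooth i)).mono hm)
  have hg := H.isL2_averageGrad.sub ((H.isL2_x.gradient H.smooth_objective).mono hm)
  refine le_trans ?_ H.average_meanGrad_sub_sq_le
  rw [← integral_finsetSum _ fun i _ => (hi i).integrable_sq, ← integral_const_mul]
  refine integral_mono hg.integrable_sq
    ((integrable_finsetSum _ fun i _ => (hi i).integrable_sq).const_mul _) fun ω => ?_
  simp only
  rw [gradient_objective fun i => (H.smooth i).1, ← average_sub]
  exact norm_average_fin_sq_le _

/-- The descent inequality, with the direction replaced in expectation by the full average of the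
local gradients. Polarization leaves half of the squared gradient and half of the squared deviation
of that average, which the drift bounds. -/
theorem integral_objective_nextX_le {a : ℝ} (ha : 0 ≤ a) :
    ∫ ω, objective D.f (D.nextX a ω) ∂P ≤ ∫ ω, objective D.f (D.x ω) ∂P
      - a / 2 * ∫ ω, ‖∇ (objective D.f) (D.x ω)‖ ^ 2 ∂P + a / 2 * (β ^ 2 * D.drift P)
      + β / 2 * (a ^ 2 * ∫ ω, ‖D.direction (D.T ω) ω‖ ^ 2 ∂P) := by
  have hm := D.le_sigma m Set.univ
  have hs := H.smooth_objective
  have hd := H.memLp_direction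
  have hG := H.isL2_x.gradient hs
  have hav := H.isL2_averageGrad
  have i0 := H.integrable_objective
  have i1 : Integrable (fun ω => a * ⟪∇ (objective D.f) (D.x ω), D.direction (D.T ω) ω⟫_ℝ) P :=
    (integrable_inner_of_memLp hG.2 hd).const_mul a
  have i2 : Integrable (fun ω => β / 2 * (a ^ 2 * ‖D.direction (D.T ω) ω‖ ^ 2)) P :=
    ((integrable_norm_sq_of_memLp hd).const_mul _).const_mul _
  have i3 : Integrable (fun ω => objective D.f (D.x ω)
    - a * ⟪∇ (objective D.f) (D.x ω), D.direction (D.T ω) ω⟫_ℝ) P := i0.sub i1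
  have h1 : ∫ ω, objective D.f (D.nextX a ω) ∂P ≤ ∫ ω, objective D.f (D.x ω) ∂P
      - a * ∫ ω, ⟪∇ (objective D.f) (D.x ω), D.direction (D.T ω) ω⟫_ℝ ∂P
      + β / 2 * (a ^ 2 * ∫ ω, ‖D.direction (D.T ω) ω‖ ^ 2 ∂P) := by
    rw [← integral_const_mul, ← integral_const_mul, ← integral_const_mul, ← integral_sub i0 i1,
      ← integral_add i3 i2]
    refine integral_mono (integrable_comp_of_memLp (H.memLp_nextX a) H.β_pos.le hs) (i3.add i2)
      fun ω => ?_
    have e1 := hs.le_quadratic (D.x ω) (D.nextX a ω)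
    have e2 : D.nextX a ω - D.x ω = -(a • D.direction (D.T ω) ω) := by rw [nextX]; abel
    rw [e2, inner_neg_right, real_inner_smul_right, norm_neg, norm_smul, mul_pow,
      Real.norm_eq_abs, sq_abs] at e1
    exact e1
  have h2 : -∫ ω, ⟪∇ (objective D.f) (D.x ω), D.direction (D.T ω) ω⟫_ℝ ∂P
      ≤ -(1 / 2) * ∫ ω, ‖∇ (objective D.f) (D.x ω)‖ ^ 2 ∂P + 1 / 2 * (β ^ 2 * D.drift P) := by
    have hsub := hav.sub (hG.mono hm)
    have e0 : -∫ ω, ⟪∇ (objective D.f) (D.x ω), (1 / (N : ℝ)) • ∑ i, D.meanGrad i ω⟫_ℝ ∂P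
        ≤ -(1 / 2) * ∫ ω, ‖∇ (objective D.f) (D.x ω)‖ ^ 2 ∂P + 1 / 2 * ∫ ω,
          ‖(1 / (N : ℝ)) • ∑ i, D.meanGrad i ω - ∇ (objective D.f) (D.x ω)‖ ^ 2 ∂P := by
      rw [← integral_neg, ← integral_const_mul, ← integral_const_mul,
        ← integral_add (hG.integrable_sq.const_mul _) (hsub.integrable_sq.const_mul _)]
      refine integral_mono (H.integrable_inner_meanGrad hG).neg
        ((hG.integrable_sq.const_mul _).add (hsub.integrable_sq.const_mul _)) fun ω => ?_
      simp only
      rw [norm_sub_sq_real, real_inner_comm]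
      have := sq_nonneg ‖(1 / (N : ℝ)) • ∑ i, D.meanGrad i ω‖
      linarith
    rw [H.integral_inner_direction hG]
    have := H.integral_averageGrad_sub_sq_le
    linarith
  have h3 := mul_le_mul_of_nonneg_left h2 ha
  linarith

section Lag

variable {α : Fin N → ℕ → Ω → Vec d} (hα : ∀ i k, IsL2 m P (α i k))
include hα

/-- Without a minimizer the comparison is with ∇f(x): the exact direction is ∇f(x) plus the centered
differences ∇f_i(x) - h_i. As h_i is a mean of gradients at the points α i k, smoothness bounds
these by the lag. -/
theorem exactSq_le_of_lag
    (hh : ∀ i ω, D.h i ω = (1 / (D.K : ℝ)) • ∑ k ∈ Finset.range D.K, ∇ (D.f i) (α i k ω)) :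
    D.exactSq P ≤ 2 * ∫ ω, ‖∇ (objective D.f) (D.x ω)‖ ^ 2 ∂P
      + 2 * (β ^ 2 * lag P D.K α D.x) := by
  have hG := H.isL2_x.gradient H.smooth_objective
  have hi : ∀ i k, Integrable (fun ω => ‖α i k ω - D.x ω‖ ^ 2) P := fun i k =>
    ((hα i k).sub H.isL2_x).integrable_sq
  have hli : Integrable (fun ω => 1 / (N : ℝ) * ∑ i, 1 / (D.K : ℝ) *
      ∑ k ∈ Finset.range D.K, ‖α i k ω - D.x ω‖ ^ 2) P :=
    (integrable_finsetSum _ fun i _ =>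
      (integrable_finsetSum _ fun k _ => hi i k).const_mul _).const_mul _
  have hN := H.N_pos
  have hK := H.K_pos
  rw [lag_eq_integral D.K hi, exactSq,
    ← integral_finsetSum _ fun i _ => (H.isL2_exactDirection i).integrable_sq,
    ← integral_const_mul, ← integral_const_mul, ← integral_const_mul, ← integral_const_mul,
    ← integral_add (hG.integrable_sq.const_mul _) ((hli.const_mul _).const_mul _)]
  refine integral_mono ((integrable_finsetSum _ fun i _ =>
      (H.isL2_exactDirection i).integrable_sq).const_mul _)
    ((hG.integrable_sq.const_mul _).add ((hli.const_mul _).const_mul _)) fun ω => ?_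
  let b : Fin N → Vec d := fun i => ∇ (D.f i) (D.x ω) - D.h i ω
  have e1 : ∀ i, D.exactDirection i ω
      = ∇ (objective D.f) (D.x ω) + (b i - (1 / (N : ℝ)) • ∑ j, b j) := by
    intro i
    simp only [b]
    rw [average_sub, gradient_objective fun i => (H.smooth i).1, exactDirection]
    abel
  have e2 : ∀ i, ‖b i‖ ^ 2
      ≤ β ^ 2 * (1 / (D.K : ℝ) * ∑ k ∈ Finset.range D.K, ‖α i k ω - D.x ω‖ ^ 2) := by
    intro i
    have : b i = (1 / (D.K : ℝ)) • ∑ k ∈ Finset.range D.K,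
        (∇ (D.f i) (D.x ω) - ∇ (D.f i) (α i k ω)) := by
      rw [Finset.sum_sub_distrib, smul_sub, ← hh]
      simp only [b, Finset.sum_const, Finset.card_range]
      rw [← Nat.cast_smul_eq_nsmul ℝ, smul_smul]
      simp [hK.ne']
    rw [this, mul_left_comm]
    refine (norm_average_range_sq_le _ _).trans (mul_le_mul_of_nonneg_left ?_ (by positivity))
    rw [Finset.mul_sum]
    refine Finset.sum_le_sum fun k _ => ?_
    rw [← mul_pow, norm_sub_rev (α i k ω)]
    gcongr
    exact (H.smooth i).2 _ _
  calc 1 / (N : ℝ) * ∑ i, ‖D.exactDirection i ω‖ ^ 2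
      ≤ 1 / (N : ℝ) * ∑ i, (2 * ‖∇ (objective D.f) (D.x ω)‖ ^ 2
          + 2 * ‖b i - (1 / (N : ℝ)) • ∑ j, b j‖ ^ 2) := by
        gcongr with i
        rw [e1]
        exact norm_add_sq_le_two _ _
    _ = 2 * ‖∇ (objective D.f) (D.x ω)‖ ^ 2
          + 2 * (1 / (N : ℝ) * ∑ i, ‖b i - (1 / (N : ℝ)) • ∑ j, b j‖ ^ 2) := by
        rw [Finset.sum_add_distrib, ← Finset.mul_sum Finset.univ _ (2 : ℝ)]
        simp only [Finset.sum_const, Finset.card_univ, Fintype.card_fin, nsmul_eq_mul]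
        rw [← Finset.mul_sum]
        field_simp
    _ ≤ 2 * ‖∇ (objective D.f) (D.x ω)‖ ^ 2 + 2 * (1 / (N : ℝ) * ∑ i, ‖b i‖ ^ 2) := by
        linarith [average_norm_sub_average_sq_le H.one_le_N b]
    _ ≤ 2 * ‖∇ (objective D.f) (D.x ω)‖ ^ 2 + 2 * (1 / (N : ℝ) * ∑ i,
          β ^ 2 * (1 / (D.K : ℝ) * ∑ k ∈ Finset.range D.K, ‖α i k ω - D.x ω‖ ^ 2)) := by
        gcongr with i
        exact e2 i
    _ = _ := by
        rw [← Finset.mul_sum]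
        ring

/-- Conditionally on client i being drawn, the direction is not unbiased, so the cross term cannot
be averaged on the event of not drawing i alone. It is therefore inserted on the other event as
well, where the old point does not matter; this leaves ½ of the old distance there, so 1 - S/N
becomes 1 - S/(2N). The complete cross term is then unbiased, and Young's inequality spends a
further S/(4N) on it. -/
theorem integral_nextPoint_sub_sq_le (a : ℝ) (i : Fin N) (k : ℕ) :
    ∫ ω, ‖D.nextPoint α i k ω - D.nextX a ω‖ ^ 2 ∂P
      ≤ 2 * ((D.S : ℝ) / N) * ∫ ω, ‖D.y i k ω - D.x ω‖ ^ 2 ∂P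
        + (1 - (D.S : ℝ) / N / 4) * ∫ ω, ‖α i k ω - D.x ω‖ ^ 2 ∂P
        + 4 * ((N : ℝ) / D.S) * (a ^ 2 * ∫ ω, ‖(1 / (N : ℝ)) • ∑ i, D.meanGrad i ω‖ ^ 2 ∂P)
        + 4 * (a ^ 2 * ∫ ω, ‖D.direction (D.T ω) ω‖ ^ 2 ∂P) := by
  have hm := D.le_sigma m Set.univ
  have hd := H.memLp_direction
  have hyx : IsL2 (D.sigma m Set.univ) P (fun ω => D.y i k ω - D.x ω) :=
    (H.isL2_y_univ i k).sub (H.isL2_x.mono hm)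
  have hαx : IsL2 m P (fun ω => α i k ω - D.x ω) := (hα i k).sub H.isL2_x
  have hαx' := hαx.mono hm
  have hρ := H.S_div_N_pos
  have hρinv : (N : ℝ) / D.S = ((D.S : ℝ) / N)⁻¹ := (inv_div _ _).symm
  have m1 : Measurable[D.sigma m Set.univ] (fun ω => 2 * ‖D.y i k ω - D.x ω‖ ^ 2
      + 1 / 2 * ‖α i k ω - D.x ω‖ ^ 2) :=
    (hyx.measurable_norm_sq.const_mul _).add (hαx'.measurable_norm_sq.const_mul _)
  have i1 : Integrable (fun ω => 2 * ‖D.y i k ω - D.x ω‖ ^ 2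
      + 1 / 2 * ‖α i k ω - D.x ω‖ ^ 2) P :=
    (hyx.integrable_sq.const_mul _).add (hαx.integrable_sq.const_mul _)
  have h1 := H.integral_ite_mem i m1 hαx'.measurable_norm_sq i1 hαx.integrable_sq
  rw [integral_add (hyx.integrable_sq.const_mul _) (hαx.integrable_sq.const_mul _),
    integral_const_mul, integral_const_mul] at h1
  have i2 : Integrable (fun ω => if i ∈ D.T ω then 2 * ‖D.y i k ω - D.x ω‖ ^ 2
      + 1 / 2 * ‖α i k ω - D.x ω‖ ^ 2 else ‖α i k ω - D.x ω‖ ^ 2) P :=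
    integrable_subset (F := fun s ω => if i ∈ s then 2 * ‖D.y i k ω - D.x ω‖ ^ 2
      + 1 / 2 * ‖α i k ω - D.x ω‖ ^ 2 else ‖α i k ω - D.x ω‖ ^ 2) H.clients.measurable fun s => by
        split_ifs
        · exact i1
        · exact hαx.integrable_sq
  have i3 : Integrable (fun ω => 2 * a * ⟪α i k ω - D.x ω, D.direction (D.T ω) ω⟫_ℝ) P :=
    (integrable_inner_of_memLp hαx.2 hd).const_mul _
  have i4 : Integrable (fun ω => 4 * (a ^ 2 * ‖D.direction (D.T ω) ω‖ ^ 2)) P :=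
    ((integrable_norm_sq_of_memLp hd).const_mul _).const_mul _
  have hnext : MemLp (fun ω => D.nextPoint α i k ω - D.nextX a ω) 2 P := by
    refine MemLp.sub ?_ (H.memLp_nextX a)
    exact memLp_subset (F := fun s ω => if i ∈ s then D.y i k ω else α i k ω)
      H.clients.measurable fun s => by
        split_ifs
        · exact (H.isL2_y_univ i k).2
        · exact (hα i k).2
  have h2 : ∫ ω, ‖D.nextPoint α i k ω - D.nextX a ω‖ ^ 2 ∂P
      ≤ ∫ ω, (if i ∈ D.T ω then 2 * ‖D.y i k ω - D.x ω‖ ^ 2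
      + 1 / 2 * ‖α i k ω - D.x ω‖ ^ 2 else ‖α i k ω - D.x ω‖ ^ 2) ∂P
        + 2 * a * ∫ ω, ⟪α i k ω - D.x ω, D.direction (D.T ω) ω⟫_ℝ ∂P
        + 4 * (a ^ 2 * ∫ ω, ‖D.direction (D.T ω) ω‖ ^ 2 ∂P) := by
    rw [← integral_const_mul, ← integral_const_mul, ← integral_const_mul,
      ← integral_add i2 i3, ← integral_add (by exact i2.add i3) i4]
    refine integral_mono (integrable_norm_sq_of_memLp hnext) ((i2.add i3).add i4) fun ω => ?_
    simp only [nextPoint, nextX]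
    set v := D.direction (D.T ω) ω
    split_ifs
    · have e1 : D.y i k ω - (D.x ω - a • v) = (D.y i k ω - D.x ω) + a • v := by abel
      rw [e1]
      have e2 := norm_add_sq_le_two (D.y i k ω - D.x ω) (a • v)
      -- Twice this square adds the missing cross term, at the cost of half the old distance and of
      -- 2a²‖v‖².
      have e3 : 0 ≤ ‖(1 / 2 : ℝ) • (α i k ω - D.x ω) + a • v‖ ^ 2 := by positivity
      rw [norm_add_sq_real, norm_smul, mul_pow, Real.norm_eq_abs, sq_abs, real_inner_smul_left,
        real_inner_smul_right] at e3
      rw [norm_smul, mul_pow, Real.norm_eq_abs, sq_abs] at e2 e3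
      linarith
    · have e1 : α i k ω - (D.x ω - a • v) = (α i k ω - D.x ω) + a • v := by abel
      rw [e1, norm_add_sq_real, norm_smul, mul_pow, Real.norm_eq_abs, sq_abs,
        real_inner_smul_right]
      have : 0 ≤ a ^ 2 * ‖v‖ ^ 2 := by positivity
      linarith
  have h3 : 2 * a * ∫ ω, ⟪α i k ω - D.x ω, (1 / (N : ℝ)) • ∑ i, D.meanGrad i ω⟫_ℝ ∂P
      ≤ (D.S : ℝ) / N / 4 * ∫ ω, ‖α i k ω - D.x ω‖ ^ 2 ∂P
        + 4 * ((N : ℝ) / D.S) * (a ^ 2 * ∫ ω, ‖(1 / (N : ℝ)) • ∑ i, D.meanGrad i ω‖ ^ 2 ∂P) := by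
    have hav := H.isL2_averageGrad
    rw [← integral_const_mul, ← integral_const_mul, ← integral_const_mul, ← integral_const_mul,
      ← integral_add (hαx.integrable_sq.const_mul _) ((hav.integrable_sq.const_mul _).const_mul _)]
    refine integral_mono ((H.integrable_inner_meanGrad hαx).const_mul _)
      ((hαx.integrable_sq.const_mul _).add ((hav.integrable_sq.const_mul _).const_mul _))
      fun ω => ?_
    simp only
    rw [hρinv]
    set w := (1 / (N : ℝ)) • ∑ i, D.meanGrad i ω
    set u := α i k ω - D.x ω
    generalize (D.S : ℝ) / N = ρ at *
    -- Young's inequality as a completed square, weighted so that exactly ρ/4 of the old distance is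
    -- used.
    have e3 : 0 ≤ ρ / 4 * ‖u - (4 * a / ρ) • w‖ ^ 2 := by positivity
    rw [norm_sub_sq_real, norm_smul, mul_pow, Real.norm_eq_abs, sq_abs,
      real_inner_smul_right] at e3
    have e4 : ρ / 4 * (‖u‖ ^ 2 - 2 * (4 * a / ρ * ⟪u, w⟫_ℝ) + (4 * a / ρ) ^ 2 * ‖w‖ ^ 2)
        = ρ / 4 * ‖u‖ ^ 2 - 2 * a * ⟪u, w⟫_ℝ + 4 * ρ⁻¹ * (a ^ 2 * ‖w‖ ^ 2) := by
      field_simp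
    linarith
  rw [H.integral_inner_direction hαx, h1] at h2
  linarith

theorem lag_next_le (a : ℝ) :
    lag P D.K (D.nextPoint α) (D.nextX a)
      ≤ 2 * ((D.S : ℝ) / N) * D.drift P + (1 - (D.S : ℝ) / N / 4) * lag P D.K α D.x
        + 8 * ((N : ℝ) / D.S) * (a ^ 2 * (∫ ω, ‖∇ (objective D.f) (D.x ω)‖ ^ 2 ∂P
          + β ^ 2 * D.drift P))
        + 4 * (a ^ 2 * ∫ ω, ‖D.direction (D.T ω) ω‖ ^ 2 ∂P) := by
  have hm := D.le_sigma m Set.univ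
  have hN := H.N_pos
  have hK := H.K_pos
  have hS := H.S_pos
  have hG := H.isL2_x.gradient H.smooth_objective
  have hav := H.isL2_averageGrad
  have h1 : ∫ ω, ‖(1 / (N : ℝ)) • ∑ i, D.meanGrad i ω‖ ^ 2 ∂P
      ≤ 2 * (∫ ω, ‖∇ (objective D.f) (D.x ω)‖ ^ 2 ∂P + β ^ 2 * D.drift P) := by
    have hsub := hav.sub (hG.mono hm)
    have e0 : ∫ ω, ‖(1 / (N : ℝ)) • ∑ i, D.meanGrad i ω‖ ^ 2 ∂P
        ≤ 2 * ∫ ω, ‖∇ (objective D.f) (D.x ω)‖ ^ 2 ∂P + 2 * ∫ ω,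
          ‖(1 / (N : ℝ)) • ∑ i, D.meanGrad i ω - ∇ (objective D.f) (D.x ω)‖ ^ 2 ∂P := by
      rw [← integral_const_mul, ← integral_const_mul,
        ← integral_add (hG.integrable_sq.const_mul _) (hsub.integrable_sq.const_mul _)]
      refine integral_mono hav.integrable_sq
        ((hG.integrable_sq.const_mul _).add (hsub.integrable_sq.const_mul _)) fun ω => ?_
      have := norm_add_sq_le_two (∇ (objective D.f) (D.x ω))
        ((1 / (N : ℝ)) • ∑ i, D.meanGrad i ω - ∇ (objective D.f) (D.x ω))
      rwa [add_sub_cancel] at this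
    have := H.integral_averageGrad_sub_sq_le
    linarith
  set M := ∫ ω, ‖D.direction (D.T ω) ω‖ ^ 2 ∂P
  set G := ∫ ω, ‖(1 / (N : ℝ)) • ∑ i, D.meanGrad i ω‖ ^ 2 ∂P
  have h2 : lag P D.K (D.nextPoint α) (D.nextX a)
      ≤ 2 * ((D.S : ℝ) / N) * D.drift P + (1 - (D.S : ℝ) / N / 4) * lag P D.K α D.x
        + 4 * ((N : ℝ) / D.S) * (a ^ 2 * G) + 4 * (a ^ 2 * M) := by
    calc lag P D.K (D.nextPoint α) (D.nextX a)
        ≤ 1 / (N : ℝ) * ∑ i, 1 / (D.K : ℝ) * ∑ k ∈ Finset.range D.K,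
          (2 * ((D.S : ℝ) / N) * ∫ ω, ‖D.y i k ω - D.x ω‖ ^ 2 ∂P
            + (1 - (D.S : ℝ) / N / 4) * ∫ ω, ‖α i k ω - D.x ω‖ ^ 2 ∂P
            + (4 * ((N : ℝ) / D.S) * (a ^ 2 * G) + 4 * (a ^ 2 * M))) := by
          unfold lag
          gcongr with i _ k _
          have := H.integral_nextPoint_sub_sq_le hα a i k
          linarith
      _ = _ := by
          simp_rw [average_range_affine H.one_le_K]
          rw [average_fin_affine H.one_le_N, drift, lag]
          ring
  have h3 : 4 * ((N : ℝ) / D.S) * (a ^ 2 * G) ≤ 4 * ((N : ℝ) / D.S) * (a ^ 2 *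
      (2 * (∫ ω, ‖∇ (objective D.f) (D.x ω)‖ ^ 2 ∂P + β ^ 2 * D.drift P))) := by gcongr
  linarith

/-- One round in the general case. -/
theorem nonconvex_round_le {a : ℝ} (hη : 0 < D.ηl) (ha : D.K * D.ηl ≤ a)
    (hh : ∀ i ω, D.h i ω = (1 / (D.K : ℝ)) • ∑ k ∈ Finset.range D.K, ∇ (D.f i) (α i k ω))
    (h₁ : a * β ≤ 1 / 200) (h₂ : (a * β) ^ 2 ≤ (D.S : ℝ) / N / 40000)
    (h₃ : (a * β) ^ 3 ≤ ((D.S : ℝ) / N) ^ 2 / 8000000) :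
    ∫ ω, objective D.f (D.nextX a ω) ∂P + 40 * ((N : ℝ) / D.S) * (β ^ 3 * a ^ 2) *
        lag P D.K (D.nextPoint α) (D.nextX a)
      ≤ ∫ ω, objective D.f (D.x ω) ∂P + 40 * ((N : ℝ) / D.S) * (β ^ 3 * a ^ 2) * lag P D.K α D.x
        - a / 4 * ∫ ω, ‖∇ (objective D.f) (D.x ω)‖ ^ 2 ∂P
        + 8 * (β * a ^ 2 * (σ ^ 2 / (D.K * D.S)))
        + β * (D.K * D.ηl) ^ 2 * (σ ^ 2 / D.K) := by
  have hb : 0 < D.K * D.ηl := mul_pos H.K_pos hη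
  have ha0 : 0 < a := hb.trans_le ha
  rw [show (N : ℝ) / D.S = ((D.S : ℝ) / N)⁻¹ from (inv_div _ _).symm]
  have hL : 0 ≤ lag P D.K α D.x := by
    have : ∀ i k, 0 ≤ ∫ ω, ‖α i k ω - D.x ω‖ ^ 2 ∂P := fun i k =>
      integral_nonneg fun ω => by positivity
    unfold lag
    positivity
  have k3 := H.lag_next_le hα a
  rw [show (N : ℝ) / D.S = ((D.S : ℝ) / N)⁻¹ from (inv_div _ _).symm] at k3
  exact nonconvex_recursion_le hb ha H.β_pos H.S_div_N_pos hL
    (integral_nonneg fun ω => by positivity) H.drift_nonneg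
    (integral_nonneg fun ω => by positivity) (by positivity)
    (H.integral_objective_nextX_le ha0.le) (H.exactSq_le_of_lag hα hh) k3
    H.integral_direction_sq_le H.drift_le h₁ h₂ h₃

end Lag

end IsValid

end RoundData

/-! ### The σ-algebras of the rounds and their independence. -/

section Sigma

variable {N : ℕ} {Ω Ξ : Type*} [mΞ : MeasurableSpace Ξ]

/-- The σ-algebra of the client sets with index in `s`. -/
abbrev clientSigma (A : ℕ → Ω → Finset (Fin N)) (s : Set ℕ) : MeasurableSpace Ω :=
  ⨆ q ∈ s, MeasurableSpace.comap (A q) inferInstance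

/-- The σ-algebra of the data points with index in `s`. -/
abbrev dataSigma (Z : ℕ → Fin N → ℕ → Ω → Ξ) (s : Set (ℕ × Fin N × ℕ)) : MeasurableSpace Ω :=
  ⨆ p ∈ s, MeasurableSpace.comap (Z p.1 p.2.1 p.2.2) mΞ

/-- The σ-algebra of everything that happens before round `r`. -/
abbrev past (A : ℕ → Ω → Finset (Fin N)) (Z : ℕ → Fin N → ℕ → Ω → Ξ) (r : ℕ) :
    MeasurableSpace Ω :=
  clientSigma A (Set.Iio r) ⊔ dataSigma Z {p | p.1 < r}

theorem measurable_clientSigma (A : ℕ → Ω → Finset (Fin N)) {s : Set ℕ} {r : ℕ} (h : r ∈ s) :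
    Measurable[clientSigma A s] (A r) := by
  rw [measurable_iff_comap_le]
  exact le_iSup₂_of_le (f := fun q (_ : q ∈ s) =>
    MeasurableSpace.comap (A q) inferInstance) r h le_rfl

theorem measurable_dataSigma (Z : ℕ → Fin N → ℕ → Ω → Ξ) {s : Set (ℕ × Fin N × ℕ)} {r : ℕ}
    {i : Fin N} {k : ℕ} (h : (r, i, k) ∈ s) : Measurable[dataSigma Z s] (Z r i k) := by
  rw [measurable_iff_comap_le]
  exact le_iSup₂_of_le (f := fun (p : ℕ × Fin N × ℕ) (_ : p ∈ s) =>
    MeasurableSpace.comap (Z p.1 p.2.1 p.2.2) mΞ) (r, i, k) h le_rfl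

theorem past_mono (A : ℕ → Ω → Finset (Fin N)) (Z : ℕ → Fin N → ℕ → Ω → Ξ) {q r : ℕ}
    (h : q ≤ r) : past A Z q ≤ past A Z r :=
  sup_le_sup (biSup_mono fun _ hp => lt_of_lt_of_le hp h) (biSup_mono fun _ hp => lt_of_lt_of_le hp h)

variable [mΩ : MeasurableSpace Ω] {P : Measure Ω} {S : ℕ} {ν : Fin N → Measure Ξ}
  {A : ℕ → Ω → Finset (Fin N)} {Z : ℕ → Fin N → ℕ → Ω → Ξ}

namespace IsSampling

variable (H : IsSampling P S ν A Z)
include H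

theorem isUniformSubset (r : ℕ) : IsUniformSubset P S (A r) :=
  ⟨H.measurable_clients r, H.uniform_clients r⟩

theorem clientSigma_le (s : Set ℕ) : clientSigma A s ≤ mΩ :=
  iSup₂_le fun q _ => (H.measurable_clients q).comap_le

theorem dataSigma_le (s : Set (ℕ × Fin N × ℕ)) : dataSigma Z s ≤ mΩ :=
  iSup₂_le fun p _ => (H.measurable_data p.1 p.2.1 p.2.2).comap_le

theorem past_le (r : ℕ) : past A Z r ≤ mΩ := sup_le (H.clientSigma_le _) (H.dataSigma_le _)

theorem indep_clientSigma_dataSigma (s : Set ℕ) (t : Set (ℕ × Fin N × ℕ)) :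
    Indep (clientSigma A s) (dataSigma Z t) P := by
  have h := H.indep_clients_data
  rw [IndepFun_iff_Indep] at h
  refine indep_of_indep_of_le_left (indep_of_indep_of_le_right h ?_) ?_
  · refine iSup₂_le fun p _ => ?_
    have hp : Z p.1 p.2.1 p.2.2 = (fun F : ℕ × Fin N × ℕ → Ξ => F p) ∘
      (fun ω (p : ℕ × Fin N × ℕ) => Z p.1 p.2.1 p.2.2 ω) := rfl
    rw [hp, ← MeasurableSpace.comap_comp]
    exact MeasurableSpace.comap_mono (measurable_pi_apply p).comap_le
  · refine iSup₂_le fun q _ => ?_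
    have hq : A q = (fun F : ℕ → Finset (Fin N) => F q) ∘ (fun ω (r : ℕ) => A r ω) := rfl
    rw [hq, ← MeasurableSpace.comap_comp]
    exact MeasurableSpace.comap_mono (measurable_pi_apply q).comap_le

/-- Mutual independence separates disjoint sets of data, and the family of client sets is
independent of all data; `indep_sup_right` merges the two facts. -/
theorem indep_dataSigma [IsProbabilityMeasure P] {s t : Set (ℕ × Fin N × ℕ)} (hst : Disjoint s t)
    (u : Set ℕ) : Indep (dataSigma Z s) (dataSigma Z t ⊔ clientSigma A u) P := by
  refine indep_sup_right (H.dataSigma_le s) (H.dataSigma_le t) (H.clientSigma_le u) ?_ ?_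
  · exact indep_iSup_of_disjoint
      (m := fun p : ℕ × Fin N × ℕ => MeasurableSpace.comap (Z p.1 p.2.1 p.2.2) mΞ)
      (fun p => (H.measurable_data p.1 p.2.1 p.2.2).comap_le) H.indep_data.iIndep hst
  · refine indep_of_indep_of_le_left (H.indep_clientSigma_dataSigma u Set.univ).symm ?_
    exact sup_le (biSup_mono fun _ _ => Set.mem_univ _) (biSup_mono fun _ _ => Set.mem_univ _)

theorem indep_clientSigma [IsProbabilityMeasure P] {s t : Set ℕ} (hst : Disjoint s t)
    (u : Set (ℕ × Fin N × ℕ)) : Indep (clientSigma A s) (clientSigma A t ⊔ dataSigma Z u) P := by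
  refine indep_sup_right (H.clientSigma_le s) (H.clientSigma_le t) (H.dataSigma_le u) ?_ ?_
  · exact indep_iSup_of_disjoint
      (m := fun q : ℕ => MeasurableSpace.comap (A q) inferInstance) (fun q => (H.measurable_clients q).comap_le)
      H.indep_clients.iIndep hst
  · refine indep_of_indep_of_le_left (H.indep_clientSigma_dataSigma Set.univ u) ?_
    exact sup_le (biSup_mono fun _ _ => Set.mem_univ _) (biSup_mono fun _ _ => Set.mem_univ _)

end IsSampling

end Sigma

theorem IsL2.ite {Ω : Type*} {d N : ℕ} {m : MeasurableSpace Ω} [mΩ : MeasurableSpace Ω]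
    {P : Measure Ω} {T : Ω → Finset (Fin N)} (hm : m ≤ mΩ) (hT : Measurable[m] T) {i : Fin N}
    {X Y : Ω → Vec d} (hX : IsL2 m P X) (hY : IsL2 m P Y) :
    IsL2 m P (fun ω => if i ∈ T ω then X ω else Y ω) := by
  refine ⟨Measurable.ite (hT (Set.toFinite {s : Finset (Fin N) | i ∈ s}).measurableSet) hX.1 hY.1,
    memLp_subset (F := fun s ω => if i ∈ s then X ω else Y ω) (hT.mono hm le_rfl) fun s => ?_⟩
  split_ifs
  exacts [hX.2, hY.2]

/-! ### The algorithm as a sequence of abstract rounds. -/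

namespace RoundData

variable {d N : ℕ} {Ω Ξ : Type*} (D : RoundData d N Ω Ξ)

theorem y_eq (i : Fin N) (k : ℕ) (ω : Ω) : D.y i k ω = D.x ω
    - D.ηl • (∑ l ∈ Finset.range k, ∇ (D.f i) (D.y i l ω) + ∑ l ∈ Finset.range k, D.noise i l ω
      + (k : ℝ) • (D.c ω - D.ci i ω)) := by
  induction k with
  | zero => simp; rfl
  | succ k ih =>
    rw [y_succ, Finset.sum_range_succ, Finset.sum_range_succ]
    nth_rewrite 1 [ih]
    push_cast
    module

theorem y_last (hK : 1 ≤ D.K) (i : Fin N) (ω : Ω) : D.y i D.K ω = D.x ω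
    - ((D.K : ℝ) * D.ηl) • (D.meanGrad i ω + D.meanNoise i ω - D.ci i ω + D.c ω) := by
  have hK' : (D.K : ℝ) ≠ 0 := by positivity
  rw [y_eq, meanGrad, meanNoise]
  have h : ∀ v : Vec d, v = (D.K : ℝ) • ((1 / (D.K : ℝ)) • v) := fun v => by
    rw [smul_smul, mul_one_div_cancel hK', one_smul]
  nth_rewrite 1 [h (∑ l ∈ Finset.range D.K, ∇ (D.f i) (D.y i l ω))]
  nth_rewrite 1 [h (∑ l ∈ Finset.range D.K, D.noise i l ω)]
  module

/-- The correction c - c_i was added in each of the K local steps, so it cancels in option II and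
only the mean of the local stochastic gradients remains. -/
theorem newControl_y_last (hK : 1 ≤ D.K) (hη : D.ηl ≠ 0) (i : Fin N) (ω : Ω) :
    newControl D.K D.ηl (D.x ω) (D.c ω) (D.ci i ω) (D.y i D.K ω)
      = D.meanGrad i ω + D.meanNoise i ω := by
  have hK' : (D.K : ℝ) ≠ 0 := by positivity
  rw [newControl, D.y_last hK, sub_sub_cancel, smul_smul, one_div_mul_cancel (mul_ne_zero hK' hη)]
  module

namespace IsValid

variable {D} {m m' : MeasurableSpace Ω} [mΩ : MeasurableSpace Ω] [MeasurableSpace Ξ]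
  {P : Measure Ω} {ν : Fin N → Measure Ξ} {β σ : ℝ} (H : D.IsValid m P ν β σ)
  [IsProbabilityMeasure P] [∀ i, IsProbabilityMeasure (ν i)]
  (hm : D.sigma m Set.univ ≤ m') (hm' : m' ≤ mΩ) (hT : Measurable[m'] D.T)
include H hm hT

theorem isL2_nextX (a : ℝ) : IsL2 m' P (D.nextX a) := by
  refine ⟨?_, H.memLp_nextX a⟩
  have hd : Measurable[m'] (fun ω => D.direction (D.T ω) ω) := by
    rw [eq_sum_indicator, Finset.sum_fn]
    exact Finset.measurable_sum _ fun s _ =>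
      ((H.isL2_direction s).1.mono hm le_rfl).indicator (hT (measurableSet_singleton s))
  exact (H.isL2_x.1.mono ((D.le_sigma m _).trans hm) le_rfl).sub (hd.const_smul a)

include hm'

theorem isL2_nextH (i : Fin N) : IsL2 m' P (D.nextH i) :=
  IsL2.ite hm' hT ((H.isL2_meanGrad i).mono hm) ((H.isL2_h i).mono ((D.le_sigma m _).trans hm))

theorem isL2_nextCi (i : Fin N) : IsL2 m' P (D.nextCi i) :=
  IsL2.ite hm' hT (((H.isL2_meanGrad i).add (H.isL2_meanNoise i)).mono hm)
    ((H.isL2_ci i).mono ((D.le_sigma m _).trans hm))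

theorem isL2_nextPoint {α : Fin N → ℕ → Ω → Vec d} (hα : ∀ i k, IsL2 m P (α i k)) (i : Fin N)
    (k : ℕ) : IsL2 m' P (D.nextPoint α i k) :=
  IsL2.ite hm' hT ((H.isL2_y_univ i k).mono hm) ((hα i k).mono ((D.le_sigma m _).trans hm))

end IsValid

end RoundData

/-- The server update preserves the identity "server control variate = mean of the client control
variates", on which unbiasedness rests. -/
theorem average_control_update {d N : ℕ} (s : Finset (Fin N)) (a b : Fin N → Vec d) :
    (1 / (N : ℝ)) • ∑ i, b i + (1 / (N : ℝ)) • ∑ i ∈ s, (a i - b i)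
      = (1 / (N : ℝ)) • ∑ i, if i ∈ s then a i else b i := by
  rw [← smul_add]
  congr 1
  have h : ∑ i ∈ s, (a i - b i) = ∑ i, if i ∈ s then a i - b i else 0 := by
    rw [Finset.sum_ite_mem, Finset.univ_inter]
  rw [h, ← Finset.sum_add_distrib]
  refine Finset.sum_congr rfl fun i _ => ?_
  split_ifs <;> abel

/-- The parameters and the initial data of the method; `h₀ i` is the part of the initial control
variate `c₀ i` that comes from exact gradients. -/
structure Method (d N : ℕ) (Ω Ξ : Type*) where
  f : Fin N → Vec d → ℝ
  g : Fin N → Vec d → Ξ → Vec d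
  S : ℕ
  K : ℕ
  ηl : ℝ
  ηg : ℝ
  A : ℕ → Ω → Finset (Fin N)
  Z : ℕ → Fin N → ℕ → Ω → Ξ
  x₀ : Vec d
  c₀ : Fin N → Ω → Vec d
  h₀ : Fin N → Ω → Vec d

namespace Method

variable {d N : ℕ} {Ω Ξ : Type*} (M : Method d N Ω Ξ)

noncomputable def state (r : ℕ) (ω : Ω) : State d N :=
  run M.g M.S M.K M.ηl M.ηg M.x₀ (fun i => M.c₀ i ω) (fun q => M.A q ω)
    (fun q i k => M.Z q i k ω) r

/-- The effective step-size. -/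
noncomputable def step : ℝ := M.K * M.ηl * M.ηg

noncomputable def roundWith (r : ℕ) (h : Fin N → Ω → Vec d) : RoundData d N Ω Ξ where
  f := M.f
  g := M.g
  S := M.S
  K := M.K
  ηl := M.ηl
  x := fun ω => (M.state r ω).model
  c := fun ω => (M.state r ω).control
  ci := fun i ω => (M.state r ω).clientControl i
  h := h
  T := M.A (r + 1)
  z := M.Z (r + 1)

/-- The part of the control variates that comes from exact gradients. -/
noncomputable def exactControl : ℕ → Fin N → Ω → Vec d
  | 0 => M.h₀
  | r + 1 => (M.roundWith r (exactControl r)).nextH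

noncomputable def roundData (r : ℕ) : RoundData d N Ω Ξ := M.roundWith r (M.exactControl r)

/-- The points at which the exact gradients in the control variates are evaluated. -/
noncomputable def points : ℕ → Fin N → ℕ → Ω → Vec d
  | 0 => fun _ _ _ => M.x₀
  | r + 1 => (M.roundData r).nextPoint (points r)

theorem model_succ (hK : 1 ≤ M.K) (r : ℕ) (ω : Ω) :
    (M.state (r + 1) ω).model = (M.roundData r).nextX M.step ω := by
  have h : (M.state (r + 1) ω).model = (M.roundData r).x ω + (M.ηg / (M.S : ℝ)) •
      ∑ i ∈ M.A (r + 1) ω, ((M.roundData r).y i M.K ω - (M.roundData r).x ω) := rfl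
  have hy : ∀ i, (M.roundData r).y i M.K ω - (M.roundData r).x ω = -(((M.K : ℝ) * M.ηl) •
      ((M.roundData r).meanGrad i ω + (M.roundData r).meanNoise i ω - (M.roundData r).ci i ω
        + (M.roundData r).c ω)) := fun i => by
    have := (M.roundData r).y_last hK i ω
    change (M.roundData r).y i M.K ω = (M.roundData r).x ω - ((M.K : ℝ) * M.ηl) • _ at this
    rw [this, sub_sub_cancel_left]
  rw [h, RoundData.nextX, RoundData.direction]
  simp_rw [hy]
  rw [Finset.sum_neg_distrib, ← Finset.smul_sum, step]
  change _ = (M.roundData r).x ω - ((M.K : ℝ) * M.ηl * M.ηg) • (1 / (M.S : ℝ)) •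
    ∑ i ∈ M.A (r + 1) ω, _
  module

theorem clientControl_succ (hK : 1 ≤ M.K) (hη : M.ηl ≠ 0) (r : ℕ) (i : Fin N) (ω : Ω) :
    (M.state (r + 1) ω).clientControl i = (M.roundData r).nextCi i ω := by
  have h : (M.state (r + 1) ω).clientControl i = if i ∈ M.A (r + 1) ω then
      newControl M.K M.ηl ((M.roundData r).x ω) ((M.roundData r).c ω) ((M.roundData r).ci i ω)
        ((M.roundData r).y i M.K ω) else (M.roundData r).ci i ω := rfl
  rw [h]
  have := (M.roundData r).newControl_y_last hK hη i ω
  change newControl M.K M.ηl _ _ _ ((M.roundData r).y i M.K ω) = _ at this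
  rw [this]
  rfl

theorem control_eq (r : ℕ) (ω : Ω) :
    (M.state r ω).control = (1 / (N : ℝ)) • ∑ i, (M.state r ω).clientControl i := by
  induction r with
  | zero => rfl
  | succ r ih =>
    have h : (M.state (r + 1) ω).control = (M.state r ω).control + (1 / (N : ℝ)) •
      ∑ i ∈ M.A (r + 1) ω, (newControl M.K M.ηl ((M.roundData r).x ω) ((M.roundData r).c ω)
        ((M.roundData r).ci i ω) ((M.roundData r).y i M.K ω) - (M.state r ω).clientControl i) := rfl
    rw [h, ih, average_control_update]
    rfl

variable [mΩ : MeasurableSpace Ω] [MeasurableSpace Ξ]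

/-- The hypotheses on the method. -/
structure IsValid (P : Measure Ω) (ν : Fin N → Measure Ξ) (β σ : ℝ) : Prop where
  one_le_S : 1 ≤ M.S
  S_le : M.S ≤ N
  one_le_K : 1 ≤ M.K
  ηl_pos : 0 < M.ηl
  one_le_ηg : 1 ≤ M.ηg
  β_pos : 0 < β
  smooth : ∀ i, IsSmooth β (M.f i)
  stoch : IsStochasticGradient σ M.f ν M.g
  sampling : IsSampling P M.S ν M.A M.Z
  isL2_c₀ : ∀ i, IsL2 (past M.A M.Z 1) P (M.c₀ i)
  isL2_h₀ : ∀ i, IsL2 (past M.A M.Z 1) P (M.h₀ i)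
  noise_le : ∀ i, ∫ ω, ‖M.c₀ i ω - M.h₀ i ω‖ ^ 2 ∂P ≤ σ ^ 2 / M.K
  step_le : 2 * (M.step * β) ≤ 1

namespace IsValid

variable {M} {P : Measure Ω} {ν : Fin N → Measure Ξ} {β σ : ℝ} (H : M.IsValid P ν β σ)
include H

theorem local_step_le : M.K * M.ηl ≤ M.step :=
  le_mul_of_one_le_right (mul_nonneg (Nat.cast_nonneg _) H.ηl_pos.le) H.one_le_ηg

/-- `roundData r` consumes the client set and the data with index r + 1. So it starts from `past (r
+ 1)` and its results live in `past (r + 2)`; the data with index 0 are left for the warm start. -/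
theorem sigma_le_past (r : ℕ) : (M.roundData r).sigma (past M.A M.Z (r + 1)) Set.univ
    ≤ past M.A M.Z (r + 2) := by
  refine sup_le (past_mono _ _ (Nat.le_succ _)) (iSup₂_le fun p _ => ?_)
  exact ((measurable_dataSigma M.Z (i := p.1) (k := p.2) (by simp)).comap_le).trans le_sup_right

theorem measurable_clients_past (r : ℕ) : Measurable[past M.A M.Z (r + 2)] (M.A (r + 1)) :=
  (measurable_clientSigma M.A (by simp)).mono le_sup_left le_rfl

variable [IsProbabilityMeasure P] [∀ i, IsProbabilityMeasure (ν i)]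

theorem indep_clients (r : ℕ) : Indep (MeasurableSpace.comap (M.A (r + 1)) inferInstance)
    ((M.roundData r).sigma (past M.A M.Z (r + 1)) Set.univ) P := by
  have hd : Disjoint {r + 1} (Set.Iio (r + 1)) := by simp
  refine indep_of_indep_of_le_left (indep_of_indep_of_le_right
    (H.sampling.indep_clientSigma hd Set.univ) ?_) (measurable_clientSigma M.A (Set.mem_singleton _)).comap_le
  refine sup_le (sup_le_sup_left (biSup_mono fun _ _ => Set.mem_univ _) _)
    (iSup₂_le fun p _ => ?_)
  exact ((measurable_dataSigma M.Z (i := p.1) (k := p.2) (Set.mem_univ _)).comap_le).trans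
    le_sup_right

theorem indep_data (r : ℕ) (i : Fin N) (k : ℕ) :
    Indep ((M.roundData r).sigma (past M.A M.Z (r + 1)) {(i, k)}ᶜ)
      (MeasurableSpace.comap (M.Z (r + 1) i k) inferInstance) P := by
  have hd : Disjoint {(r + 1, i, k)} ({(r + 1, i, k)}ᶜ : Set (ℕ × Fin N × ℕ)) :=
    disjoint_compl_right
  refine indep_of_indep_of_le_right (indep_of_indep_of_le_left
    (H.sampling.indep_dataSigma hd Set.univ).symm ?_) (measurable_dataSigma M.Z (Set.mem_singleton _)).comap_le
  refine sup_le (sup_le ((biSup_mono fun _ _ => Set.mem_univ _).trans le_sup_right)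
    ((biSup_mono fun p hp => ?_).trans le_sup_left)) (iSup₂_le fun p hp => ?_)
  · rintro rfl
    exact lt_irrefl (r + 1) hp
  · refine ((measurable_dataSigma M.Z (i := p.1) (k := p.2) ?_).comap_le).trans le_sup_left
    intro h
    exact hp (Prod.ext_iff.1 h).2

/-- Independence comes from the sampling scheme for every r. The induction only carries
measurability and square integrability of the state, and the bound on the control noise. -/
theorem roundData_isValid (r : ℕ) : (M.roundData r).IsValid (past M.A M.Z (r + 1)) P ν β σ := by
  have base : ∀ r, IsL2 (past M.A M.Z (r + 1)) P (M.roundData r).x →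
      (∀ i, IsL2 (past M.A M.Z (r + 1)) P ((M.roundData r).ci i)) →
      (∀ i, IsL2 (past M.A M.Z (r + 1)) P ((M.roundData r).h i)) →
      (∀ i, ∫ ω, ‖(M.roundData r).ci i ω - (M.roundData r).h i ω‖ ^ 2 ∂P ≤ σ ^ 2 / M.K) →
      (M.roundData r).IsValid (past M.A M.Z (r + 1)) P ν β σ := fun r hx hc hh hn =>
    { one_le_S := H.one_le_S
      S_le := H.S_le
      one_le_K := H.one_le_K
      ηl_nonneg := H.ηl_pos.le
      β_pos := H.β_pos
      smooth := H.smooth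
      stoch := H.stoch
      le := H.sampling.past_le _
      clients := H.sampling.isUniformSubset _
      measurable_z := H.sampling.measurable_data _
      law_z := H.sampling.law_data _
      indep_clients := H.indep_clients r
      indep_z := H.indep_data r
      isL2_x := hx
      isL2_ci := hc
      isL2_h := hh
      c_eq := M.control_eq r
      noise_le := hn
      step_le := by
        have h1 := mul_le_mul_of_nonneg_right H.local_step_le H.β_pos.le
        have h2 := H.step_le
        change 2 * (M.K * M.ηl * β) ≤ 1
        linarith }
  induction r with
  | zero => exact base 0 (IsL2.const _) H.isL2_c₀ H.isL2_h₀ H.noise_le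
  | succ r ih =>
    have hm := H.sigma_le_past r
    have hm' := H.sampling.past_le (r + 2)
    have hT := H.measurable_clients_past r
    have e1 : (M.roundData (r + 1)).x = (M.roundData r).nextX M.step :=
      funext fun ω => M.model_succ H.one_le_K r ω
    have e2 : ∀ i, (M.roundData (r + 1)).ci i = (M.roundData r).nextCi i := fun i =>
      funext fun ω => M.clientControl_succ H.one_le_K H.ηl_pos.ne' r i ω
    have e3 : ∀ i, (M.roundData (r + 1)).h i = (M.roundData r).nextH i := fun i => rfl
    refine base (r + 1) ?_ (fun i => ?_) (fun i => ?_) fun i => ?_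
    · rw [e1]; exact ih.isL2_nextX hm hT _
    · rw [e2]; exact ih.isL2_nextCi hm hm' hT i
    · rw [e3]; exact ih.isL2_nextH hm hm' hT i
    · rw [e2, e3]; exact ih.next_noise_le i

theorem isL2_points (r : ℕ) (i : Fin N) (k : ℕ) : IsL2 (past M.A M.Z (r + 1)) P (M.points r i k) := by
  induction r generalizing i k with
  | zero => exact IsL2.const _
  | succ r ih =>
    exact (H.roundData_isValid r).isL2_nextPoint (H.sigma_le_past r) (H.sampling.past_le (r + 2))
      (H.measurable_clients_past r) ih i k

theorem exactControl_eq (h : ∀ i ω, M.h₀ i ω = ∇ (M.f i) M.x₀) (r : ℕ) (i : Fin N) (ω : Ω) :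
    M.exactControl r i ω
      = (1 / (M.K : ℝ)) • ∑ k ∈ Finset.range M.K, ∇ (M.f i) (M.points r i k ω) := by
  induction r with
  | zero =>
    have hK : (M.K : ℝ) ≠ 0 := by exact_mod_cast (by have := H.one_le_K; omega : M.K ≠ 0)
    change M.h₀ i ω = (1 / (M.K : ℝ)) • ∑ k ∈ Finset.range M.K, ∇ (M.f i) M.x₀
    rw [h, Finset.sum_const, Finset.card_range, ← Nat.cast_smul_eq_nsmul ℝ, smul_smul,
      one_div_mul_cancel hK, one_smul]
  | succ r ih =>
    change (if i ∈ M.A (r + 1) ω then (M.roundData r).meanGrad i ω else M.exactControl r i ω)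
      = (1 / (M.K : ℝ)) • ∑ k ∈ Finset.range M.K, ∇ (M.f i)
        (if i ∈ M.A (r + 1) ω then (M.roundData r).y i k ω else M.points r i k ω)
    split_ifs
    · rfl
    · exact ih

end IsValid

end Method

/-! ### Warm start. -/

/-- The average over `K` independent samples as the mean noise of a round without movement. -/
noncomputable def warmRound {d N : ℕ} {Ω Ξ : Type*} (f : Fin N → Vec d → ℝ)
    (g : Fin N → Vec d → Ξ → Vec d) (S K : ℕ) (A : ℕ → Ω → Finset (Fin N))
    (Z : ℕ → Fin N → ℕ → Ω → Ξ) (x₀ : Vec d) : RoundData d N Ω Ξ where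
  f := f
  g := g
  S := S
  K := K
  ηl := 0
  x := fun _ => x₀
  c := fun _ => 0
  ci := fun _ _ => 0
  h := fun _ _ => 0
  T := A 0
  z := Z 0

section Warm

variable {d N S K : ℕ} {Ω Ξ : Type*} [mΩ : MeasurableSpace Ω] [MeasurableSpace Ξ]
  {P : Measure Ω} [IsProbabilityMeasure P] {ν : Fin N → Measure Ξ}
  [∀ i, IsProbabilityMeasure (ν i)] {A : ℕ → Ω → Finset (Fin N)} {Z : ℕ → Fin N → ℕ → Ω → Ξ}
  {f : Fin N → Vec d → ℝ} {g : Fin N → Vec d → Ξ → Vec d} {β σ : ℝ}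

theorem warmRound_isValid (hS : 1 ≤ S) (hSN : S ≤ N) (hK : 1 ≤ K) (hβ : 0 < β)
    (hf : ∀ i, IsSmooth β (f i)) (hg : IsStochasticGradient σ f ν g) (hA : IsSampling P S ν A Z)
    (x₀ : Vec d) : (warmRound f g S K A Z x₀).IsValid (past A Z 0) P ν β σ where
  one_le_S := hS
  S_le := hSN
  one_le_K := hK
  ηl_nonneg := le_rfl
  β_pos := hβ
  smooth := hf
  stoch := hg
  le := hA.past_le 0
  clients := hA.isUniformSubset 0
  measurable_z := hA.measurable_data 0
  law_z := hA.law_data 0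
  indep_clients := by
    have hd : Disjoint {0} (Set.Iio 0) := by simp
    refine indep_of_indep_of_le_left (indep_of_indep_of_le_right
      (hA.indep_clientSigma hd Set.univ) ?_)
        (measurable_clientSigma A (Set.mem_singleton _)).comap_le
    refine sup_le (sup_le_sup_left (biSup_mono fun _ _ => Set.mem_univ _) _)
      (iSup₂_le fun p _ => ?_)
    exact ((measurable_dataSigma Z (i := p.1) (k := p.2) (Set.mem_univ _)).comap_le).trans
      le_sup_right
  indep_z := by
    intro i k
    have hd : Disjoint {(0, i, k)} ({(0, i, k)}ᶜ : Set (ℕ × Fin N × ℕ)) :=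
      disjoint_compl_right
    refine indep_of_indep_of_le_right (indep_of_indep_of_le_left
      (hA.indep_dataSigma hd Set.univ).symm ?_)
        (measurable_dataSigma Z (Set.mem_singleton _)).comap_le
    refine sup_le (sup_le ((biSup_mono fun _ _ => Set.mem_univ _).trans le_sup_right)
      ((biSup_mono fun p hp => ?_).trans le_sup_left)) (iSup₂_le fun p hp => ?_)
    · exact absurd hp (Nat.not_lt_zero _)
    · refine ((measurable_dataSigma Z (i := p.1) (k := p.2) ?_).comap_le).trans le_sup_left
      intro h
      exact hp (Prod.ext_iff.1 h).2
  isL2_x := IsL2.const _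
  isL2_ci := fun _ => IsL2.const _
  isL2_h := fun _ => IsL2.const _
  c_eq := fun _ => by simp [warmRound]
  noise_le := fun _ => by simp only [warmRound, sub_zero, norm_zero]; simp; positivity
  step_le := by simp [warmRound]

theorem warmRound_y (x₀ : Vec d) (i : Fin N) (k : ℕ) (ω : Ω) :
    (warmRound f g S K A Z x₀).y i k ω = x₀ := by
  rw [RoundData.y_eq]
  simp [warmRound]

theorem warmStart_sub_gradient (hK : 1 ≤ K) (x₀ : Vec d) (i : Fin N) (ω : Ω) :
    warmStart g K Z x₀ i ω - ∇ (f i) x₀ = (warmRound f g S K A Z x₀).meanNoise i ω := by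
  have hK' : (K : ℝ) ≠ 0 := by positivity
  have h1 : ∀ k, (warmRound f g S K A Z x₀).noise i k ω
      = g i x₀ (Z 0 i k ω) - ∇ (f i) x₀ := fun k => by
    rw [RoundData.noise, warmRound_y]
    rfl
  simp_rw [RoundData.meanNoise, h1]
  change _ = (1 / (K : ℝ)) • ∑ k ∈ Finset.range K, _
  rw [Finset.sum_sub_distrib, smul_sub, Finset.sum_const, Finset.card_range,
    ← Nat.cast_smul_eq_nsmul ℝ, smul_smul, one_div_mul_cancel hK', one_smul, warmStart]

theorem isL2_warmStart (hS : 1 ≤ S) (hSN : S ≤ N) (hK : 1 ≤ K) (hβ : 0 < β)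
    (hf : ∀ i, IsSmooth β (f i)) (hg : IsStochasticGradient σ f ν g) (hA : IsSampling P S ν A Z)
    (x₀ : Vec d) (i : Fin N) : IsL2 (past A Z 1) P (warmStart g K Z x₀ i) := by
  have H := warmRound_isValid hS hSN hK hβ hf hg hA x₀
  have h1 : warmStart g K Z x₀ i
      = fun ω => (warmRound f g S K A Z x₀).meanNoise i ω + ∇ (f i) x₀ := by
    ext1 ω
    rw [← warmStart_sub_gradient hK, sub_add_cancel]
  rw [h1]
  refine ((H.isL2_meanNoise i).mono ?_).add (IsL2.const _)
  refine sup_le (past_mono _ _ zero_le_one) (iSup₂_le fun p _ => ?_)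
  exact ((measurable_dataSigma Z (i := p.1) (k := p.2) (by simp)).comap_le).trans le_sup_right

theorem integral_warmStart_sub_sq_le (hS : 1 ≤ S) (hSN : S ≤ N) (hK : 1 ≤ K) (hβ : 0 < β)
    (hf : ∀ i, IsSmooth β (f i)) (hg : IsStochasticGradient σ f ν g) (hA : IsSampling P S ν A Z)
    (x₀ : Vec d) (i : Fin N) :
    ∫ ω, ‖warmStart g K Z x₀ i ω - ∇ (f i) x₀‖ ^ 2 ∂P ≤ σ ^ 2 / K := by
  have H := warmRound_isValid hS hSN hK hβ hf hg hA x₀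
  simp_rw [warmStart_sub_gradient (f := f) (S := S) (A := A) hK]
  exact H.integral_meanNoise_sq_le i

end Warm

/-! ### The output law, averaging of recursions and choice of the step-size. -/

section Output

variable {d : ℕ} {Ω : Type*} [MeasurableSpace Ω] {P : Measure Ω}

theorem integrable_outputLaw {x : ℕ → Ω → Vec d} (R : ℕ) (w : ℕ → ℝ≥0) {err : Vec d → ℝ}
    (hx : ∀ r, AEMeasurable (x r) P) (herr : Continuous err)
    (hi : ∀ r, Integrable (fun ω => err (x r ω)) P) :
    Integrable err (outputLaw P x R w) ∧ ∫ v, err v ∂(outputLaw P x R w)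
      = ∑ r ∈ Finset.range (R + 1),
        ((w r : ℝ) / ∑ q ∈ Finset.range (R + 1), (w q : ℝ)) * ∫ ω, err (x r ω) ∂P := by
  have h1 : ∀ r, Integrable err (P.map (x r)) := fun r =>
    (integrable_map_measure herr.aestronglyMeasurable (hx r)).2 (hi r)
  have h2 : ∀ r ∈ Finset.range (R + 1), Integrable err
      (((w r / ∑ q ∈ Finset.range (R + 1), w q : ℝ≥0) : ℝ≥0∞) • P.map (x r)) := fun r _ =>
    (h1 r).smul_measure ENNReal.coe_ne_top
  refine ⟨integrable_finsetSum_measure.2 h2, ?_⟩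
  rw [outputLaw, integral_finsetSum_measure h2]
  refine Finset.sum_congr rfl fun r _ => ?_
  rw [integral_smul_measure, integral_map (hx r) herr.aestronglyMeasurable]
  simp

/-- The output law concentrated on the starting point. -/
theorem outputSatisfies_of_start {x : ℝ → ℕ → Ω → Vec d} [IsProbabilityMeasure P] {x₀ : Vec d}
    {ηmax : ℝ} (hη : 0 < ηmax) (R : ℕ) {err : Vec d → ℝ} (herr : Continuous err) {Q : ℝ → Prop}
    (hx : ∀ r, AEMeasurable (x ηmax r) P) (hi : ∀ r, Integrable (fun ω => err (x ηmax r ω)) P)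
    (h0 : ∀ ω, x ηmax 0 ω = x₀) (hQ : Q (err x₀)) : OutputSatisfies P x ηmax R err Q := by
  have hw : ∑ r ∈ Finset.range (R + 1), (if r = 0 then 1 else 0 : ℝ≥0) = 1 := by simp
  refine ⟨ηmax, hη, le_rfl, fun r => if r = 0 then 1 else 0, by rw [hw]; exact one_pos, ?_⟩
  obtain ⟨h1, h2⟩ := integrable_outputLaw (P := P) R (fun r => if r = 0 then 1 else 0) hx herr hi
  refine ⟨h1, ?_⟩
  rw [h2]
  have h3 : ∑ q ∈ Finset.range (R + 1), (((if q = 0 then 1 else 0 : ℝ≥0)) : ℝ) = 1 := by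
    rw [← NNReal.coe_sum, hw, NNReal.coe_one]
  rw [h3, Finset.sum_eq_single 0]
  · simpa [h0] using hQ
  · intro r _ hr; simp [hr]
  · simp

end Output

/-- Averaging a descent recursion with uniform weights. -/
theorem uniform_average_le {Φ E : ℕ → ℝ} {a B : ℝ} (ha : 0 < a) (hΦ : ∀ r, 0 ≤ Φ r)
    (h : ∀ r, Φ (r + 1) ≤ Φ r - a * E r + B) {R : ℕ} (hR : 1 ≤ R) :
    0 < ∑ r ∈ Finset.range (R + 1), (if r < R then 1 else 0 : ℝ≥0) ∧
    ∑ r ∈ Finset.range (R + 1), (((if r < R then 1 else 0 : ℝ≥0) : ℝ) /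
      ∑ q ∈ Finset.range (R + 1), ((if q < R then 1 else 0 : ℝ≥0) : ℝ)) * E r
      ≤ Φ 0 / (a * R) + B / a := by
  have hR' : (0 : ℝ) < R := by exact_mod_cast hR
  -- The last iterate gets weight 0: R steps of the recursion control only E 0, …, E (R - 1).
  have h1 : ∑ r ∈ Finset.range (R + 1), (if r < R then 1 else 0 : ℝ≥0) = R := by
    rw [Finset.sum_range_succ, if_neg (lt_irrefl R), add_zero,
      Finset.sum_congr rfl fun r hr => if_pos (Finset.mem_range.1 hr)]
    simp
  have h2 : ∑ r ∈ Finset.range (R + 1), ((if r < R then 1 else 0 : ℝ≥0) : ℝ) = R := by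
    rw [← NNReal.coe_sum, h1, NNReal.coe_natCast]
  refine ⟨by rw [h1]; exact_mod_cast hR, ?_⟩
  rw [h2, Finset.sum_range_succ, if_neg (lt_irrefl R), NNReal.coe_zero, zero_div, zero_mul, add_zero]
  have h3 : ∑ r ∈ Finset.range R, (((if r < R then 1 else 0 : ℝ≥0) : ℝ) / R) * E r
      = (∑ r ∈ Finset.range R, E r) / R := by
    rw [Finset.sum_div]
    refine Finset.sum_congr rfl fun r hr => ?_
    rw [if_pos (Finset.mem_range.1 hr), NNReal.coe_one]
    ring
  have h4 : ∀ n : ℕ, a * ∑ r ∈ Finset.range n, E r ≤ Φ 0 - Φ n + n * B := by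
    intro n
    induction n with
    | zero => simp
    | succ n ih =>
      rw [Finset.sum_range_succ]
      push_cast
      linarith [h n]
  rw [h3, div_le_iff₀ hR']
  have h5 : (Φ 0 / (a * R) + B / a) * R = (Φ 0 + R * B) / a := by field_simp
  rw [h5, le_div_iff₀ ha]
  linarith [h4 R, hΦ R]

/-- Averaging a contractive descent recursion with geometric weights. -/
theorem geometric_average_le {Φ E : ℕ → ℝ} {a B q : ℝ} (ha : 0 < a) (hq : 0 < q)
    (hq1 : q < 1) (hΦ : ∀ r, 0 ≤ Φ r)
    (h : ∀ r, Φ (r + 1) ≤ (1 - q) * Φ r - a * E r + B) {R : ℕ} (hR : 1 ≤ q * R) :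
    ∃ w : ℕ → ℝ≥0, 0 < ∑ r ∈ Finset.range (R + 1), w r ∧
    ∑ r ∈ Finset.range (R + 1), ((w r : ℝ) / ∑ q ∈ Finset.range (R + 1), (w q : ℝ)) * E r
      ≤ 2 * q * Real.exp (-(q * R)) * Φ 0 / a + B / a := by
  set p : ℝ≥0 := ⟨1 - q, by linarith⟩ with hp
  have hpc : (p : ℝ) = 1 - q := rfl
  -- The weights are those with which the terms E r appear when the contraction is unrolled R times;
  -- x^R again gets weight 0.
  set w : ℕ → ℝ≥0 := fun r => if r < R then p ^ (R - 1 - r) else 0 with hw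
  have hp0 : 0 ≤ 1 - q := by linarith
  have h1 : ∀ F : ℕ → ℝ, ∑ r ∈ Finset.range (R + 1), (w r : ℝ) * F r
      = ∑ r ∈ Finset.range R, (1 - q) ^ (R - 1 - r) * F r := by
    intro F
    rw [Finset.sum_range_succ]
    simp only [hw, if_neg (lt_irrefl R), NNReal.coe_zero, zero_mul, add_zero]
    refine Finset.sum_congr rfl fun r hr => ?_
    rw [if_pos (Finset.mem_range.1 hr), NNReal.coe_pow, hpc]
  set W : ℝ := ∑ r ∈ Finset.range (R + 1), (w r : ℝ) with hW
  have h2 : W = ∑ r ∈ Finset.range R, (1 - q) ^ r := by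
    have := h1 fun _ => 1
    simp only [mul_one] at this
    rw [hW, this, Finset.sum_range_reflect fun r => (1 - q) ^ r]
  have h3 : q * W = 1 - (1 - q) ^ R := by
    have := geom_sum_mul_neg (1 - q) R
    rw [h2]
    linarith
  have h4 : (1 - q) ^ R ≤ Real.exp (-(q * R)) := by
    have e1 : 1 - q ≤ Real.exp (-q) := by
      have := Real.add_one_le_exp (-q); linarith
    calc (1 - q) ^ R ≤ (Real.exp (-q)) ^ R := pow_le_pow_left₀ hp0 e1 R
      _ = Real.exp (-(q * R)) := by rw [← Real.exp_nat_mul]; ring_nf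
  have h5 : Real.exp (-(q * R)) ≤ 1 / 2 := by
    calc Real.exp (-(q * R)) ≤ Real.exp (-1) := Real.exp_le_exp.2 (by linarith)
      _ ≤ 1 / 2 := by
        rw [Real.exp_neg, ← one_div]
        exact one_div_le_one_div_of_le (by norm_num) (by linarith [Real.add_one_le_exp (1 : ℝ)])
  -- The assumption qR ≥ 1 makes the total weight W at least 1/(2q). Normalizing therefore costs
  -- only 2q on the initial term, not 1/R.
  have h6 : 1 / 2 ≤ q * W := by linarith
  have hWpos : 0 < W := by
    by_contra hneg
    linarith [mul_nonpos_of_nonneg_of_nonpos hq.le (not_lt.1 hneg)]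
  have h7 : ∀ n : ℕ, a * ∑ r ∈ Finset.range n, (1 - q) ^ (n - 1 - r) * E r
      ≤ (1 - q) ^ n * Φ 0 - Φ n + B * ∑ r ∈ Finset.range n, (1 - q) ^ r := by
    intro n
    induction n with
    | zero => simp
    | succ n ih =>
      rw [Finset.sum_range_succ, geom_sum_succ]
      have e1 : ∑ r ∈ Finset.range n, (1 - q) ^ (n + 1 - 1 - r) * E r
          = (1 - q) * ∑ r ∈ Finset.range n, (1 - q) ^ (n - 1 - r) * E r := by
        rw [Finset.mul_sum]
        refine Finset.sum_congr rfl fun r hr => ?_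
        have := Finset.mem_range.1 hr
        rw [show n + 1 - 1 - r = (n - 1 - r) + 1 by omega, pow_succ]
        ring
      rw [e1, show n + 1 - 1 - n = 0 by omega, pow_zero, pow_succ]
      have e2 := mul_le_mul_of_nonneg_left ih hp0
      linarith [h n]
  refine ⟨w, ?_, ?_⟩
  · rw [← NNReal.coe_pos, NNReal.coe_sum]; exact hWpos
  · have h8 : ∑ r ∈ Finset.range (R + 1), (w r : ℝ) / W * E r
        = (∑ r ∈ Finset.range R, (1 - q) ^ (R - 1 - r) * E r) / W := by
      rw [← h1 E, Finset.sum_div]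
      exact Finset.sum_congr rfl fun r _ => by ring
    rw [h8, div_le_iff₀ hWpos]
    have h9 : (2 * q * Real.exp (-(q * R)) * Φ 0 / a + B / a) * W
        = (2 * (q * W) * (Real.exp (-(q * R)) * Φ 0) + B * W) / a := by field_simp
    rw [h9, le_div_iff₀ ha, mul_comm]
    have e1 := h7 R
    rw [← h2] at e1
    have e2 := mul_le_mul_of_nonneg_right h4 (hΦ 0)
    have e3 : 0 ≤ Real.exp (-(q * R)) * Φ 0 := mul_nonneg (Real.exp_pos _).le (hΦ 0)
    have e4 := mul_le_mul_of_nonneg_right (show 1 ≤ 2 * (q * W) by linarith) e3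
    linarith [hΦ R]

/-- Choice of the step-size that balances the initial error and the noise. -/
theorem exists_step_le {F V c R a₀ : ℝ} (hF : 0 < F) (hV : 0 ≤ V) (hc : 0 ≤ c) (hR : 0 < R)
    (ha₀ : 0 < a₀) : ∃ a, 0 < a ∧ a ≤ a₀ ∧
      F / (a * R) + c * (a * V) ≤ F / (a₀ * R) + (1 + c) * √(F * V / R) := by
  rcases hV.eq_or_lt with rfl | hV
  · refine ⟨a₀, ha₀, le_rfl, ?_⟩
    simp
  -- The step at which F/(bR) and bV coincide; it is truncated at a₀. The case V = 0, where the
  -- balance point is infinite, was removed above.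
  set b : ℝ := √(F / (R * V)) with hb
  have hb0 : 0 < b := Real.sqrt_pos.2 (by positivity)
  have hb2 : b ^ 2 = F / (R * V) := Real.sq_sqrt (by positivity)
  have hbV : b * V = √(F * V / R) := by
    rw [eq_comm, Real.sqrt_eq_iff_mul_self_eq_of_pos (by positivity),
      show b * V * (b * V) = b ^ 2 * V ^ 2 by ring, hb2]
    field_simp
  have hFb : F / (b * R) = √(F * V / R) := by
    rw [← hbV, div_eq_iff (by positivity), show b * V * (b * R) = b ^ 2 * (R * V) by ring, hb2]
    field_simp
  have hs : 0 ≤ √(F * V / R) := Real.sqrt_nonneg _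
  rcases le_total a₀ b with h | h
  · refine ⟨a₀, ha₀, le_rfl, ?_⟩
    have : c * (a₀ * V) ≤ c * (b * V) := by gcongr
    rw [hbV] at this
    linarith
  · refine ⟨b, hb0, h, ?_⟩
    rw [hbV, hFb]
    have : 0 ≤ F / (a₀ * R) := by positivity
    linarith

/-! ### From the recursions to the law of the output. -/

namespace Method

variable {d N : ℕ} {Ω Ξ : Type*} {M : Method d N Ω Ξ} [mΩ : MeasurableSpace Ω] [MeasurableSpace Ξ]
  {P : Measure Ω} {ν : Fin N → Measure Ξ} {β σ : ℝ}

/-- The variance of an average update. -/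
noncomputable def variance (M : Method d N Ω Ξ) (σ : ℝ) : ℝ :=
  σ ^ 2 / (M.K * M.S) * (1 + M.S / M.ηg ^ 2)

namespace IsValid

variable (H : M.IsValid P ν β σ)
include H

/-- Since K ηl is the effective step divided by ηg, the drift noise (Kηl)²σ²/K is exactly the S/ηg²
share of the variance. -/
theorem noise_le_variance {u v : ℝ} (hv : v ≤ u) :
    u * (M.step ^ 2 * (σ ^ 2 / (M.K * M.S))) + v * ((M.K * M.ηl) ^ 2 * (σ ^ 2 / M.K))
      ≤ u * (M.step ^ 2 * M.variance σ) := by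
  have hK : (0 : ℝ) < M.K := by exact_mod_cast H.one_le_K
  have hS : (0 : ℝ) < M.S := by exact_mod_cast H.one_le_S
  have hg : (0 : ℝ) < M.ηg := by linarith [H.one_le_ηg]
  have h1 : M.step ^ 2 * M.variance σ = M.step ^ 2 * (σ ^ 2 / (M.K * M.S))
      + (M.K * M.ηl) ^ 2 * (σ ^ 2 / M.K) := by
    rw [variance, step]
    field_simp
  rw [h1, mul_add]
  gcongr

variable [IsProbabilityMeasure P] [∀ i, IsProbabilityMeasure (ν i)]

theorem memLp_model (r : ℕ) : MemLp (fun ω => (M.state r ω).model) 2 P :=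
  (H.roundData_isValid r).isL2_x.2

theorem smooth_objective : IsSmooth β (objective M.f) :=
  isSmooth_objective (H.one_le_S.trans H.S_le) H.smooth

theorem integrable_gap (v : Vec d) (r : ℕ) :
    Integrable (fun ω => objective M.f (M.state r ω).model - objective M.f v) P :=
  (integrable_comp_of_memLp (H.memLp_model r) H.β_pos.le H.smooth_objective).sub
    (integrable_const _)

theorem integrable_gradient_sq (r : ℕ) :
    Integrable (fun ω => ‖∇ (objective M.f) (M.state r ω).model‖ ^ 2) P :=
  integrable_norm_sq_of_memLp (memLp_gradient H.smooth_objective (H.memLp_model r))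

theorem convex_succ_le {μ : ℝ} (hμ : 0 ≤ μ) (hc : ∀ i, IsMuConvex μ (M.f i)) {xs : Vec d}
    (hxs : ∀ x, objective M.f xs ≤ objective M.f x) (haβ : M.step * β ≤ 1 / 81)
    (haμ : μ * M.step ≤ (M.S : ℝ) / N / 15) (r : ℕ) :
    ∫ ω, ‖(M.state (r + 1) ω).model - xs‖ ^ 2 ∂P + 13 * ((N : ℝ) / M.S) * M.step ^ 2 *
        (1 / (N : ℝ) * ∑ i, ∫ ω, ‖M.exactControl (r + 1) i ω - ∇ (M.f i) xs‖ ^ 2 ∂P)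
      ≤ (1 - μ * M.step / 2) * (∫ ω, ‖(M.state r ω).model - xs‖ ^ 2 ∂P + 13 * ((N : ℝ) / M.S) *
        M.step ^ 2 * (1 / (N : ℝ) * ∑ i, ∫ ω, ‖M.exactControl r i ω - ∇ (M.f i) xs‖ ^ 2 ∂P))
        - M.step * ∫ ω, (objective M.f (M.state r ω).model - objective M.f xs) ∂P
        + 8 * (M.step ^ 2 * M.variance σ) := by
  have h1 := (H.roundData_isValid r).convex_round_le hμ hc hxs H.ηl_pos H.local_step_le haβ haμ
  have h2 := H.noise_le_variance (u := 8) (v := 3) (by norm_num)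
  have h3 : ∀ ω, (M.state (r + 1) ω).model = (M.roundData r).nextX M.step ω :=
    M.model_succ H.one_le_K r
  simp_rw [h3]
  exact h1.trans (by
    refine (add_assoc _ _ _).le.trans ?_
    exact add_le_add_right h2 _)

theorem nonconvex_succ_le (h₀ : ∀ i ω, M.h₀ i ω = ∇ (M.f i) M.x₀)
    (h₁ : M.step * β ≤ 1 / 200) (h₂ : (M.step * β) ^ 2 ≤ (M.S : ℝ) / N / 40000)
    (h₃ : (M.step * β) ^ 3 ≤ ((M.S : ℝ) / N) ^ 2 / 8000000) (r : ℕ) :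
    ∫ ω, objective M.f (M.state (r + 1) ω).model ∂P + 40 * ((N : ℝ) / M.S) *
        (β ^ 3 * M.step ^ 2) *
        RoundData.lag P M.K (M.points (r + 1)) (fun ω => (M.state (r + 1) ω).model)
      ≤ ∫ ω, objective M.f (M.state r ω).model ∂P + 40 * ((N : ℝ) / M.S) *
        (β ^ 3 * M.step ^ 2) * RoundData.lag P M.K (M.points r) (fun ω => (M.state r ω).model)
        - M.step / 4 * ∫ ω, ‖∇ (objective M.f) (M.state r ω).model‖ ^ 2 ∂P
        + 8 * (β * M.step ^ 2 * M.variance σ) := by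
  have h1 := (H.roundData_isValid r).nonconvex_round_le (H.isL2_points r) H.ηl_pos
    H.local_step_le (H.exactControl_eq h₀ r) h₁ h₂ h₃
  have h2 := H.noise_le_variance (u := 8 * β) (v := β) (by linarith [H.β_pos])
  have h3 : (fun ω => (M.state (r + 1) ω).model) = (M.roundData r).nextX M.step :=
    funext fun ω => M.model_succ H.one_le_K r ω
  have h4 : ∀ ω, (M.state (r + 1) ω).model = (M.roundData r).nextX M.step ω := congrFun h3
  rw [h3]
  simp_rw [h4]
  refine h1.trans ?_
  refine (add_assoc _ _ _).le.trans (add_le_add_right (le_trans (le_of_eq ?_) (h2.trans (le_of_eq ?_))) _)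
  · change 8 * (β * M.step ^ 2 * (σ ^ 2 / (M.K * M.S))) + β * (M.K * M.ηl) ^ 2 * (σ ^ 2 / M.K) = _
    ring
  · ring

end IsValid

end Method

/-- The standing assumptions of the theorem. -/
structure Setting {d N : ℕ} {Ω Ξ : Type*} [MeasurableSpace Ω] [MeasurableSpace Ξ] (P : Measure Ω)
    (S K : ℕ) (ν : Fin N → Measure Ξ) (A : ℕ → Ω → Finset (Fin N)) (Z : ℕ → Fin N → ℕ → Ω → Ξ)
    (f : Fin N → Vec d → ℝ) (g : Fin N → Vec d → Ξ → Vec d) (β σ : ℝ) : Prop where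
  one_le_S : 1 ≤ S
  S_le : S ≤ N
  one_le_K : 1 ≤ K
  β_pos : 0 < β
  σ_nonneg : 0 ≤ σ
  smooth : ∀ i, IsSmooth β (f i)
  stoch : IsStochasticGradient σ f ν g
  sampling : IsSampling P S ν A Z

/-- Admissible initial control variates. -/
structure IsStart {d N : ℕ} {Ω Ξ : Type*} [MeasurableSpace Ω] [MeasurableSpace Ξ] (P : Measure Ω)
    (K : ℕ) (A : ℕ → Ω → Finset (Fin N)) (Z : ℕ → Fin N → ℕ → Ω → Ξ) (σ : ℝ)
    (c₀ h₀ : Fin N → Ω → Vec d) : Prop where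
  isL2_c₀ : ∀ i, IsL2 (past A Z 1) P (c₀ i)
  isL2_h₀ : ∀ i, IsL2 (past A Z 1) P (h₀ i)
  noise_le : ∀ i, ∫ ω, ‖c₀ i ω - h₀ i ω‖ ^ 2 ∂P ≤ σ ^ 2 / K

namespace Setting

variable {d N S K : ℕ} {Ω Ξ : Type*} [mΩ : MeasurableSpace Ω] [MeasurableSpace Ξ]
  {P : Measure Ω} [IsProbabilityMeasure P] {ν : Fin N → Measure Ξ}
  [∀ i, IsProbabilityMeasure (ν i)] {A : ℕ → Ω → Finset (Fin N)} {Z : ℕ → Fin N → ℕ → Ω → Ξ}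
  {f : Fin N → Vec d → ℝ} {g : Fin N → Vec d → Ξ → Vec d} {β σ : ℝ} {x₀ : Vec d}
  {c₀ h₀ : Fin N → Ω → Vec d} {ηg : ℝ}
  (H : Setting P S K ν A Z f g β σ)
include H

theorem N_pos : (0 : ℝ) < N := by exact_mod_cast H.one_le_S.trans H.S_le

theorem S_pos : (0 : ℝ) < S := by exact_mod_cast H.one_le_S

theorem K_pos : (0 : ℝ) < K := by exact_mod_cast H.one_le_K

theorem ratio_pos : 0 < (S : ℝ) / N := div_pos H.S_pos H.N_pos

theorem ratio_le_one : (S : ℝ) / N ≤ 1 := by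
  rw [div_le_one H.N_pos]
  exact_mod_cast H.S_le

theorem one_le_inv_ratio : 1 ≤ (N : ℝ) / S := by
  rw [one_le_div H.S_pos]
  exact_mod_cast H.S_le

/-- Fixed control variates count as exact parts without noise, although they need not be gradients;
their error is carried by the potential. -/
theorem isStart_const (c₀ : Fin N → Vec d) :
    IsStart P K A Z σ (fun i _ => c₀ i) (fun i _ => c₀ i) :=
  ⟨fun _ => IsL2.const _, fun _ => IsL2.const _, fun i => by
    simp only [sub_self, norm_zero]
    simp
    positivity⟩

/-- A batch of K samples has the same noise level σ²/K as a refreshed control variate, and its exact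
part is a gradient at x₀. In the non-convex case the initial lag is therefore zero. -/
theorem isStart_warm (x₀ : Vec d) :
    IsStart P K A Z σ (warmStart g K Z x₀) (fun i _ => ∇ (f i) x₀) :=
  ⟨isL2_warmStart H.one_le_S H.S_le H.one_le_K H.β_pos H.smooth H.stoch H.sampling x₀,
    fun _ => IsL2.const _,
    integral_warmStart_sub_sq_le H.one_le_S H.S_le H.one_le_K H.β_pos H.smooth H.stoch H.sampling
      x₀⟩

/-- The method with local step-size `ηl`. -/
theorem method_isValid (hs : IsStart P K A Z σ c₀ h₀) (hg : 1 ≤ ηg) {ηl : ℝ} (hη : 0 < ηl)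
    (hstep : 2 * (K * ηl * ηg * β) ≤ 1) :
    (Method.mk f g S K ηl ηg A Z x₀ c₀ h₀).IsValid P ν β σ :=
  ⟨H.one_le_S, H.S_le, H.one_le_K, hη, hg, H.β_pos, H.smooth, H.stoch, H.sampling, hs.isL2_c₀,
    hs.isL2_h₀, hs.noise_le, hstep⟩

theorem continuous_gap (v : Vec d) : Continuous fun x => objective f x - objective f v :=
  (isSmooth_objective (H.one_le_S.trans H.S_le) H.smooth).1.continuous.sub continuous_const

theorem continuous_gradient_sq : Continuous fun x => ‖∇ (objective f) x‖ ^ 2 :=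
  (isSmooth_objective (H.one_le_S.trans H.S_le) H.smooth).continuous_gradient.norm.pow 2

/-- An output that satisfies `Q` because the starting point does. -/
theorem start_gap (hs : IsStart P K A Z σ c₀ h₀) (hg : 1 ≤ ηg) {ηmax : ℝ} (hη : 0 < ηmax)
    (hstep : 2 * (K * ηmax * ηg * β) ≤ 1) (R : ℕ) {xs : Vec d} {Q : ℝ → Prop}
    (hQ : Q (objective f x₀ - objective f xs)) :
    OutputSatisfies P (fun ηl => iterates g S K A Z x₀ c₀ ηl ηg) ηmax R
      (fun x => objective f x - objective f xs) Q := by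
  have hM := H.method_isValid (x₀ := x₀) hs hg hη hstep
  exact outputSatisfies_of_start hη R (H.continuous_gap xs)
    (fun r => (hM.memLp_model r).1.aemeasurable) (hM.integrable_gap xs) (fun ω => rfl) hQ

theorem start_gradient (hs : IsStart P K A Z σ c₀ h₀) (hg : 1 ≤ ηg) {ηmax : ℝ} (hη : 0 < ηmax)
    (hstep : 2 * (K * ηmax * ηg * β) ≤ 1) (R : ℕ) {Q : ℝ → Prop}
    (hQ : Q (‖∇ (objective f) x₀‖ ^ 2)) :
    OutputSatisfies P (fun ηl => iterates g S K A Z x₀ c₀ ηl ηg) ηmax R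
      (fun x => ‖∇ (objective f) x‖ ^ 2) Q := by
  have hM := H.method_isValid (x₀ := x₀) hs hg hη hstep
  exact outputSatisfies_of_start hη R H.continuous_gradient_sq
    (fun r => (hM.memLp_model r).1.aemeasurable) hM.integrable_gradient_sq (fun ω => rfl) hQ

theorem step_eq (hg : 1 ≤ ηg) (a : ℝ) : K * (a / (K * ηg)) * ηg = a := by
  have := H.K_pos
  have : 0 < ηg := by linarith
  field_simp

/-- The initial value of the potential in the convex cases. -/
noncomputable def _root_.Scaffold.initPotential {d N : ℕ} {Ω : Type*} [MeasurableSpace Ω]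
    (P : Measure Ω) (S : ℕ) (f : Fin N → Vec d → ℝ) (x₀ xs : Vec d) (h₀ : Fin N → Ω → Vec d)
    (a : ℝ) : ℝ :=
  ‖x₀ - xs‖ ^ 2 + 13 * ((N : ℝ) / S) * a ^ 2 *
    (1 / (N : ℝ) * ∑ i, ∫ ω, ‖h₀ i ω - ∇ (f i) xs‖ ^ 2 ∂P)

/-- Leaving Q open lets the same estimate serve the error bounds and the round counts. The local
step a/(Kηg) realizes the effective step a. -/
theorem convex_output (hs : IsStart P K A Z σ c₀ h₀) (hg : 1 ≤ ηg) {a : ℝ} (ha : 0 < a)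
    (haβ : a * β ≤ 1 / 81) (hc : ∀ i, IsMuConvex 0 (f i)) {xs : Vec d}
    (hxs : ∀ x, objective f xs ≤ objective f x) {R : ℕ} (hR : 1 ≤ R) {ηmax : ℝ}
    (hη : a / (K * ηg) ≤ ηmax) {Q : ℝ → Prop}
    (hQ : ∀ e ≤ initPotential P S f x₀ xs h₀ a / (a * R)
      + 8 * (a * (σ ^ 2 / (K * S) * (1 + S / ηg ^ 2))), Q e) :
    OutputSatisfies P (fun ηl => iterates g S K A Z x₀ c₀ ηl ηg) ηmax R
      (fun x => objective f x - objective f xs) Q := by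
  have hη0 : 0 < a / (K * ηg) := div_pos ha (mul_pos H.K_pos (by linarith))
  have hst := H.step_eq hg a
  have hM := H.method_isValid (x₀ := x₀) hs hg hη0 (by rw [hst]; linarith)
  set M := Method.mk f g S K (a / (K * ηg)) ηg A Z x₀ c₀ h₀
  have hstep : M.step = a := hst
  have hrec := hM.convex_succ_le (μ := 0) le_rfl hc hxs (by rw [hstep]; exact haβ)
    (by rw [zero_mul]; exact div_nonneg H.ratio_pos.le (by norm_num))
  have hf : M.f = f := rfl
  have hS : M.S = S := rfl
  simp only [hf, hS, hstep] at hrec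
  obtain ⟨hw, hle⟩ := uniform_average_le (a := a) (B := 8 * (a ^ 2 * M.variance σ))
    (Φ := fun r => ∫ ω, ‖(M.state r ω).model - xs‖ ^ 2 ∂P + 13 * ((N : ℝ) / S) * a ^ 2 *
        (1 / (N : ℝ) * ∑ i, ∫ ω, ‖M.exactControl r i ω - ∇ (f i) xs‖ ^ 2 ∂P))
    (E := fun r => ∫ ω, (objective f (M.state r ω).model - objective f xs) ∂P) ha
    (fun r => by
      have h1 : 0 ≤ ∫ ω, ‖(M.state r ω).model - xs‖ ^ 2 ∂P := integral_nonneg fun ω => by positivity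
      have h2 : ∀ i, 0 ≤ ∫ ω, ‖M.exactControl r i ω - ∇ (f i) xs‖ ^ 2 ∂P := fun i =>
        integral_nonneg fun ω => by positivity
      exact add_nonneg h1 (mul_nonneg (by positivity) (mul_nonneg (by positivity)
        (Finset.sum_nonneg fun i _ => h2 i))))
    (fun r => by
      have := hrec r
      rw [zero_mul, zero_div, sub_zero, one_mul] at this
      exact this) hR
  obtain ⟨h1, h2⟩ := integrable_outputLaw (P := P) (x := iterates g S K A Z x₀ c₀ (a / (K * ηg)) ηg)
    R (fun r => if r < R then 1 else 0)
    (fun r => (hM.memLp_model r).1.aemeasurable) (H.continuous_gap xs) (hM.integrable_gap xs)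
  refine ⟨a / (K * ηg), hη0, hη, fun r => if r < R then 1 else 0, hw, h1, hQ _ ?_⟩
  rw [h2]
  refine hle.trans (le_of_eq ?_)
  have h3 : 8 * (a ^ 2 * M.variance σ) / a = 8 * (a * (σ ^ 2 / (K * S) * (1 + S / ηg ^ 2))) := by
    have : M.variance σ = σ ^ 2 / (K * S) * (1 + S / ηg ^ 2) := rfl
    rw [this]
    generalize σ ^ 2 / (K * S) * (1 + S / ηg ^ 2) = V
    field_simp
  rw [h3]
  have h4 : ∫ ω, ‖(M.state 0 ω).model - xs‖ ^ 2 ∂P = ‖x₀ - xs‖ ^ 2 := by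
    change ∫ ω, ‖x₀ - xs‖ ^ 2 ∂P = _
    rw [integral_const, probReal_univ, one_smul]
  have h5 : initPotential P S f x₀ xs h₀ a = ‖x₀ - xs‖ ^ 2 + 13 * ((N : ℝ) / S) * a ^ 2 *
        (1 / (N : ℝ) * ∑ i, ∫ ω, ‖M.exactControl 0 i ω - ∇ (f i) xs‖ ^ 2 ∂P) := rfl
  rw [h4, ← h5]

theorem strongly_convex_output (hs : IsStart P K A Z σ c₀ h₀) (hg : 1 ≤ ηg) {a μ : ℝ} (ha : 0 < a)
    (hμ : 0 < μ) (haβ : a * β ≤ 1 / 81) (haμ : μ * a ≤ (S : ℝ) / N / 15)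
    (hc : ∀ i, IsMuConvex μ (f i)) {xs : Vec d}
    (hxs : ∀ x, objective f xs ≤ objective f x) {R : ℕ} (hR : 2 ≤ μ * a * R) {ηmax : ℝ}
    (hη : a / (K * ηg) ≤ ηmax) {Q : ℝ → Prop}
    (hQ : ∀ e ≤ μ * initPotential P S f x₀ xs h₀ a * Real.exp (-(μ * a * R / 2))
      + 8 * (a * (σ ^ 2 / (K * S) * (1 + S / ηg ^ 2))), Q e) :
    OutputSatisfies P (fun ηl => iterates g S K A Z x₀ c₀ ηl ηg) ηmax R
      (fun x => objective f x - objective f xs) Q := by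
  have hη0 : 0 < a / (K * ηg) := div_pos ha (mul_pos H.K_pos (by linarith))
  have hst := H.step_eq hg a
  have hM := H.method_isValid (x₀ := x₀) hs hg hη0 (by rw [hst]; linarith)
  set M := Method.mk f g S K (a / (K * ηg)) ηg A Z x₀ c₀ h₀
  have hstep : M.step = a := hst
  have hrec := hM.convex_succ_le hμ.le hc hxs (by rw [hstep]; exact haβ)
    (by rw [hstep]; exact haμ)
  have hf : M.f = f := rfl
  have hS : M.S = S := rfl
  simp only [hf, hS, hstep] at hrec
  obtain ⟨w, hw, hle⟩ := geometric_average_le (a := a) (B := 8 * (a ^ 2 * M.variance σ))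
    (q := μ * a / 2)
    (Φ := fun r => ∫ ω, ‖(M.state r ω).model - xs‖ ^ 2 ∂P + 13 * ((N : ℝ) / S) * a ^ 2 *
        (1 / (N : ℝ) * ∑ i, ∫ ω, ‖M.exactControl r i ω - ∇ (f i) xs‖ ^ 2 ∂P))
    (E := fun r => ∫ ω, (objective f (M.state r ω).model - objective f xs) ∂P) ha
    (by positivity) (by linarith [H.ratio_le_one])
    (fun r => by
      have h1 : 0 ≤ ∫ ω, ‖(M.state r ω).model - xs‖ ^ 2 ∂P := integral_nonneg fun ω => by positivity
      have h2 : ∀ i, 0 ≤ ∫ ω, ‖M.exactControl r i ω - ∇ (f i) xs‖ ^ 2 ∂P := fun i =>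
        integral_nonneg fun ω => by positivity
      exact add_nonneg h1 (mul_nonneg (by positivity) (mul_nonneg (by positivity)
        (Finset.sum_nonneg fun i _ => h2 i))))
    hrec (R := R) (by linarith)
  obtain ⟨h1, h2⟩ := integrable_outputLaw (P := P) (x := iterates g S K A Z x₀ c₀ (a / (K * ηg)) ηg)
    R w (fun r => (hM.memLp_model r).1.aemeasurable) (H.continuous_gap xs) (hM.integrable_gap xs)
  refine ⟨a / (K * ηg), hη0, hη, w, hw, h1, hQ _ ?_⟩
  rw [h2]
  refine hle.trans (le_of_eq ?_)
  have h3 : 8 * (a ^ 2 * M.variance σ) / a = 8 * (a * (σ ^ 2 / (K * S) * (1 + S / ηg ^ 2))) := by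
    have : M.variance σ = σ ^ 2 / (K * S) * (1 + S / ηg ^ 2) := rfl
    rw [this]
    generalize σ ^ 2 / (K * S) * (1 + S / ηg ^ 2) = V
    field_simp
  rw [h3]
  congr 1
  have h4 : ∫ ω, ‖(M.state 0 ω).model - xs‖ ^ 2 ∂P = ‖x₀ - xs‖ ^ 2 := by
    change ∫ ω, ‖x₀ - xs‖ ^ 2 ∂P = _
    rw [integral_const, probReal_univ, one_smul]
  have h5 : initPotential P S f x₀ xs h₀ a = ‖x₀ - xs‖ ^ 2 + 13 * ((N : ℝ) / S) * a ^ 2 *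
        (1 / (N : ℝ) * ∑ i, ∫ ω, ‖M.exactControl 0 i ω - ∇ (f i) xs‖ ^ 2 ∂P) := rfl
  rw [h4, ← h5, show μ * a / 2 * (R : ℝ) = μ * a * R / 2 by ring]
  field_simp

theorem nonconvex_output (hg : 1 ≤ ηg) {a : ℝ} (ha : 0 < a) (h₁ : a * β ≤ 1 / 200)
    (h₂ : (a * β) ^ 2 ≤ (S : ℝ) / N / 40000) (h₃ : (a * β) ^ 3 ≤ ((S : ℝ) / N) ^ 2 / 8000000)
    {fs : ℝ} (hfs : ∀ x, fs ≤ objective f x) {R : ℕ} (hR : 1 ≤ R) {ηmax : ℝ}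
    (hη : a / (K * ηg) ≤ ηmax) {Q : ℝ → Prop}
    (hQ : ∀ e ≤ 4 * (objective f x₀ - fs) / (a * R)
      + 32 * (a * (β * (σ ^ 2 / (K * S) * (1 + S / ηg ^ 2)))), Q e) :
    OutputSatisfies P (fun ηl => iterates g S K A Z x₀ (warmStart g K Z x₀) ηl ηg) ηmax R
      (fun x => ‖∇ (objective f) x‖ ^ 2) Q := by
  have hη0 : 0 < a / (K * ηg) := div_pos ha (mul_pos H.K_pos (by linarith))
  have hst := H.step_eq hg a
  have hM := H.method_isValid (x₀ := x₀) (H.isStart_warm x₀) hg hη0 (by rw [hst]; linarith)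
  set M := Method.mk f g S K (a / (K * ηg)) ηg A Z x₀ (warmStart g K Z x₀)
    (fun i _ => ∇ (f i) x₀)
  have hstep : M.step = a := hst
  have hrec := hM.nonconvex_succ_le (fun i ω => rfl) (by rw [hstep]; exact h₁)
    (by rw [hstep]; exact h₂) (by rw [hstep]; exact h₃)
  rw [hstep] at hrec
  have hint : ∀ r, Integrable (fun ω => objective f (M.state r ω).model) P := fun r =>
    integrable_comp_of_memLp (hM.memLp_model r) hM.β_pos.le hM.smooth_objective
  have hβ := H.β_pos
  have hlag : ∀ r, 0 ≤ RoundData.lag P K (M.points r) (fun ω => (M.state r ω).model) := fun r => by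
    have : ∀ i k, 0 ≤ ∫ ω, ‖M.points r i k ω - (M.state r ω).model‖ ^ 2 ∂P := fun i k =>
      integral_nonneg fun ω => by positivity
    unfold RoundData.lag
    positivity
  obtain ⟨hw, hle⟩ := uniform_average_le (a := a / 4) (B := 8 * (β * a ^ 2 * M.variance σ))
    (Φ := fun r => ∫ ω, objective f (M.state r ω).model ∂P - fs + 40 * ((N : ℝ) / S) *
      (β ^ 3 * a ^ 2) * RoundData.lag P K (M.points r) (fun ω => (M.state r ω).model))
    (E := fun r => ∫ ω, ‖∇ (objective f) (M.state r ω).model‖ ^ 2 ∂P) (by positivity)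
    (fun r => by
      have h1 : fs ≤ ∫ ω, objective f (M.state r ω).model ∂P := by
        have := integral_mono (integrable_const fs) (hint r) fun ω => hfs _
        rwa [integral_const, probReal_univ, one_smul] at this
      have h2 := hlag r
      have : 0 ≤ 40 * ((N : ℝ) / S) * (β ^ 3 * a ^ 2) *
        RoundData.lag P K (M.points r) (fun ω => (M.state r ω).model) := by positivity
      linarith)
    (fun r => by
      have h1 : ∫ ω, objective f (M.state (r + 1) ω).model ∂P + 40 * ((N : ℝ) / S) *
        (β ^ 3 * a ^ 2) *
        RoundData.lag P K (M.points (r + 1)) (fun ω => (M.state (r + 1) ω).model)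
        ≤ ∫ ω, objective f (M.state r ω).model ∂P + 40 * ((N : ℝ) / S) *
        (β ^ 3 * a ^ 2) * RoundData.lag P K (M.points r) (fun ω => (M.state r ω).model)
        - a / 4 * ∫ ω, ‖∇ (objective f) (M.state r ω).model‖ ^ 2 ∂P
        + 8 * (β * a ^ 2 * M.variance σ) := hrec r
      linarith) hR
  obtain ⟨h1, h2⟩ := integrable_outputLaw (P := P)
    (x := iterates g S K A Z x₀ (warmStart g K Z x₀) (a / (K * ηg)) ηg)
    R (fun r => if r < R then 1 else 0)
    (fun r => (hM.memLp_model r).1.aemeasurable) H.continuous_gradient_sq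
    hM.integrable_gradient_sq
  refine ⟨a / (K * ηg), hη0, hη, fun r => if r < R then 1 else 0, hw, h1, hQ _ ?_⟩
  rw [h2]
  refine hle.trans (le_of_eq ?_)
  have h3 : 8 * (β * a ^ 2 * M.variance σ) / (a / 4)
      = 32 * (a * (β * (σ ^ 2 / (K * S) * (1 + S / ηg ^ 2)))) := by
    have : M.variance σ = σ ^ 2 / (K * S) * (1 + S / ηg ^ 2) := rfl
    rw [this]
    generalize σ ^ 2 / (K * S) * (1 + S / ηg ^ 2) = V
    field_simp
    ring
  have h4 : ∫ ω, objective f (M.state 0 ω).model ∂P = objective f x₀ := by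
    change ∫ ω, objective f x₀ ∂P = _
    rw [integral_const, probReal_univ, one_smul]
  have h5 : RoundData.lag P K (M.points 0) (fun ω => (M.state 0 ω).model) = 0 := by
    change RoundData.lag P K (fun _ _ _ => x₀) (fun _ => x₀) = 0
    simp [RoundData.lag]
  rw [h3, h4, h5, mul_zero, add_zero]
  have hR' : (0 : ℝ) < R := by exact_mod_cast hR
  field_simp

end Setting

/-! ### The rates. -/

namespace Setting

variable {d N S K : ℕ} {Ω Ξ : Type*} [mΩ : MeasurableSpace Ω] [MeasurableSpace Ξ]
  {P : Measure Ω} [IsProbabilityMeasure P] {ν : Fin N → Measure Ξ}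
  [∀ i, IsProbabilityMeasure (ν i)] {A : ℕ → Ω → Finset (Fin N)} {Z : ℕ → Fin N → ℕ → Ω → Ξ}
  {f : Fin N → Vec d → ℝ} {g : Fin N → Vec d → Ξ → Vec d} {β σ : ℝ} {x₀ : Vec d} {ηg : ℝ}
  (H : Setting P S K ν A Z f g β σ)
include H

theorem initDistSq_nonneg (xs : Vec d) (c₀ : Fin N → Vec d) : 0 ≤ initDistSq f β x₀ xs c₀ := by
  have := H.β_pos
  unfold initDistSq
  positivity

/-- The weight N/S of the control error is damped by (aβ)². With ρ = 1 the factor N/S remains, which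
is harmless in front of an exponential; with ρ = S/N it disappears at the price of a smaller step.
-/
theorem initPotential_const_le {a : ℝ} {ρ : ℝ} (hρ : (a * β) ^ 2 ≤ ρ / 6561) (xs : Vec d)
    (c₀ : Fin N → Vec d) : initPotential P S f x₀ xs (fun i _ => c₀ i) a
      ≤ ‖x₀ - xs‖ ^ 2 + (N : ℝ) / S * ρ * (initDistSq f β x₀ xs c₀ - ‖x₀ - xs‖ ^ 2) := by
  have hβ := H.β_pos
  have hN := H.N_pos
  have hS := H.S_pos
  have h1 : initPotential P S f x₀ xs (fun i _ => c₀ i) a = ‖x₀ - xs‖ ^ 2 +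
      26 * ((N : ℝ) / S) * (a * β) ^ 2 * (initDistSq f β x₀ xs c₀ - ‖x₀ - xs‖ ^ 2) := by
    unfold initPotential initDistSq
    simp only [integral_const, probReal_univ, one_smul]
    generalize ∑ i, ‖c₀ i - ∇ (f i) xs‖ ^ 2 = u
    field_simp
    ring
  have h2 : 0 ≤ initDistSq f β x₀ xs c₀ - ‖x₀ - xs‖ ^ 2 := by
    unfold initDistSq
    rw [add_sub_cancel_left]
    positivity
  rw [h1]
  have h3 : (N : ℝ) / S * (26 * (a * β) ^ 2) ≤ (N : ℝ) / S * ρ := by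
    gcongr
    nlinarith [sq_nonneg (a * β)]
  have h4 := mul_le_mul_of_nonneg_right h3 h2
  linarith

theorem initPotential_const_le_of_le {a : ℝ} (ha : 0 ≤ a) (haβ : a * β ≤ 1 / 81) (xs : Vec d)
    (c₀ : Fin N → Vec d) : initPotential P S f x₀ xs (fun i _ => c₀ i) a
      ≤ (N : ℝ) / S * initDistSq f β x₀ xs c₀ := by
  have hβ := H.β_pos
  have h1 := H.initPotential_const_le (x₀ := x₀) (a := a) (ρ := 1) (by nlinarith [mul_nonneg ha hβ.le]) xs c₀
  have h2 := mul_le_mul_of_nonneg_right H.one_le_inv_ratio (sq_nonneg ‖x₀ - xs‖)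
  linarith

theorem initPotential_const_le_of_sq_le {a : ℝ} (ha : (a * β) ^ 2 ≤ (S : ℝ) / N / 6561)
    (xs : Vec d) (c₀ : Fin N → Vec d) : initPotential P S f x₀ xs (fun i _ => c₀ i) a
      ≤ initDistSq f β x₀ xs c₀ := by
  have hN := H.N_pos
  have hS := H.S_pos
  have h1 := H.initPotential_const_le (x₀ := x₀) ha xs c₀
  have h2 : (N : ℝ) / S * (S / N) = 1 := by field_simp
  rw [h2] at h1
  linarith

theorem initPotential_warm_eq (a : ℝ) (xs : Vec d) :
    initPotential P S f x₀ xs (fun i (_ : Ω) => ∇ (f i) x₀) a = ‖x₀ - xs‖ ^ 2 +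
      13 * ((N : ℝ) / S) * a ^ 2 * (1 / (N : ℝ) * ∑ i, ‖∇ (f i) x₀ - ∇ (f i) xs‖ ^ 2) := by
  unfold initPotential
  simp only [integral_const, probReal_univ, one_smul]

/-- After a warm start smoothness bounds the control error by β²‖x₀ - xs‖², so the initial potential
no longer involves the control variates. -/
theorem initPotential_warm_le {a : ℝ} (ha : 0 ≤ a) (haβ : a * β ≤ 1 / 81) (xs : Vec d) :
    initPotential P S f x₀ xs (fun i (_ : Ω) => ∇ (f i) x₀) a
      ≤ 2 * ((N : ℝ) / S * ‖x₀ - xs‖ ^ 2) := by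
  have hβ := H.β_pos
  have hN := H.N_pos
  have hS := H.S_pos
  rw [H.initPotential_warm_eq]
  have h1 : 1 / (N : ℝ) * ∑ i, ‖∇ (f i) x₀ - ∇ (f i) xs‖ ^ 2 ≤ (β * ‖x₀ - xs‖) ^ 2 := by
    calc 1 / (N : ℝ) * ∑ i, ‖∇ (f i) x₀ - ∇ (f i) xs‖ ^ 2
        ≤ 1 / (N : ℝ) * ∑ i : Fin N, (β * ‖x₀ - xs‖) ^ 2 := by
          gcongr with i
          exact (H.smooth i).2 x₀ xs
      _ = (β * ‖x₀ - xs‖) ^ 2 := by simp; field_simp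
  have h2 : 13 * (a * β) ^ 2 ≤ 1 := by nlinarith [mul_nonneg ha hβ.le]
  have h3 := mul_le_mul_of_nonneg_right H.one_le_inv_ratio (sq_nonneg ‖x₀ - xs‖)
  have h4 := mul_le_mul_of_nonneg_left h1 (by positivity : 0 ≤ 13 * ((N : ℝ) / S) * a ^ 2)
  have h5 := mul_le_mul_of_nonneg_right h2 (by positivity : 0 ≤ (N : ℝ) / S * ‖x₀ - xs‖ ^ 2)
  have h6 : 13 * ((N : ℝ) / S) * a ^ 2 * (β * ‖x₀ - xs‖) ^ 2
    = 13 * (a * β) ^ 2 * ((N : ℝ) / S * ‖x₀ - xs‖ ^ 2) := by ring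
  linarith

/-- Co-coercivity bounds the initial control error by the initial gap instead; this produces the
term NF/(Sε) in the number of rounds. -/
theorem initPotential_warm_le_of_convex (a : ℝ) {xs : Vec d} (hc : ∀ i, IsMuConvex 0 (f i))
    (hxs : ∀ x, objective f xs ≤ objective f x) :
    initPotential P S f x₀ xs (fun i (_ : Ω) => ∇ (f i) x₀) a
      ≤ ‖x₀ - xs‖ ^ 2 + 26 * ((N : ℝ) / S) * a ^ 2 * (β * (objective f x₀ - objective f xs)) := by
  rw [H.initPotential_warm_eq]
  have h1 := average_norm_gradient_sub_sq_le H.β_pos H.smooth hc hxs x₀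
  have h4 := mul_le_mul_of_nonneg_left h1 (by positivity : 0 ≤ 13 * ((N : ℝ) / S) * a ^ 2)
  linarith

theorem local_step_le {a b : ℝ} (hg : 1 ≤ ηg) (h : a ≤ b) : a / (K * ηg) ≤ b / (K * ηg) := by
  have := H.K_pos
  have : 0 < ηg := by linarith
  gcongr

theorem one_le_sqrt_S : 1 ≤ √(S : ℝ) := by
  rw [Real.one_le_sqrt]
  exact_mod_cast H.one_le_S

theorem variance_sqrt_S : σ ^ 2 / (K * S) * (1 + S / √(S : ℝ) ^ 2) = 2 * (σ ^ 2 / (K * S)) := by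
  have := H.S_pos
  rw [Real.sq_sqrt this.le, div_self this.ne']
  ring

theorem sqrt_variance (hg : 1 ≤ ηg) {F : ℝ} (hF : 0 ≤ F) {R : ℕ} (hR : 1 ≤ R) :
    √(F * (σ ^ 2 / (K * S) * (1 + S / ηg ^ 2)) / R)
      = σ * √F / √(R * K * S) * √(1 + S / ηg ^ 2) := by
  have hK := H.K_pos
  have hS := H.S_pos
  have hR' : (0 : ℝ) < R := by exact_mod_cast hR
  rw [show F * (σ ^ 2 / (K * S) * (1 + S / ηg ^ 2)) / R
    = σ ^ 2 * F / (R * K * S) * (1 + S / ηg ^ 2) by field_simp,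
    Real.sqrt_mul (by positivity), Real.sqrt_div (by positivity), Real.sqrt_mul (by positivity),
    Real.sqrt_sq H.σ_nonneg]

/-- The step is the smaller of the largest admissible one, `a₀`, and `a₁`, of order L/(μR). At `a₀`
the exponential is the stated one; at `a₁` the exponential is already below the noise term. -/
theorem strongly_convex_error {μ : ℝ} {xs : Vec d} (hμ : 0 < μ) (hc : ∀ i, IsMuConvex μ (f i))
    (hxs : ∀ x, objective f xs ≤ objective f x) (c₀ : Fin N → Vec d) (R : ℕ) (hg : 1 ≤ ηg)
    (hR : max (162 * β / μ) (30 * N / S) ≤ (R : ℝ)) :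
    OutputSatisfies P (fun ηl => iterates g S K A Z x₀ (fun i _ => c₀ i) ηl ηg)
      (min (1 / (81 * β * K * ηg)) (S / (15 * μ * N * K * ηg))) R
      (fun x => objective f x - objective f xs)
      (fun e => e ≤ 10000 * (σ ^ 2 / (μ * R * K * S) * (1 + S / ηg ^ 2) *
        Real.log (Real.exp 1 + μ ^ 2 * R * N * K * initDistSq f β x₀ xs c₀ / σ ^ 2) +
        N * μ / S * initDistSq f β x₀ xs c₀ *
          Real.exp (-(min ((S : ℝ) / (30 * N)) (μ / (162 * β)) * R)))) := by
  have hβ := H.β_pos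
  have hN := H.N_pos
  have hS := H.S_pos
  have hK := H.K_pos
  have hg0 : 0 < ηg := by linarith
  have hD := H.initDistSq_nonneg (x₀ := x₀) xs c₀
  set D := initDistSq f β x₀ xs c₀
  obtain ⟨hR1, hR2⟩ := max_le_iff.1 hR
  rw [div_le_iff₀ hμ] at hR1
  rw [div_le_iff₀ hS] at hR2
  have hR0 : (0 : ℝ) < R := by
    rcases (Nat.cast_nonneg R : (0 : ℝ) ≤ R).eq_or_lt with h | h
    · rw [← h] at hR1; linarith
    · exact h
  set X := μ ^ 2 * R * N * K * D / σ ^ 2 with hX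
  have hX0 : 0 ≤ X := by positivity
  set L := Real.log (Real.exp 1 + X) with hL
  have hL1 : 1 ≤ L := by
    rw [hL, Real.le_log_iff_exp_le (by positivity)]
    linarith
  set a₀ := min (1 / (81 * β)) ((S : ℝ) / N / (15 * μ)) with ha₀def
  have ha₀ : 0 < a₀ := lt_min (by positivity) (by positivity)
  have hmin : min ((S : ℝ) / (30 * N)) (μ / (162 * β)) = μ * a₀ / 2 := by
    rw [ha₀def, mul_min_of_nonneg _ _ hμ.le, ← min_div_div_right (by norm_num), min_comm]
    congr 1 <;> · field_simp; norm_num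
  have ha₀R : 2 ≤ μ * a₀ * R := by
    have : 1 ≤ μ * a₀ / 2 * R := by
      rw [← hmin, min_mul_of_nonneg _ _ hR0.le]
      refine le_min ?_ ?_
      · rw [div_mul_eq_mul_div, le_div_iff₀ (by positivity)]; linarith
      · rw [div_mul_eq_mul_div, le_div_iff₀ (by positivity)]; linarith
    linarith
  rw [hmin]
  set V := σ ^ 2 / (K * S) * (1 + S / ηg ^ 2) with hV
  have hV0 : 0 ≤ V := by positivity
  have hfirst : σ ^ 2 / (μ * R * K * S) * (1 + S / ηg ^ 2) = V / (μ * R) := by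
    rw [hV]; field_simp
  rw [hfirst]
  have key : ∀ a, 0 < a → a ≤ a₀ → 2 ≤ μ * a * R →
      μ * ((N : ℝ) / S * D) * Real.exp (-(μ * a * R / 2)) + 8 * (a * V)
        ≤ 10000 * (V / (μ * R) * L + N * μ / S * D * Real.exp (-(μ * a₀ / 2 * R))) →
      OutputSatisfies P (fun ηl => iterates g S K A Z x₀ (fun i _ => c₀ i) ηl ηg)
      (min (1 / (81 * β * K * ηg)) (S / (15 * μ * N * K * ηg))) R
      (fun x => objective f x - objective f xs)
      (fun e => e ≤ 10000 * (V / (μ * R) * L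
        + N * μ / S * D * Real.exp (-(μ * a₀ / 2 * R)))) := by
    intro a ha haa haR hle
    have h1 := haa.trans (min_le_left _ _)
    have h2 := haa.trans (min_le_right _ _)
    have haβ : a * β ≤ 1 / 81 := by
      rw [le_div_iff₀ (by positivity)] at h1
      linarith
    refine H.strongly_convex_output (H.isStart_const c₀) hg ha hμ haβ ?_ hc hxs haR ?_ ?_
    · rw [le_div_iff₀ (by positivity)] at h2
      linarith
    · refine le_min ((H.local_step_le hg h1).trans (le_of_eq ?_))
        ((H.local_step_le hg h2).trans (le_of_eq ?_)) <;> field_simp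
    · intro e he
      refine he.trans (le_trans ?_ hle)
      have := H.initPotential_const_le_of_le (x₀ := x₀) ha.le haβ xs c₀
      gcongr
  have hE : 0 ≤ N * μ / S * D * Real.exp (-(μ * a₀ / 2 * R)) := by positivity
  have hVL : 0 ≤ V / (μ * R) * L := by positivity
  have hfull : 8 * (a₀ * V) ≤ 16 * (V / (μ * R) * L) → μ * ((N : ℝ) / S * D) *
      Real.exp (-(μ * a₀ * R / 2)) + 8 * (a₀ * V)
        ≤ 10000 * (V / (μ * R) * L + N * μ / S * D * Real.exp (-(μ * a₀ / 2 * R))) := by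
    intro h
    have e1 : μ * ((N : ℝ) / S * D) * Real.exp (-(μ * a₀ * R / 2))
        = N * μ / S * D * Real.exp (-(μ * a₀ / 2 * R)) := by
      rw [show μ * a₀ * R / 2 = μ * a₀ / 2 * R by ring]
      ring
    rw [e1]
    linarith
  rcases H.σ_nonneg.eq_or_lt with hσ | hσ
  -- For σ = 0 the quotient X is 0 by division by zero, and V = 0: the noise term vanishes and the
  -- largest step is taken.
  · have hV' : V = 0 := by rw [hV, ← hσ]; simp
    exact key a₀ ha₀ le_rfl ha₀R (hfull (by rw [hV']; simp))
  -- Chosen so that exp(-μa₁R/2) = 1/(e + X), where X is the initial error in units of the noise.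
  set a₁ := 2 * L / (μ * R) with ha₁
  have ha₁V : 8 * (a₁ * V) = 16 * (V / (μ * R) * L) := by rw [ha₁]; field_simp; ring
  rcases le_total a₀ a₁ with h | h
  · refine key a₀ ha₀ le_rfl ha₀R (hfull ?_)
    rw [← ha₁V]
    gcongr
  · have hm : μ * a₁ * R = 2 * L := by rw [ha₁]; field_simp
    refine key a₁ (by positivity) h (by rw [hm]; linarith) ?_
    have e1 : Real.exp (-(μ * a₁ * R / 2)) = (Real.exp 1 + X)⁻¹ := by
      rw [hm, mul_div_cancel_left₀ _ (two_ne_zero), Real.exp_neg, hL, Real.exp_log (by positivity)]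
    have e2 : μ * ((N : ℝ) / S * D) * (Real.exp 1 + X)⁻¹ ≤ V / (μ * R) * L := by
      rw [← div_eq_mul_inv, div_le_iff₀ (by positivity)]
      have e3 : μ * ((N : ℝ) / S * D) = σ ^ 2 / (K * S) / (μ * R) * X := by
        rw [hX]; field_simp
      have e4 : σ ^ 2 / (K * S) ≤ V := by
        rw [hV]
        exact le_mul_of_one_le_right (by positivity) (by
          have : 0 ≤ S / ηg ^ 2 := by positivity
          linarith)
      rw [e3]
      calc σ ^ 2 / (K * S) / (μ * R) * X ≤ V / (μ * R) * (Real.exp 1 + X) := by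
            gcongr
            linarith [Real.exp_pos 1]
        _ ≤ V / (μ * R) * L * (Real.exp 1 + X) := by
            gcongr
            exact le_mul_of_one_le_right (by positivity) hL1
    rw [e1, ha₁V]
    linarith

theorem strongly_convex_rounds {μ : ℝ} {xs : Vec d} (hμ : 0 < μ) (hc : ∀ i, IsMuConvex μ (f i))
    (hxs : ∀ x, objective f xs ≤ objective f x) {ε : ℝ} (R : ℕ) (hε : 0 < ε)
    (hR : 10000 * (σ ^ 2 / (μ * K * S * ε) + β / μ + N / S) *
      Real.log (Real.exp 1 + N * μ * ‖x₀ - xs‖ ^ 2 / (S * ε)) ≤ R) :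
    OutputSatisfies P (fun ηl => iterates g S K A Z x₀ (warmStart g K Z x₀) ηl √S)
      (min (1 / (81 * β * K * √S)) (S / (15 * μ * N * K * √S))) R
      (fun x => objective f x - objective f xs) (fun e => e < ε) := by
  have hβ := H.β_pos
  have hN := H.N_pos
  have hS := H.S_pos
  have hK := H.K_pos
  have hg := H.one_le_sqrt_S
  have hg0 : 0 < √(S : ℝ) := by linarith
  set t := N * μ * ‖x₀ - xs‖ ^ 2 / (S * ε) with ht
  have ht0 : 0 ≤ t := by positivity
  set L := Real.log (Real.exp 1 + t) with hL
  have hL1 : 1 ≤ L := by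
    rw [hL, Real.le_log_iff_exp_le (by positivity)]
    linarith
  set V := σ ^ 2 / (μ * K * S * ε) with hV
  have hV0 : 0 ≤ V := by positivity
  have hρ := H.one_le_inv_ratio
  -- 1/(μW) is the step: each summand of W enforces one restriction, namely noise at most ε/4, aβ ≤
  -- 1/81, and μa ≤ S/(15N).
  set W := 64 * V + 81 * (β / μ) + 81 * ((N : ℝ) / S) with hW
  have hβμ : 0 < β / μ := by positivity
  have hW0 : 0 < W := by positivity
  set a := 1 / (μ * W) with ha
  have ha0 : 0 < a := by positivity
  have hμa : μ * a = 1 / W := by rw [ha]; field_simp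
  have hβW : 81 * β ≤ μ * W := by
    rw [hW]
    have : μ * (β / μ) = β := by field_simp
    nlinarith [mul_nonneg hμ.le hV0, mul_nonneg hμ.le (zero_le_one.trans hρ)]
  have ha1 : a ≤ 1 / (81 * β) := one_div_le_one_div_of_le (by positivity) hβW
  have haβ : a * β ≤ 1 / 81 := by
    rw [le_div_iff₀ (by positivity)] at ha1
    linarith
  have ha2 : μ * a ≤ (S : ℝ) / N / 15 := by
    rw [hμa, div_le_div_iff₀ hW0 (by norm_num), one_mul]
    have e1 : (S : ℝ) / N * W ≥ (S : ℝ) / N * (81 * ((N : ℝ) / S)) := by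
      apply mul_le_mul_of_nonneg_left _ H.ratio_pos.le
      rw [hW]; linarith
    have e2 : (S : ℝ) / N * (81 * ((N : ℝ) / S)) = 81 := by field_simp
    linarith
  have hRW : 4 * L * W ≤ R := by
    refine le_trans ?_ hR
    rw [hW]
    have : 4 * (64 * V + 81 * (β / μ) + 81 * ((N : ℝ) / S)) ≤ 10000 * (V + β / μ + N / S) := by
      linarith
    linarith [mul_le_mul_of_nonneg_right this (zero_le_one.trans hL1)]
  have hμaR : 4 * L ≤ μ * a * R := by
    rw [hμa, div_mul_eq_mul_div, le_div_iff₀ hW0]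
    linarith
  refine H.strongly_convex_output (H.isStart_warm x₀) hg ha0 hμ haβ ha2 hc hxs (by linarith) ?_ ?_
  · refine le_min ((H.local_step_le hg ha1).trans (le_of_eq ?_))
      ((H.local_step_le hg (b := (S : ℝ) / N / 15 / μ) ?_).trans (le_of_eq ?_))
    · field_simp
    · rw [le_div_iff₀ hμ]; linarith
    · field_simp
  · intro e he
    rw [H.variance_sqrt_S] at he
    refine lt_of_le_of_lt he ?_
    -- The number of rounds is large enough for the square of 1/(e + t). A single power would only
    -- bound the initial error by a multiple of ε; with the square, t/(e + t)² ≤ 1/8 makes it at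
    -- most ε/4.
    have e1 : Real.exp (-(μ * a * R / 2)) ≤ ((Real.exp 1 + t)⁻¹) ^ 2 := by
      have : ((Real.exp 1 + t)⁻¹) ^ 2 = Real.exp (-(2 * L)) := by
        rw [← Real.exp_log (show 0 < Real.exp 1 + t by positivity), ← hL, ← Real.exp_neg,
          ← Real.exp_nat_mul]
        congr 1
        push_cast
        ring
      rw [this]
      exact Real.exp_le_exp.2 (by linarith)
    have e2 := H.initPotential_warm_le (x₀ := x₀) ha0.le haβ xs
    have e3 : μ * (2 * ((N : ℝ) / S * ‖x₀ - xs‖ ^ 2)) = 2 * ε * t := by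
      rw [ht]; field_simp
    have e4 : t * ((Real.exp 1 + t)⁻¹) ^ 2 ≤ 1 / 8 := by
      rw [inv_pow, ← div_eq_mul_inv, div_le_div_iff₀ (by positivity) (by norm_num)]
      have h2 : 2 ≤ Real.exp 1 := by linarith [Real.add_one_le_exp (1 : ℝ)]
      nlinarith [sq_nonneg (Real.exp 1 - t)]
    have e5 : 8 * (a * (2 * (σ ^ 2 / (K * S)))) ≤ ε / 4 := by
      have h1 : σ ^ 2 / (K * S) = μ * ε * V := by rw [hV]; field_simp
      have h2 : 8 * (a * (2 * (μ * ε * V))) = 16 * ε * V * (μ * a) := by ring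
      rw [h1, h2, hμa, mul_one_div, div_le_div_iff₀ hW0 (by norm_num), hW]
      have h3 : 0 ≤ ε * (81 * (β / μ) + 81 * ((N : ℝ) / S)) := by positivity
      linarith
    have e6 : μ * initPotential P S f x₀ xs (fun i _ => ∇ (f i) x₀) a *
        Real.exp (-(μ * a * R / 2)) ≤ 2 * ε * t * ((Real.exp 1 + t)⁻¹) ^ 2 := by
      rw [← e3]
      gcongr
    have e7 := mul_le_mul_of_nonneg_left e4 (by positivity : 0 ≤ 2 * ε)
    linarith

theorem convex_error {xs : Vec d} (hc : ∀ i, IsMuConvex 0 (f i))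
    (hxs : ∀ x, objective f xs ≤ objective f x) (c₀ : Fin N → Vec d) {R : ℕ} (hg : 1 ≤ ηg)
    (hR : 1 ≤ R) :
    OutputSatisfies P (fun ηl => iterates g S K A Z x₀ (fun i _ => c₀ i) ηl ηg)
      (1 / (81 * β * K * ηg)) R (fun x => objective f x - objective f xs)
      (fun e => e ≤ 10000 * (σ * √(initDistSq f β x₀ xs c₀) / √(R * K * S) * √(1 + S / ηg ^ 2) +
        √(N / S) * (β * initDistSq f β x₀ xs c₀ / R))) := by
  have hβ := H.β_pos
  have hN := H.N_pos
  have hS := H.S_pos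
  have hK := H.K_pos
  have hσ := H.σ_nonneg
  have hg0 : 0 < ηg := by linarith
  have hR0 : (0 : ℝ) < R := by exact_mod_cast hR
  have hD := H.initDistSq_nonneg (x₀ := x₀) xs c₀
  -- For D̃ = 0 the bound is 0, but x₀ is the minimizer itself, and the output is taken to be x₀.
  -- The balancing of the step needs a positive initial error.
  rcases hD.eq_or_lt with hD0 | hD0
  · refine H.start_gap (H.isStart_const c₀) hg (by positivity) ?_ R ?_
    · have : K * (1 / (81 * β * K * ηg)) * ηg * β = 1 / 81 := by field_simp
      rw [this]; norm_num
    · have h1 : x₀ - xs = 0 := by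
        rw [← norm_eq_zero, ← sq_eq_zero_iff]
        refine le_antisymm ?_ (by positivity)
        rw [hD0, initDistSq]
        exact le_add_of_nonneg_right (by positivity)
      rw [← hD0, sub_eq_zero.1 h1]
      simp
  set D := initDistSq f β x₀ xs c₀
  set s := √((S : ℝ) / N) with hs
  have hs0 : 0 < s := Real.sqrt_pos.2 H.ratio_pos
  have hs2 : s ^ 2 = (S : ℝ) / N := Real.sq_sqrt H.ratio_pos.le
  have hs1 : s ≤ 1 := Real.sqrt_le_one.2 H.ratio_le_one
  have hsinv : √((N : ℝ) / S) = 1 / s := by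
    rw [hs, ← inv_div, Real.sqrt_inv, one_div]
  set V := σ ^ 2 / (K * S) * (1 + S / ηg ^ 2) with hV
  -- The cap is smaller than the admissible step by √(S/N), so that the initial potential is at most
  -- D̃²; this is the origin of √(N/S) in the bound.
  obtain ⟨a, ha, haa, hle⟩ := exists_step_le (F := D) (V := V) (c := 8) (R := R)
    (a₀ := s / (81 * β)) hD0 (by positivity) (by norm_num) hR0 (by positivity)
  have haβ' : a * β ≤ s / 81 := by
    rw [le_div_iff₀ (by positivity)] at haa
    linarith
  refine H.convex_output (H.isStart_const c₀) hg ha (by linarith) hc hxs hR ?_ ?_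
  · refine (H.local_step_le hg (b := 1 / (81 * β)) (haa.trans (by gcongr))).trans (le_of_eq ?_)
    field_simp
  · intro e he
    have h1 : (a * β) ^ 2 ≤ (S : ℝ) / N / 6561 := by
      rw [← hs2]
      have := pow_le_pow_left₀ (by positivity) haβ' 2
      linarith [show (s / 81) ^ 2 = s ^ 2 / 6561 by ring]
    have h2 := H.initPotential_const_le_of_sq_le (x₀ := x₀) h1 xs c₀
    have h3 : initPotential P S f x₀ xs (fun i _ => c₀ i) a / (a * R) ≤ D / (a * R) := by gcongr
    have h4 := H.sqrt_variance hg hD hR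
    rw [← hV] at h4
    have h5 : D / (s / (81 * β) * R) = 81 * (1 / s * (β * D / R)) := by field_simp
    rw [hsinv, ← h4]
    rw [h5] at hle
    have h6 : 0 ≤ 1 / s * (β * D / R) := by positivity
    have h7 := Real.sqrt_nonneg (D * V / R)
    linarith

theorem convex_rounds {xs : Vec d} (hc : ∀ i, IsMuConvex 0 (f i))
    (hxs : ∀ x, objective f xs ≤ objective f x) {ε : ℝ} (R : ℕ) (hε : 0 < ε)
    (hR : 10000 * (σ ^ 2 * ‖x₀ - xs‖ ^ 2 / (K * S * ε ^ 2) + β * ‖x₀ - xs‖ ^ 2 / ε +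
      N * (objective f x₀ - objective f xs) / (S * ε)) ≤ R) :
    OutputSatisfies P (fun ηl => iterates g S K A Z x₀ (warmStart g K Z x₀) ηl √S)
      (1 / (81 * β * K * √S)) R (fun x => objective f x - objective f xs) (fun e => e < ε) := by
  have hβ := H.β_pos
  have hN := H.N_pos
  have hS := H.S_pos
  have hK := H.K_pos
  have hg := H.one_le_sqrt_S
  have hg0 : 0 < √(S : ℝ) := by linarith
  rcases (norm_nonneg (x₀ - xs)).eq_or_lt with hD0 | hD0
  · refine H.start_gap (H.isStart_warm x₀) hg (by positivity) ?_ R ?_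
    · have : K * (1 / (81 * β * K * √(S : ℝ))) * √(S : ℝ) * β = 1 / 81 := by field_simp
      rw [this]; norm_num
    · rw [sub_eq_zero.1 (norm_eq_zero.1 hD0.symm), sub_self]
      exact hε
  have hF : 0 ≤ objective f x₀ - objective f xs := sub_nonneg.2 (hxs x₀)
  have h0 : 0 < β * ‖x₀ - xs‖ ^ 2 / ε := by positivity
  have h1 : 0 ≤ σ ^ 2 * ‖x₀ - xs‖ ^ 2 / (K * S * ε ^ 2) := by positivity
  have h2 : 0 ≤ N * (objective f x₀ - objective f xs) / (S * ε) := by positivity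
  have hR0 : (0 : ℝ) < R := by linarith
  have hR1 : 1 ≤ R := by exact_mod_cast hR0
  set V := σ ^ 2 / (K * S * ε) with hV
  have hV0 : 0 ≤ V := by positivity
  -- The step 1/W respects aβ ≤ 1/81 and keeps the noise below ε/4.
  set W := 81 * β + 64 * V with hW
  have hW0 : 0 < W := by positivity
  have ha1 : 1 / W ≤ 1 / (81 * β) := one_div_le_one_div_of_le (by positivity) (by linarith)
  have haβ : 1 / W * β ≤ 1 / 81 := by
    rw [le_div_iff₀ (by positivity)] at ha1
    linarith
  refine H.convex_output (H.isStart_warm x₀) hg (a := 1 / W) (by positivity) haβ hc hxs hR1 ?_ ?_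
  · refine (H.local_step_le hg ha1).trans (le_of_eq ?_)
    field_simp
  · intro e he
    rw [H.variance_sqrt_S] at he
    refine lt_of_le_of_lt he ?_
    have e1 := H.initPotential_warm_le_of_convex (x₀ := x₀) (1 / W) hc hxs
    set F := objective f x₀ - objective f xs
    set D := ‖x₀ - xs‖ with hD
    have e2 : 8 * (1 / W * (2 * (σ ^ 2 / (K * S)))) ≤ ε / 4 := by
      have h1 : σ ^ 2 / (K * S) = ε * V := by rw [hV]; field_simp
      rw [h1, show 8 * (1 / W * (2 * (ε * V))) = 16 * ε * V / W by ring,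
        div_le_div_iff₀ hW0 (by norm_num), hW]
      nlinarith [mul_pos hε hβ]
    have e3 : initPotential P S f x₀ xs (fun i _ => ∇ (f i) x₀) (1 / W) / (1 / W * R)
        ≤ ε / 4 := by
      rw [div_le_iff₀ (by positivity)]
      refine e1.trans ?_
      have e4 : 26 * ((N : ℝ) / S) * (1 / W) ^ 2 * (β * F)
          ≤ (N : ℝ) / S * F * (1 / W) := by
        have := mul_le_mul_of_nonneg_right haβ
          (by positivity : 0 ≤ 26 * ((N : ℝ) / S) * (1 / W) * F)
        have h3 : 0 ≤ (N : ℝ) / S * F * (1 / W) := by positivity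
        linarith
      have e5 : D ^ 2 + (N : ℝ) / S * F * (1 / W)
          = (W * D ^ 2 + (N : ℝ) / S * F) * (1 / W) := by field_simp
      have e6 : W * D ^ 2 + (N : ℝ) / S * F = ε * (81 * (β * D ^ 2 / ε)
          + 64 * (σ ^ 2 * D ^ 2 / (K * S * ε ^ 2)) + N * F / (S * ε)) := by
        rw [hW, hV]; field_simp
      have e7 : 81 * (β * D ^ 2 / ε) + 64 * (σ ^ 2 * D ^ 2 / (K * S * ε ^ 2))
          + N * F / (S * ε) ≤ R / 4 := by linarith
      calc D ^ 2 + 26 * ((N : ℝ) / S) * (1 / W) ^ 2 * (β * F)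
          ≤ (W * D ^ 2 + (N : ℝ) / S * F) * (1 / W) := by linarith
        _ ≤ ε * (R / 4) * (1 / W) := by
            rw [e6]; gcongr
        _ = ε / 4 * (1 / W * R) := by ring
    linarith

/-- For p = (S/N)^(2/3) one has p³ = (S/N)² and, as S ≤ N, also p² ≤ S/N. So a single bound on aβ
yields all three conditions of the recursion, the cubic one being the binding one. -/
theorem nonconvex_step {a : ℝ} (ha : 0 ≤ a) (h : a * β ≤ ((S : ℝ) / N) ^ (2 / 3 : ℝ) / 200) :
    a * β ≤ 1 / 200 ∧ (a * β) ^ 2 ≤ (S : ℝ) / N / 40000 ∧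
      (a * β) ^ 3 ≤ ((S : ℝ) / N) ^ 2 / 8000000 := by
  have hρ := H.ratio_pos
  have hρ1 := H.ratio_le_one
  have hβ := H.β_pos
  set p := ((S : ℝ) / N) ^ (2 / 3 : ℝ) with hp
  have hp0 : 0 < p := Real.rpow_pos_of_pos hρ _
  have hp1 : p ≤ 1 := Real.rpow_le_one hρ.le hρ1 (by norm_num)
  have hp3 : p ^ 3 = ((S : ℝ) / N) ^ 2 := by
    rw [hp, ← Real.rpow_natCast, ← Real.rpow_mul hρ.le, ← Real.rpow_natCast]
    norm_num
  have hp2 : p ^ 2 ≤ (S : ℝ) / N := by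
    have h1 : p ^ 2 = ((S : ℝ) / N) ^ (4 / 3 : ℝ) := by
      rw [hp, ← Real.rpow_natCast, ← Real.rpow_mul hρ.le]
      norm_num
    rw [h1]
    calc ((S : ℝ) / N) ^ (4 / 3 : ℝ) ≤ ((S : ℝ) / N) ^ (1 : ℝ) :=
          Real.rpow_le_rpow_of_exponent_ge hρ hρ1 (by norm_num)
      _ = (S : ℝ) / N := Real.rpow_one _
  have h0 : 0 ≤ a * β := mul_nonneg ha hβ.le
  refine ⟨by linarith, ?_, ?_⟩
  · have := pow_le_pow_left₀ h0 h 2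
    linarith [show (p / 200) ^ 2 = p ^ 2 / 40000 by ring]
  · have := pow_le_pow_left₀ h0 h 3
    linarith [show (p / 200) ^ 3 = p ^ 3 / 8000000 by ring]

theorem inv_ratio_rpow : ((N : ℝ) / S) ^ (2 / 3 : ℝ) = 1 / ((S : ℝ) / N) ^ (2 / 3 : ℝ) := by
  rw [← inv_div, Real.inv_rpow H.ratio_pos.le, one_div]

theorem gradient_eq_zero_of_eq {fs : ℝ} (hfs : ∀ x, fs ≤ objective f x)
    (h : 0 = objective f x₀ - fs) : ∇ (objective f) x₀ = 0 :=
  gradient_eq_zero_of_forall_le fun y => by linarith [hfs y]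

theorem nonconvex_max_step (hg : 1 ≤ ηg) :
    0 < 1 / (24 * K * ηg * β) * ((S : ℝ) / N) ^ (2 / 3 : ℝ) ∧
      2 * (K * (1 / (24 * K * ηg * β) * ((S : ℝ) / N) ^ (2 / 3 : ℝ)) * ηg * β) ≤ 1 := by
  have hβ := H.β_pos
  have hK := H.K_pos
  have hg0 : 0 < ηg := by linarith
  have hp0 : 0 < ((S : ℝ) / N) ^ (2 / 3 : ℝ) := Real.rpow_pos_of_pos H.ratio_pos _
  have hp1 : ((S : ℝ) / N) ^ (2 / 3 : ℝ) ≤ 1 :=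
    Real.rpow_le_one H.ratio_pos.le H.ratio_le_one (by norm_num)
  refine ⟨by positivity, ?_⟩
  have : K * (1 / (24 * K * ηg * β) * ((S : ℝ) / N) ^ (2 / 3 : ℝ)) * ηg * β
      = ((S : ℝ) / N) ^ (2 / 3 : ℝ) / 24 := by field_simp
  rw [this]
  linarith

theorem nonconvex_error {fs : ℝ} (hfs : ∀ x, fs ≤ objective f x) {R : ℕ} (hg : 1 ≤ ηg)
    (hR : 1 ≤ R) :
    OutputSatisfies P (fun ηl => iterates g S K A Z x₀ (warmStart g K Z x₀) ηl ηg)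
      (1 / (24 * K * ηg * β) * ((S : ℝ) / N) ^ (2 / 3 : ℝ)) R
      (fun x => ‖∇ (objective f) x‖ ^ 2)
      (fun e => e ≤ 10000 * (σ * √(β * (objective f x₀ - fs)) / √(R * K * S) * √(1 + S / ηg ^ 2) +
        β * (objective f x₀ - fs) / R * ((N : ℝ) / S) ^ (2 / 3 : ℝ))) := by
  have hβ := H.β_pos
  have hN := H.N_pos
  have hS := H.S_pos
  have hK := H.K_pos
  have hσ := H.σ_nonneg
  have hg0 : 0 < ηg := by linarith
  have hR0 : (0 : ℝ) < R := by exact_mod_cast hR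
  have hF : 0 ≤ objective f x₀ - fs := sub_nonneg.2 (hfs x₀)
  obtain ⟨hmax, hmax2⟩ := H.nonconvex_max_step hg
  rcases hF.eq_or_lt with hF0 | hF0
  · refine H.start_gradient (H.isStart_warm x₀) hg hmax hmax2 R ?_
    rw [H.gradient_eq_zero_of_eq hfs hF0, ← hF0]
    simp
  set F := objective f x₀ - fs
  rw [H.inv_ratio_rpow]
  set p := ((S : ℝ) / N) ^ (2 / 3 : ℝ) with hp
  have hp0 : 0 < p := Real.rpow_pos_of_pos H.ratio_pos _
  set V := σ ^ 2 / (K * S) * (1 + S / ηg ^ 2) with hV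
  have hV0 : 0 ≤ V := by positivity
  -- The recursion wants 200 in place of the 24 of the stated step-size bound; the smaller cap is
  -- still admissible.
  obtain ⟨a, ha, haa, hle⟩ := exists_step_le (F := 4 * F) (V := β * V) (c := 32) (R := R)
    (a₀ := p / (200 * β)) (by positivity) (by positivity) (by norm_num) hR0 (by positivity)
  have haβ : a * β ≤ p / 200 := by
    rw [le_div_iff₀ (by positivity)] at haa
    linarith
  obtain ⟨h₁, h₂, h₃⟩ := H.nonconvex_step ha.le haβ
  refine H.nonconvex_output hg ha h₁ h₂ h₃ hfs hR ?_ ?_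
  · refine (H.local_step_le hg (b := p / (24 * β)) (haa.trans (by gcongr; norm_num))).trans
      (le_of_eq ?_)
    field_simp
  · intro e he
    refine he.trans (hle.trans ?_)
    have h4 := H.sqrt_variance hg (F := β * F) (by positivity) hR
    rw [← hV] at h4
    have h5 : 4 * F / (p / (200 * β) * R) = 800 * (β * F / R * (1 / p)) := by
      field_simp; norm_num
    have h6 : √(4 * F * (β * V) / R) = 2 * √(β * F * V / R) := by
      rw [show 4 * F * (β * V) / R = 2 ^ 2 * (β * F * V / R) by ring,
        Real.sqrt_mul (by norm_num), Real.sqrt_sq (by norm_num)]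
    rw [h5, h6, ← h4]
    have h7 : 0 ≤ β * F / R * (1 / p) := by positivity
    have h8 := Real.sqrt_nonneg (β * F * V / R)
    linarith

theorem nonconvex_rounds {fs : ℝ} (hfs : ∀ x, fs ≤ objective f x) {ε : ℝ} (R : ℕ) (hε : 0 < ε)
    (hR : 10000 * (β * σ ^ 2 * (objective f x₀ - fs) / (K * S * ε ^ 2) +
      ((N : ℝ) / S) ^ (2 / 3 : ℝ) * (β * (objective f x₀ - fs) / ε)) ≤ R) :
    OutputSatisfies P (fun ηl => iterates g S K A Z x₀ (warmStart g K Z x₀) ηl √S)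
      (1 / (24 * K * √S * β) * ((S : ℝ) / N) ^ (2 / 3 : ℝ)) R
      (fun x => ‖∇ (objective f) x‖ ^ 2) (fun e => e < ε) := by
  have hβ := H.β_pos
  have hN := H.N_pos
  have hS := H.S_pos
  have hK := H.K_pos
  have hg := H.one_le_sqrt_S
  have hg0 : 0 < √(S : ℝ) := by linarith
  have hF : 0 ≤ objective f x₀ - fs := sub_nonneg.2 (hfs x₀)
  obtain ⟨hmax, hmax2⟩ := H.nonconvex_max_step hg
  rcases hF.eq_or_lt with hF0 | hF0
  · refine H.start_gradient (H.isStart_warm x₀) hg hmax hmax2 R ?_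
    rw [H.gradient_eq_zero_of_eq hfs hF0]
    simpa using hε
  rw [H.inv_ratio_rpow] at hR
  set F := objective f x₀ - fs
  set p := ((S : ℝ) / N) ^ (2 / 3 : ℝ) with hp
  have hp0 : 0 < p := Real.rpow_pos_of_pos H.ratio_pos _
  have h0 : 0 < 1 / p * (β * F / ε) := by positivity
  have h1 : 0 ≤ β * σ ^ 2 * F / (K * S * ε ^ 2) := by positivity
  have hR0 : (0 : ℝ) < R := by linarith
  have hR1 : 1 ≤ R := by exact_mod_cast hR0
  set V := β * σ ^ 2 / (K * S * ε) with hV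
  have hV0 : 0 ≤ V := by positivity
  -- The first summand gives aβ ≤ p/200, the second keeps the noise below ε/4.
  set W := 200 * β / p + 256 * V with hW
  have hβp : 0 < 200 * β / p := by positivity
  have hW0 : 0 < W := by positivity
  have haa : 1 / W ≤ p / (200 * β) := by
    rw [show p / (200 * β) = 1 / (200 * β / p) by field_simp]
    exact one_div_le_one_div_of_le hβp (by linarith)
  have haβ : 1 / W * β ≤ p / 200 := by
    rw [le_div_iff₀ (by positivity)] at haa
    linarith
  obtain ⟨h₁, h₂, h₃⟩ := H.nonconvex_step (by positivity) haβ
  refine H.nonconvex_output hg (a := 1 / W) (by positivity) h₁ h₂ h₃ hfs hR1 ?_ ?_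
  · refine (H.local_step_le hg (b := p / (24 * β)) (haa.trans (by gcongr; norm_num))).trans
      (le_of_eq ?_)
    field_simp
  · intro e he
    rw [H.variance_sqrt_S] at he
    refine lt_of_le_of_lt he ?_
    have e2 : 32 * (1 / W * (β * (2 * (σ ^ 2 / (K * S))))) ≤ ε / 4 := by
      have h1 : β * (2 * (σ ^ 2 / (K * S))) = 2 * (ε * V) := by rw [hV]; field_simp
      rw [h1, show 32 * (1 / W * (2 * (ε * V))) = 64 * ε * V / W by ring,
        div_le_div_iff₀ hW0 (by norm_num), hW]
      nlinarith [mul_pos hε hβp]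
    have e3 : 4 * F / (1 / W * R) ≤ ε / 2 := by
      rw [div_le_iff₀ (by positivity)]
      have e5 : 4 * F = 4 * (W * F) * (1 / W) := by field_simp
      have e6 : W * F = ε * (200 * (1 / p * (β * F / ε))
          + 256 * (β * σ ^ 2 * F / (K * S * ε ^ 2))) := by
        rw [hW, hV]; field_simp
      have e7 : 4 * (200 * (1 / p * (β * F / ε)) + 256 * (β * σ ^ 2 * F / (K * S * ε ^ 2)))
          ≤ R / 2 := by linarith
      calc 4 * F = ε * (4 * (200 * (1 / p * (β * F / ε))
            + 256 * (β * σ ^ 2 * F / (K * S * ε ^ 2)))) * (1 / W) := by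
            rw [e5, e6]; ring
        _ ≤ ε * (R / 2) * (1 / W) := by gcongr
        _ = ε / 2 * (1 / W * R) := by ring
    linarith

end Setting

end Scaffold

theorem theorem3 :
    ∃ C : ℝ, 0 < C ∧
    ∀ (d N S K : ℕ) (Ω : Type*) (Ξ : Type*) [MeasurableSpace Ω] [MeasurableSpace Ξ]
      (P : Measure Ω) [IsProbabilityMeasure P]
      (ν : Fin N → Measure Ξ) [∀ i, IsProbabilityMeasure (ν i)]
      (A : ℕ → Ω → Finset (Fin N)) (Z : ℕ → Fin N → ℕ → Ω → Ξ)
      (f : Fin N → Scaffold.Vec d → ℝ)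
      (g : Fin N → Scaffold.Vec d → Ξ → Scaffold.Vec d)
      (β σ : ℝ) (x₀ : Scaffold.Vec d),
      1 ≤ S → S ≤ N → 1 ≤ K → 0 < β → 0 ≤ σ →
      (∀ i, Scaffold.IsSmooth β (f i)) →
      Scaffold.IsStochasticGradient σ f ν g →
      Scaffold.IsSampling P S ν A Z →
      -- Strongly convex case.
      (∀ (μ : ℝ) (xs : Scaffold.Vec d), 0 < μ → (∀ i, Scaffold.IsMuConvex μ (f i)) →
        (∀ x, Scaffold.objective f xs ≤ Scaffold.objective f x) →
        -- error bound, any initial control variates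
        (∀ (c₀ : Fin N → Scaffold.Vec d) (ηg : ℝ) (R : ℕ), 1 ≤ ηg →
          max (162 * β / μ) (30 * N / S) ≤ (R : ℝ) →
          Scaffold.OutputSatisfies P
            (fun ηl => Scaffold.iterates g S K A Z x₀ (fun i _ => c₀ i) ηl ηg)
            (min (1 / (81 * β * K * ηg)) (S / (15 * μ * N * K * ηg))) R
            (fun x => Scaffold.objective f x - Scaffold.objective f xs)
            (fun e => e ≤ C *
              (σ ^ 2 / (μ * R * K * S) * (1 + S / ηg ^ 2) *
                  Real.log (Real.exp 1 +
                    μ ^ 2 * R * N * K * Scaffold.initDistSq f β x₀ xs c₀ / σ ^ 2) +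
                N * μ / S * Scaffold.initDistSq f β x₀ xs c₀ *
                  Real.exp (-(min ((S : ℝ) / (30 * N)) (μ / (162 * β)) * R))))) ∧
        -- number of rounds, warm start
        (∀ (ε : ℝ) (R : ℕ), 0 < ε →
          C * (σ ^ 2 / (μ * K * S * ε) + β / μ + N / S) *
              Real.log (Real.exp 1 + N * μ * ‖x₀ - xs‖ ^ 2 / (S * ε)) ≤ R →
          Scaffold.OutputSatisfies P
            (fun ηl => Scaffold.iterates g S K A Z x₀ (Scaffold.warmStart g K Z x₀) ηl √S)
            (min (1 / (81 * β * K * √S)) (S / (15 * μ * N * K * √S))) R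
            (fun x => Scaffold.objective f x - Scaffold.objective f xs)
            (fun e => e < ε))) ∧
      -- General convex case.
      (∀ xs : Scaffold.Vec d, (∀ i, Scaffold.IsMuConvex 0 (f i)) →
        (∀ x, Scaffold.objective f xs ≤ Scaffold.objective f x) →
        -- error bound, any initial control variates
        (∀ (c₀ : Fin N → Scaffold.Vec d) (ηg : ℝ) (R : ℕ), 1 ≤ ηg → 1 ≤ R →
          Scaffold.OutputSatisfies P
            (fun ηl => Scaffold.iterates g S K A Z x₀ (fun i _ => c₀ i) ηl ηg)
            (1 / (81 * β * K * ηg)) R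
            (fun x => Scaffold.objective f x - Scaffold.objective f xs)
            (fun e => e ≤ C *
              (σ * √(Scaffold.initDistSq f β x₀ xs c₀) / √(R * K * S) * √(1 + S / ηg ^ 2) +
                √(N / S) * (β * Scaffold.initDistSq f β x₀ xs c₀ / R)))) ∧
        -- number of rounds, warm start
        (∀ (ε : ℝ) (R : ℕ), 0 < ε →
          C * (σ ^ 2 * ‖x₀ - xs‖ ^ 2 / (K * S * ε ^ 2) + β * ‖x₀ - xs‖ ^ 2 / ε +
              N * (Scaffold.objective f x₀ - Scaffold.objective f xs) / (S * ε)) ≤ R →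
          Scaffold.OutputSatisfies P
            (fun ηl => Scaffold.iterates g S K A Z x₀ (Scaffold.warmStart g K Z x₀) ηl √S)
            (1 / (81 * β * K * √S)) R
            (fun x => Scaffold.objective f x - Scaffold.objective f xs)
            (fun e => e < ε))) ∧
      -- Non-convex case, warm start.
      (∀ fs : ℝ, (∀ x, fs ≤ Scaffold.objective f x) →
        -- error bound
        (∀ (ηg : ℝ) (R : ℕ), 1 ≤ ηg → 1 ≤ R →
          Scaffold.OutputSatisfies P
            (fun ηl => Scaffold.iterates g S K A Z x₀ (Scaffold.warmStart g K Z x₀) ηl ηg)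
            (1 / (24 * K * ηg * β) * ((S : ℝ) / N) ^ (2 / 3 : ℝ)) R
            (fun x => ‖∇ (Scaffold.objective f) x‖ ^ 2)
            (fun e => e ≤ C *
              (σ * √(β * (Scaffold.objective f x₀ - fs)) / √(R * K * S) * √(1 + S / ηg ^ 2) +
                β * (Scaffold.objective f x₀ - fs) / R * ((N : ℝ) / S) ^ (2 / 3 : ℝ)))) ∧
        -- number of rounds
        (∀ (ε : ℝ) (R : ℕ), 0 < ε →
          C * (β * σ ^ 2 * (Scaffold.objective f x₀ - fs) / (K * S * ε ^ 2) +
              ((N : ℝ) / S) ^ (2 / 3 : ℝ) * (β * (Scaffold.objective f x₀ - fs) / ε)) ≤ R →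
          Scaffold.OutputSatisfies P
            (fun ηl => Scaffold.iterates g S K A Z x₀ (Scaffold.warmStart g K Z x₀) ηl √S)
            (1 / (24 * K * √S * β) * ((S : ℝ) / N) ^ (2 / 3 : ℝ)) R
            (fun x => ‖∇ (Scaffold.objective f) x‖ ^ 2)
            (fun e => e < ε))) := by
  -- One generous constant for all six bounds; the largest demand, 8 · 256, comes from
  -- `nonconvex_rounds`.
  refine ⟨10000, by norm_num, ?_⟩
  intro d N S K Ω Ξ _ _ P _ ν _ A Z f g β σ x₀ hS hSN hK hβ hσ hf hg hA
  have H : Scaffold.Setting P S K ν A Z f g β σ := ⟨hS, hSN, hK, hβ, hσ, hf, hg, hA⟩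
  exact ⟨fun μ xs hμ hc hxs =>
      ⟨fun c₀ ηg R hηg hR => H.strongly_convex_error hμ hc hxs c₀ R hηg hR,
        fun ε R hε hR => H.strongly_convex_rounds hμ hc hxs R hε hR⟩,
    fun xs hc hxs => ⟨fun c₀ ηg R hηg hR => H.convex_error hc hxs c₀ hηg hR,
      fun ε R hε hR => H.convex_rounds hc hxs R hε hR⟩,
    fun fs hfs => ⟨fun ηg R hηg hR => H.nonconvex_error hfs hηg hR,
      fun ε R hε hR => H.nonconvex_rounds hfs R hε hR⟩⟩
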